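/- Let $\mathsf k$ be a nonzero commutative Noetherian ring and let $Q$ be a finite quiver without oriented cycles. For each pair of vertices $(v,w)$ let a collection of pairwise disjoint sets of paths from $v$ to $w$ be given, let $I\subset \mathsf kQ$ be the two-sided ideal generated by all differences $p-p'$ of two paths in the same set, and let $A=\mathsf kQ/I$ (products are concatenations, first path first). Assume that $A$ is a homotopy path algebra: for all paths $r,p,p'$, if $rp-rp'$ is nonzero and lies in $I$, or $pr-p'r$ is nonzero and lies in $I$, then $p-p'\in I$. Identify parallel paths $p,p'$ with $p-p'\in I$, and call the classes paths in $A$; write $t(p)$ and $h(p)$ for the tail and the head of $p$. Paths in $A$ with a fixed tail $v$ form a poset, with $p\le q$ iff $q=pr$ for some path $r$; the trivial path $e_v$ is its least element. A path in $A$ is irreducible if it is nontrivial and is not a product of two nontrivial paths; a path has length $n$ if it is a product of $n$ irreducible paths. (If no arrow of $Q$ is identified with another path, the irreducible paths are the arrows.) Let $A_n\subset A$ be the $\mathsf k$-span of the paths of length $n$. Let $X_A$ be the classifying space of the category with object set $Q_0$ and the paths in $A$ as morphisms. Its $n$-cells are the chains $[e_v=p_0<p_1<\dots<p_n]$ of paths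 with tail $v$; such a cell $\eta$ has tail $t(\eta)=v$ and head $h(\eta)=h(p_n)$. Its facets, with incidence numbers $(-1)^i$ and coefficients $l\otimes r$, are: $[e_{h(p_1)}<p_2/p_1<\dots<p_n/p_1]$ with $i=0$ and $p_1\otimes 1$; the chain without $p_i$ with $1\otimes 1$, for $0<i<n$; and $[p_0<\dots<p_{n-1}]$ with $i=n$ and $1\otimes p_n/p_{n-1}$. Assume that for every path $p$ in $A$ the order complex of the open interval $(e_{t(p)},p)$ is (pure) shellable or a finite, possibly empty, set of points. Then: 1. $A=\bigoplus_n A_n$ is a graded algebra and is Koszul: the left module $A/\bigoplus_{n>0}A_n$ has a graded projective resolution whose $i$-th term is generated in degree $i$, for all $i\ge 0$. 2. For every $p$ there is an ordering of the maximal chains of $(e_{t(p)},p)$ (the facets of its order complex) that is a shelling. Choose any such ordering for every $p$. Let $M_p$ be the associated Babson–Hersh matching of nonempty chains: given a nonempty chain $t$, let $F$ be the first maximal chain containing it; the inclusion-minimal sets $F\setminus F'$, with $F'$ an earlier maximal chain, are the minimal skipped intervals of $F$. Truncate them to disjoint $J$-intervals by repeatedly selecting the lowest one, deleting its elements from the others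 and discarding those that are no longer minimal. Then $t$ is matched by adding or removing the least element of the first $J$-interval that $t$ does not meet exactly in its least element, or, if there is none, the least element of $F$ outside all $J$-intervals, if there is one; the empty chain is not matched. For each nonempty interval choose moreover a point $b_p$ such that the chain $\{b_p\}$ is unmatched. The Babson–Hersh matching $\overline M$ of the cells of $X_A$ pairs $[e<s<p]$ with $[e<t<p]$ if $M_p$ matches the chains $s$ and $t$, and pairs $[e<b_p<p]$ with $[e<p]$. For all these choices $\overline M$ is an acyclic matching, and its Morse complex of bimodules $$\mathfrak C_n=\bigoplus_{\eta\text{ critical }n\text{-cell}} Ae_{t(\eta)}\otimes_{\mathsf k} e_{h(\eta)}A,\qquad \delta_n(1\otimes[\eta]\otimes 1)=\sum_{\eta'}\ \sum_{\gamma\colon\eta\to\eta'}\epsilon(\gamma)\,l(\gamma)\otimes[\eta']\otimes r(\gamma),$$ where $\eta'$ runs over the critical $(n-1)$-cells, $\gamma$ over the discrete gradient paths, $\epsilon(\gamma)$ is the usual multiplicity of $\gamma$ in the discrete Morse complex, and $l(\gamma)$, $r(\gamma)$ are the products of the left and right coefficients of the downward steps of $\gamma$, is, with the multiplication map $\mathfrak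 C_0\to A$, a projective resolution of $A$ as an $A\otimes_{\mathsf k}A^{op}$-module. It is minimal: the components of every $\delta_n$ lie in the ideal generated by the arrows. -/

import Mathlib

open scoped TensorProduct

noncomputable section

namespace HPA

open Quiver

universe w v u

/-! ### Shellability and the order complex -/

section Simplicial

variable {α : Type*}

/-- The facets (inclusion-maximal faces) of a simplicial complex. -/
def facets (K : PreAbstractSimplicialComplex α) : Set (Finset α) :=
  {F | Maximal (· ∈ K.faces) F}

/-- `L` lists every facet of `K` exactly once, i.e. it is a total ordering of the facets. -/
def IsFacetOrder (K : PreAbstractSimplicialComplex α) (L : List (Finset α)) : Prop :=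
  L.Nodup ∧ ∀ F, F ∈ L ↔ F ∈ facets K

open Classical in
/-- `L = F₁, …, Fₙ` is a shelling: all `Fⱼ` have the same dimension, and for `j > 1` the
intersection of `Fⱼ` with the union of the earlier facets is pure of codimension one in `Fⱼ`. -/
def IsShelling (L : List (Finset α)) : Prop :=
  (∀ F ∈ L, ∀ F' ∈ L, F.card = F'.card) ∧
  ∀ (E : List (Finset α)) (F : Finset α) (R : List (Finset α)), L = E ++ F :: R →
    ∀ F' ∈ E, ∃ F'' ∈ E, ∃ x ∈ F, F' ∩ F ⊆ F.erase x ∧ F'' ∩ F = F.erase x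

/-- A (pure) shellable finite simplicial complex. -/
def IsShellable (K : PreAbstractSimplicialComplex α) : Prop :=
  ∃ L, IsFacetOrder K L ∧ IsShelling L

/-- The simplicial complex is a (possibly empty) finite set of points. -/
def IsFinitePointSet (K : PreAbstractSimplicialComplex α) : Prop :=
  K.faces.Finite ∧ ∀ s ∈ K.faces, s.card = 1

/-- The order complex of a subset `P` of a poset: its faces are the nonempty finite chains. -/
def orderComplex [PartialOrder α] (P : Set α) : PreAbstractSimplicialComplex α where
  faces := {s | s.Nonempty ∧ (s : Set α) ⊆ P ∧ IsChain (· ≤ ·) (s : Set α)}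
  isRelLowerSet_faces := by
    rintro s ⟨hs, hP, hc⟩
    refine ⟨hs, fun t hts ht => ⟨ht, ?_, ?_⟩⟩
    · exact (Finset.coe_subset.2 hts).trans hP
    · exact hc.mono (Finset.coe_subset.2 hts)

end Simplicial

/-! ### The Babson–Hersh matching of an ordered order complex -/

section BabsonHersh

variable {α : Type*} [PartialOrder α]

open Classical in
/-- The minimal skipped sets of a facet `F` preceded by the facets in `E`: the inclusion-minimal
sets among the `F \ F'`, `F' ∈ E` (these are rank intervals of `F` for a lexicographic order).
A face of `F` lies in no earlier facet iff it meets each of them. -/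
def minimalSkipped (E : List (Finset α)) (F : Finset α) : Set (Finset α) :=
  {I | Minimal (fun I => ∃ F' ∈ E, I = F \ F') I}

open Classical in
/-- `JIntervals 𝓘 js`: truncating the family `𝓘` of skipped intervals yields the list `js` of
pairwise disjoint intervals. One repeatedly moves the lowest member `J` to the list, deletes the
elements of `J` from the other members, and discards what is no longer minimal. -/
inductive JIntervals : Set (Finset α) → List (Finset α) → Prop
  | nil : JIntervals ∅ []
  | cons {𝓘 : Set (Finset α)} {J : Finset α} {x : α} {js : List (Finset α)}
      (hJ : J ∈ 𝓘) (hx : x ∈ J) (hlow : ∀ I ∈ 𝓘, ∀ y ∈ I, x ≤ y)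
      (hrest : JIntervals {K | Minimal (fun K => ∃ I ∈ 𝓘, I ≠ J ∧ K = I \ J) K} js) :
      JIntervals 𝓘 (J :: js)

open Classical in
/-- The face `s` meets the interval `J` exactly in the least element of `J`. -/
def MeetsInLeast (s J : Finset α) : Prop :=
  ∃ x, IsLeast (J : Set α) x ∧ s ∩ J = {x}

open Classical in
/-- `x` is the element toggled by the matching at the face `s` of the facet `F`: the least element
of the first `J`-interval that `s` does not meet exactly in its least element or, if there is
no such interval, the least element of `F` outside all `J`-intervals. -/
def IsPivot (js : List (Finset α)) (F s : Finset α) (x : α) : Prop :=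
  (∃ (as : List (Finset α)) (J : Finset α) (bs : List (Finset α)), js = as ++ J :: bs ∧
    (∀ K ∈ as, MeetsInLeast s K) ∧ ¬ MeetsInLeast s J ∧ IsLeast (J : Set α) x) ∨
  ((∀ K ∈ js, MeetsInLeast s K) ∧ IsLeast {y : α | y ∈ F ∧ ∀ K ∈ js, y ∉ K} x)

open Classical in
/-- The Babson–Hersh matching for the ordering `L` of the facets: `t` is matched with
`s = t ∪ {x}`, where `F` is the first facet containing `t` and `x ∉ t` is the toggled element.
Only nonempty faces are matched. -/
def BHMatched (L : List (Finset α)) (s t : Finset α) : Prop :=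
  t.Nonempty ∧ ∃ (E : List (Finset α)) (F : Finset α) (R js : List (Finset α)) (x : α),
    L = E ++ F :: R ∧ t ⊆ F ∧ (∀ F' ∈ E, ¬ t ⊆ F') ∧
    JIntervals (minimalSkipped E F) js ∧ IsPivot js F t x ∧ x ∉ t ∧ s = insert x t

end BabsonHersh

/-! ### Path algebras -/

/-- A quiver without oriented cycles. -/
class AcyclicQuiver (V : Type u) [Quiver.{v} V] : Prop where
  eq_nil : ∀ {a : V} (p : Path a a), p = Path.nil

/-- All paths of the quiver, with their tail and head. -/
abbrev AnyPath (V : Type u) [Quiver.{v} V] := Σ a b : V, Path a b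

/-- The path algebra: free on the set of paths. The product is concatenation, first factor first. -/
def PathAlgebra (k : Type w) (V : Type u) [Quiver.{v} V] [CommRing k] := AnyPath V →₀ k

section PathAlgebra

variable (k : Type w) (V : Type u) [Quiver.{v} V] [CommRing k]

instance : AddCommGroup (PathAlgebra k V) := inferInstanceAs (AddCommGroup (AnyPath V →₀ k))
instance : Module k (PathAlgebra k V) := inferInstanceAs (Module k (AnyPath V →₀ k))

variable {V}

/-- The basis element of the path algebra given by a path. -/
def ofPath {a b : V} (p : Path a b) : PathAlgebra k V :=
  Finsupp.single (⟨a, b, p⟩ : AnyPath V) (1 : k)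

variable (V)

open Classical in
/-- The product of two paths: their concatenation, or zero if they cannot be concatenated. -/
def mulPath (p q : AnyPath V) : AnyPath V →₀ k :=
  if h : p.2.1 = q.1 then
    Finsupp.single ⟨p.1, q.2.1, p.2.2.comp (q.2.2.cast h.symm rfl)⟩ 1
  else 0

/-- The bilinear extension of `mulPath`. -/
def mulHom : (AnyPath V →₀ k) →ₗ[k] (AnyPath V →₀ k) →ₗ[k] (AnyPath V →₀ k) :=
  Finsupp.lift ((AnyPath V →₀ k) →ₗ[k] (AnyPath V →₀ k)) k (AnyPath V) fun p =>
    Finsupp.lift (AnyPath V →₀ k) k (AnyPath V) fun q => mulPath k V p q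

instance : Mul (PathAlgebra k V) := ⟨fun x y => mulHom k V x y⟩

variable {V}

/-- Multiplication of the path algebra as a bilinear map. -/
def mulLin : PathAlgebra k V →ₗ[k] PathAlgebra k V →ₗ[k] PathAlgebra k V := mulHom k V

theorem mul_eq (x y : PathAlgebra k V) : x * y = mulLin k x y := rfl

theorem mulHom_single (p q : AnyPath V) :
    mulHom k V (Finsupp.single p 1) (Finsupp.single q 1) = mulPath k V p q := by
  simp [mulHom]

theorem ofPath_mul_eq {a b c d : V} (p : Path a b) (q : Path c d) :
    ofPath k p * ofPath k q = mulPath k V ⟨a, b, p⟩ ⟨c, d, q⟩ :=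
  mulHom_single k _ _

theorem ofPath_mul_ofPath {a b c : V} (p : Path a b) (q : Path b c) :
    ofPath k p * ofPath k q = ofPath k (p.comp q) := by
  rw [ofPath_mul_eq]
  simp [mulPath]
  rfl

theorem ofPath_mul_of_ne {a b c d : V} (p : Path a b) (q : Path c d) (h : b ≠ c) :
    ofPath k p * ofPath k q = 0 := by
  rw [ofPath_mul_eq]
  simp only [mulPath, h, dite_false]
  rfl

theorem path_induction {P : PathAlgebra k V → Prop} (x : PathAlgebra k V) (zero : P 0)
    (add : ∀ x y, P x → P y → P (x + y))
    (smul : ∀ (r : k) {a b : V} (p : Path a b), P (r • ofPath k p)) : P x := by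
  refine Finsupp.induction_linear x zero add fun p r => ?_
  have h : (Finsupp.single p r : AnyPath V →₀ k) = r • Finsupp.single p 1 := by simp
  have h' := smul r p.2.2
  rw [show (r • ofPath k p.2.2 : PathAlgebra k V) = (Finsupp.single p r : AnyPath V →₀ k)
    from h.symm] at h'
  exact h'

theorem path_add_mul (x y z : PathAlgebra k V) : (x + y) * z = x * z + y * z := by
  simp [mul_eq]
theorem path_mul_add (x y z : PathAlgebra k V) : x * (y + z) = x * y + x * z := by
  simp [mul_eq]
theorem path_zero_mul (x : PathAlgebra k V) : 0 * x = 0 := by simp [mul_eq]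
theorem path_mul_zero (x : PathAlgebra k V) : x * 0 = 0 := by simp [mul_eq]
theorem path_smul_mul (r : k) (x y : PathAlgebra k V) : (r • x) * y = r • (x * y) := by
  simp [mul_eq]
theorem path_mul_smul (r : k) (x y : PathAlgebra k V) : x * (r • y) = r • (x * y) := by
  simp [mul_eq]

theorem ofPath_assoc {a b c d e f : V} (p : Path a b) (q : Path c d) (r : Path e f) :
    ofPath k p * ofPath k q * ofPath k r = ofPath k p * (ofPath k q * ofPath k r) := by
  by_cases h : b = c
  · subst h
    by_cases h' : d = e
    · subst h'
      simp [ofPath_mul_ofPath]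
    · rw [ofPath_mul_ofPath, ofPath_mul_of_ne k _ _ h', ofPath_mul_of_ne k _ _ h', path_mul_zero]
  · by_cases h' : d = e
    · subst h'
      rw [ofPath_mul_ofPath, ofPath_mul_of_ne k _ _ h, ofPath_mul_of_ne k _ _ h, path_zero_mul]
    · rw [ofPath_mul_of_ne k _ _ h, ofPath_mul_of_ne k _ _ h', path_mul_zero, path_zero_mul]

theorem path_mul_assoc (x y z : PathAlgebra k V) : x * y * z = x * (y * z) := by
  induction x using path_induction with
  | zero => simp only [path_zero_mul]
  | add x x' h h' => simp only [path_add_mul, h, h']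
  | smul r p =>
    induction y using path_induction with
    | zero => simp only [path_zero_mul, path_mul_zero]
    | add x x' h h' => simp only [path_add_mul, path_mul_add, h, h']
    | smul s q =>
      induction z using path_induction with
      | zero => simp only [path_mul_zero]
      | add x x' h h' => simp only [path_mul_add, h, h']
      | smul t q' => simp only [path_smul_mul, path_mul_smul, ofPath_assoc]

variable [Fintype V]

instance : One (PathAlgebra k V) := ⟨∑ a : V, ofPath k (Path.nil : Path a a)⟩

theorem one_eq : (1 : PathAlgebra k V) = ∑ a : V, ofPath k (Path.nil : Path a a) := rfl

theorem path_one_mul (x : PathAlgebra k V) : 1 * x = x := by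
  induction x using path_induction with
  | zero => exact path_mul_zero k _
  | add x y hx hy => rw [path_mul_add, hx, hy]
  | @smul r a b p =>
    rw [path_mul_smul, one_eq, mul_eq, map_sum, LinearMap.sum_apply, Finset.sum_eq_single a]
    · rw [← mul_eq, ofPath_mul_ofPath, Path.nil_comp]
    · intro c _ hc
      rw [← mul_eq, ofPath_mul_of_ne k _ _ hc]
    · simp

theorem path_mul_one (x : PathAlgebra k V) : x * 1 = x := by
  induction x using path_induction with
  | zero => exact path_zero_mul k _
  | add x y hx hy => rw [path_add_mul, hx, hy]
  | @smul r a b p =>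
    rw [path_smul_mul, one_eq, mul_eq, map_sum, Finset.sum_eq_single b]
    · rw [← mul_eq, ofPath_mul_ofPath, Path.comp_nil]
    · intro c _ hc
      rw [← mul_eq, ofPath_mul_of_ne k _ _ (Ne.symm hc)]
    · simp

instance : Ring (PathAlgebra k V) :=
  { (inferInstance : AddCommGroup (PathAlgebra k V)),
    (inferInstance : Mul (PathAlgebra k V)),
    (inferInstance : One (PathAlgebra k V)) with
    left_distrib := path_mul_add k
    right_distrib := path_add_mul k
    zero_mul := path_zero_mul k
    mul_zero := path_mul_zero k
    mul_assoc := path_mul_assoc k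
    one_mul := path_one_mul k
    mul_one := path_mul_one k }

instance : Algebra k (PathAlgebra k V) := Algebra.ofModule (path_smul_mul k) (path_mul_smul k)

end PathAlgebra

/-! ### Homotopy path algebras -/

/-- For each pair of vertices, a collection of pairwise disjoint sets of parallel paths. -/
structure PathRelations (V : Type u) [Quiver.{v} V] where
  sets : ∀ a b : V, Set (Set (Path a b))
  disjoint : ∀ a b, (sets a b).PairwiseDisjoint id

section Algebra

variable (k : Type w) {V : Type u} [Quiver.{v} V] [CommRing k] [Fintype V] (S : PathRelations V)

/-- The ideal of the path algebra generated by the differences of paths in the same set of `S`. -/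
def relIdeal : TwoSidedIdeal (PathAlgebra k V) :=
  TwoSidedIdeal.span {x | ∃ (a b : V) (T : Set (Path a b)) (p q : Path a b),
    T ∈ S.sets a b ∧ p ∈ T ∧ q ∈ T ∧ x = ofPath k p - ofPath k q}

/-- The quiver algebra of `S`: the path algebra modulo the ideal of `S`. -/
abbrev QuiverAlgebra : Type (max u v w) := (relIdeal k S).ringCon.Quotient

/-- The quotient map. -/
abbrev proj : PathAlgebra k V →ₐ[k] QuiverAlgebra k S := (relIdeal k S).ringCon.mkₐ (α := k)

/-- The quiver algebra is a homotopy path algebra. -/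
structure IsHPA : Prop where
  left_cancel : ∀ {a b c d e f : V} (r : Path a b) (p : Path c d) (p' : Path e f),
    ofPath k r * ofPath k p - ofPath k r * ofPath k p' ≠ 0 →
    ofPath k r * ofPath k p - ofPath k r * ofPath k p' ∈ relIdeal k S →
    ofPath k p - ofPath k p' ∈ relIdeal k S
  right_cancel : ∀ {a b c d e f : V} (r : Path a b) (p : Path c d) (p' : Path e f),
    ofPath k p * ofPath k r - ofPath k p' * ofPath k r ≠ 0 →
    ofPath k p * ofPath k r - ofPath k p' * ofPath k r ∈ relIdeal k S →
    ofPath k p - ofPath k p' ∈ relIdeal k S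

/-- Two parallel paths are identified when their difference lies in the ideal. -/
def pathSetoid (a b : V) : Setoid (Path a b) where
  r p q := ofPath k p - ofPath k q ∈ relIdeal k S
  iseqv :=
    { refl := fun p => by simp
      symm := fun {p q} h => by simpa using (relIdeal k S).neg_mem h
      trans := fun {p q r} h h' => by simpa using (relIdeal k S).add_mem h h' }

/-- Paths in the algebra from `a` to `b`: the morphisms of the path category. -/
def PathClass (a b : V) : Type (max u v) := Quotient (pathSetoid k S a b)

variable {k S}

namespace PathClass

/-- The class of a path. -/
def mk {a b : V} (p : Path a b) : PathClass k S a b := Quotient.mk (pathSetoid k S a b) p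

/-- The trivial path at `a`. -/
def id (a : V) : PathClass k S a a := mk Path.nil

/-- Concatenation of path classes. -/
def comp {a b c : V} : PathClass k S a b → PathClass k S b c → PathClass k S a c :=
  Quotient.map₂ Path.comp fun p p' (hp : _ ∈ _) q q' (hq : _ ∈ _) => by
    change ofPath k (p.comp q) - ofPath k (p'.comp q') ∈ relIdeal k S
    have h1 := (relIdeal k S).mul_mem_right _ (ofPath k q) hp
    have h2 := (relIdeal k S).mul_mem_left (ofPath k p') _ hq
    have h := (relIdeal k S).add_mem h1 h2
    simpa [sub_mul, mul_sub, ofPath_mul_ofPath] using h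

/-- The element of the algebra given by a path class. -/
def toAlg {a b : V} (p : PathClass k S a b) : QuiverAlgebra k S :=
  Quotient.lift (fun p : Path a b => proj k S (ofPath k p)) (fun p q (h : _ ∈ _) => by
    refine (RingCon.eq _).2 ?_
    exact ((relIdeal k S).rel_iff _ _).2 h) p

theorem comp_assoc {a b c d : V} (p : PathClass k S a b) (q : PathClass k S b c)
    (r : PathClass k S c d) : (p.comp q).comp r = p.comp (q.comp r) := by
  induction p using Quotient.inductionOn
  induction q using Quotient.inductionOn
  induction r using Quotient.inductionOn
  exact congrArg mk (Path.comp_assoc _ _ _)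

theorem comp_id {a b : V} (p : PathClass k S a b) : p.comp (id b) = p := by
  induction p using Quotient.inductionOn
  rfl

theorem id_comp {a b : V} (p : PathClass k S a b) : (id a).comp p = p := by
  induction p using Quotient.inductionOn
  exact congrArg mk (Path.nil_comp _)

end PathClass

variable (k S)

/-- The path poset at a vertex `a`: all path classes with tail `a`. -/
structure PathsFrom (a : V) where
  head : V
  path : PathClass k S a head

variable {k S}

variable [AcyclicQuiver V]

theorem PathsFrom.eq_of_comp {a b c : V} (p : PathClass k S a b) (r : PathClass k S b c)
    (s : PathClass k S c b) : (⟨b, p⟩ : PathsFrom k S a) = ⟨c, p.comp r⟩ := by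
  obtain ⟨r, rfl⟩ := Quotient.exists_rep r
  obtain ⟨s, rfl⟩ := Quotient.exists_rep s
  have h := congrArg Path.length (AcyclicQuiver.eq_nil (r.comp s))
  simp only [Path.length_comp, Path.length_nil, Nat.add_eq_zero_iff] at h
  obtain rfl := Path.eq_of_length_zero r h.1
  obtain rfl := AcyclicQuiver.eq_nil r
  exact congrArg _ (PathClass.comp_id p).symm

/-- `p ≤ q` iff `q = p r` for some path `r`. -/
instance (a : V) : PartialOrder (PathsFrom k S a) where
  le p q := ∃ r : PathClass k S p.head q.head, q.path = p.path.comp r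
  le_refl p := ⟨PathClass.id _, (PathClass.comp_id _).symm⟩
  le_trans p q r := by
    rintro ⟨s, hs⟩ ⟨t, ht⟩
    exact ⟨s.comp t, by rw [ht, hs, PathClass.comp_assoc]⟩
  le_antisymm := by
    rintro p q ⟨r, hr⟩ ⟨s, -⟩
    have h := PathsFrom.eq_of_comp p.path r s
    rwa [← hr] at h

instance (a : V) : OrderBot (PathsFrom k S a) where
  bot := ⟨a, PathClass.id a⟩
  bot_le p := ⟨p.path, (PathClass.id_comp _).symm⟩

namespace PathClass

/-- The path class as an element of the path poset at its tail. -/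
def toPoset {a b : V} (p : PathClass k S a b) : PathsFrom k S a := ⟨b, p⟩

/-- The open interval of all `q` with `e < q < p`, where `e` is the trivial path at the tail. -/
def openInterval {a b : V} (p : PathClass k S a b) : Set (PathsFrom k S a) :=
  Set.Ioo ⊥ p.toPoset

/-- A path class is irreducible if it is nontrivial and not a product of two nontrivial ones. -/
def IsIrreducible {a b : V} (p : PathClass k S a b) : Prop :=
  (⊥ : PathsFrom k S a) ⋖ p.toPoset

/-- `HasLength p n`: the path class `p` is a product of `n` irreducible ones. -/
inductive HasLength : ∀ {a b : V}, PathClass k S a b → ℕ → Prop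
  | id (a : V) : HasLength (PathClass.id a) 0
  | comp {a b c : V} {p : PathClass k S a b} {n : ℕ} {r : PathClass k S b c}
      (hp : HasLength p n) (hr : IsIrreducible r) : HasLength (p.comp r) (n + 1)

end PathClass

variable (k S)

/-- The grading of the algebra by path length. -/
def lengthGrading (n : ℕ) : Submodule k (QuiverAlgebra k S) :=
  Submodule.span k {x | ∃ (a b : V) (p : PathClass k S a b), p.HasLength n ∧ x = p.toAlg}

end Algebra

/-! ### Koszul algebras -/

/-- `A` is Koszul with respect to the family `𝒜`: `𝒜` is a grading of `A` as an algebra, and the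
left module `A₀ = A / A_{>0}` has a graded projective resolution
`⋯ → P 1 → P 0 → A₀ → 0` that is linear, i.e. `P i` is generated by its component of degree `i`. -/
def IsKoszul {k : Type*} {A : Type u} [CommRing k] [Ring A] [Algebra k A]
    (𝒜 : ℕ → Submodule k A) : Prop :=
  Nonempty (GradedAlgebra 𝒜) ∧
  ∃ (P : ℕ → Type u) (_ : ∀ i, AddCommGroup (P i)) (_ : ∀ i, Module A (P i))
    (𝒢 : ∀ i, ℕ → AddSubgroup (P i))
    (d : ∀ i, P (i + 1) →ₗ[A] P i)
    (ε : P 0 →ₗ[A] A ⧸ Ideal.span (⋃ n : ℕ, (𝒜 (n + 1) : Set A))),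
    (∀ i, Module.Projective A (P i)) ∧
    (∀ i, DirectSum.IsInternal (𝒢 i)) ∧
    (∀ i m n, ∀ a ∈ 𝒜 m, ∀ x ∈ 𝒢 i n, a • x ∈ 𝒢 i (m + n)) ∧
    (∀ i n, ∀ x ∈ 𝒢 (i + 1) n, d i x ∈ 𝒢 i n) ∧
    (∀ i, Submodule.span A (𝒢 i i : Set (P i)) = ⊤) ∧
    Function.Surjective ε ∧ Function.Exact (d 0) ε ∧ ∀ i, Function.Exact (d (i + 1)) (d i)

/-! ### Cells of the geometric realization -/

section Cells

variable (k : Type w) {V : Type u} [Quiver.{v} V] [CommRing k] [Fintype V] (S : PathRelations V)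
  [AcyclicQuiver V]

/-- A cell of the geometric realization with tail `a` and head `b`, given by its canonical
representative `[e_a = p₀ < p₁ < ⋯ < pₙ]`, where `pₙ = top` is a path from `a` to `b`. -/
@[ext]
structure Cell (a b : V) where
  top : PathClass k S a b
  verts : Finset (PathsFrom k S a)
  chain : IsChain (· ≤ ·) (verts : Set (PathsFrom k S a))
  bot_mem : ⊥ ∈ verts
  isGreatest : IsGreatest (verts : Set (PathsFrom k S a)) top.toPoset

/-- All cells, with their tail and head. -/
abbrev AnyCell := Σ a b : V, Cell k S a b

variable {k S}

/-- The dimension of a cell. -/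
def Cell.dim {a b : V} (σ : Cell k S a b) : ℕ := σ.verts.card - 1

open Classical in
/-- The chain `p₁ < ⋯ < pₙ₋₁` in the open interval below `pₙ`. -/
def Cell.inner {a b : V} (σ : Cell k S a b) : Finset (PathsFrom k S a) :=
  (σ.verts.erase ⊥).erase σ.top.toPoset

open Classical in
/-- `Facet σ τ`: a way in which `τ` is a facet of the cell `σ = [p₀ < ⋯ < pₙ]`.
* `initial`: `τ = [e < p₂/p₁ < ⋯ < pₙ/p₁]`, where `r = p₁`;
* `internal`: `τ` omits `pᵢ = x`, `0 < i < n`;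
* `terminal`: `τ` omits `pₙ`, where `r = pₙ/pₙ₋₁`. -/
inductive Facet : AnyCell k S → AnyCell k S → Type (max u v)
  | initial {a b c : V} (r : PathClass k S a b) (hr : ⊥ < r.toPoset)
      (σ : Cell k S a c) (τ : Cell k S b c)
      (h : σ.verts = insert ⊥ (τ.verts.image fun q => (r.comp q.path).toPoset)) :
      Facet ⟨a, c, σ⟩ ⟨b, c, τ⟩
  | internal {a b : V} (x : PathsFrom k S a) (σ τ : Cell k S a b) (hx : x ∈ σ.inner)
      (h : τ.verts = σ.verts.erase x) :
      Facet ⟨a, b, σ⟩ ⟨a, b, τ⟩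
  | terminal {a b c : V} (r : PathClass k S b c) (hr : ⊥ < r.toPoset)
      (σ : Cell k S a c) (τ : Cell k S a b)
      (h : σ.verts = insert σ.top.toPoset τ.verts) (htop : σ.top = τ.top.comp r) :
      Facet ⟨a, c, σ⟩ ⟨a, b, τ⟩

namespace Facet

open Classical in
/-- The incidence number `(-1)ⁱ` of the facet omitting `pᵢ`. -/
def sign {σ τ : AnyCell k S} : Facet σ τ → ℤ
  | initial .. => 1
  | internal x σ _ _ _ => (-1) ^ (σ.verts.filter (· < x)).card
  | terminal _ _ σ _ _ _ => (-1) ^ σ.dim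

/-- The coefficient on the left: `p₁` for the initial facet, and `1` otherwise. -/
def left {σ τ : AnyCell k S} : Facet σ τ → QuiverAlgebra k S
  | initial r .. => r.toAlg
  | internal .. => 1
  | terminal .. => 1

/-- The coefficient on the right: `pₙ/pₙ₋₁` for the terminal facet, and `1` otherwise. -/
def right {σ τ : AnyCell k S} : Facet σ τ → QuiverAlgebra k S
  | initial .. => 1
  | internal .. => 1
  | terminal r .. => r.toAlg

end Facet

/-! ### Matchings and the Morse complex of bimodules -/

variable (k S) in
/-- A relation between cells; `M σ τ` says that `σ` is matched with its facet `τ`. -/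
abbrev CellMatching := AnyCell k S → AnyCell k S → Prop

/-- The arrows of the Hasse diagram of the cells: unmatched facet relations are oriented downwards,
matched ones upwards. -/
def HasseArrow (M : CellMatching k S) (σ τ : AnyCell k S) : Prop :=
  (Nonempty (Facet σ τ) ∧ ¬ M σ τ) ∨ M τ σ

/-- `M` is an acyclic matching: each matched pair consists of a cell and one of its facets, each cell
is in at most one pair, and the modified Hasse diagram has no oriented cycle. -/
structure IsAcyclicMatching (M : CellMatching k S) : Prop where
  facet : ∀ σ τ, M σ τ → Nonempty (Facet σ τ)
  down_unique : ∀ σ τ τ', M σ τ → M σ τ' → τ = τ'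
  up_unique : ∀ σ σ' τ, M σ τ → M σ' τ → σ = σ'
  not_both : ∀ ρ σ τ, M ρ σ → ¬ M σ τ
  acyclic : ∀ σ, ¬ Relation.TransGen (HasseArrow M) σ σ

/-- A cell is critical if it is unmatched. -/
def IsCritical (M : CellMatching k S) (σ : AnyCell k S) : Prop :=
  ∀ τ, ¬ M σ τ ∧ ¬ M τ σ

/-- Discrete gradient paths from `σ` to `η`: alternating downward and upward arrows of the modified
Hasse diagram, beginning and ending with a downward arrow. -/
inductive GradientPath (M : CellMatching k S) : AnyCell k S → AnyCell k S → Type (max u v)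
  | last {σ τ : AnyCell k S} (f : Facet σ τ) (hf : ¬ M σ τ) : GradientPath M σ τ
  | step {σ τ σ' η : AnyCell k S} (f : Facet σ τ) (hf : ¬ M σ τ) (g : Facet σ' τ) (hg : M σ' τ)
      (γ : GradientPath M σ' η) : GradientPath M σ η

namespace GradientPath

variable {M : CellMatching k S}

/-- The multiplicity of a gradient path in the discrete Morse complex. -/
def sign : ∀ {σ η : AnyCell k S}, GradientPath M σ η → ℤ
  | _, _, last f _ => f.sign
  | _, _, step f _ g _ γ => -(f.sign * g.sign * γ.sign)

/-- The left coefficient of a gradient path. -/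
def left : ∀ {σ η : AnyCell k S}, GradientPath M σ η → QuiverAlgebra k S
  | _, _, last f _ => f.left
  | _, _, step f _ _ _ γ => f.left * γ.left

/-- The right coefficient of a gradient path. -/
def right : ∀ {σ η : AnyCell k S}, GradientPath M σ η → QuiverAlgebra k S
  | _, _, last f _ => f.right
  | _, _, step f _ _ _ γ => γ.right * f.right

end GradientPath

variable (k S)

/-- The enveloping algebra. Its left modules are the bimodules over the quiver algebra. -/
abbrev Env : Type (max u v w) := QuiverAlgebra k S ⊗[k] (QuiverAlgebra k S)ᵐᵒᵖ

/-- The idempotent of the enveloping algebra given by a pair of vertices. -/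
def idem (a b : V) : Env k S :=
  (PathClass.id (k := k) (S := S) a).toAlg ⊗ₜ[k]
    MulOpposite.op (PathClass.id (k := k) (S := S) b).toAlg

/-- The projective bimodule `A e_a ⊗ e_b A`, as the left ideal of the enveloping algebra generated
by the idempotent. -/
abbrev projBimod (a b : V) : Ideal (Env k S) := Ideal.span {idem k S a b}

/-- The bimodule map from `A e_a ⊗ e_b A` to `A e_c ⊗ e_d A` sending the generator to
`(e_a ⊗ e_b) z (e_c ⊗ e_d)`, that is, right multiplication by `z (e_c ⊗ e_d)`. -/
def projBimodMap (a b c d : V) (z : Env k S) :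
    projBimod k S a b →ₗ[Env k S] projBimod k S c d where
  toFun x := ⟨x.1 * (z * idem k S c d), by
    rw [← mul_assoc]
    exact Ideal.mul_mem_left _ _ (Ideal.subset_span rfl)⟩
  map_add' x y := Subtype.ext (add_mul _ _ _)
  map_smul' r x := Subtype.ext (mul_assoc _ _ _)

variable {k S}

/-- The critical cells of dimension `n`. -/
abbrev Crit (M : CellMatching k S) (n : ℕ) : Type (max u v) :=
  {σ : AnyCell k S // IsCritical M σ ∧ σ.2.2.dim = n}

/-- The bimodule of the Morse complex in degree `n`: the direct sum of `A e_{t(η)} ⊗ e_{h(η)} A`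
over the critical cells `η` of dimension `n`. -/
abbrev MorseModule (M : CellMatching k S) (n : ℕ) : Type (max u v w) :=
  DirectSum (Crit M n) fun η => projBimod k S η.1.1 η.1.2.1

/-- The coefficient of `η` in the differential of `σ`: the sum over the gradient paths `γ`
from `σ` to `η` of `ε(γ) l(γ) ⊗ r(γ)`. -/
def morseCoeff (M : CellMatching k S) (σ η : AnyCell k S) : Env k S :=
  ∑ᶠ γ : GradientPath M σ η, γ.sign • (γ.left ⊗ₜ[k] MulOpposite.op γ.right)

open Classical in
/-- The differential of the Morse complex of bimodules. -/
def morseDiff (M : CellMatching k S) (n : ℕ) :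
    MorseModule M (n + 1) →ₗ[Env k S] MorseModule M n :=
  DirectSum.toModule (Env k S) (Crit M (n + 1)) (MorseModule M n) fun σ =>
    ∑ᶠ η : Crit M n,
      (DirectSum.lof (Env k S) (Crit M n) (fun η => projBimod k S η.1.1 η.1.2.1) η).comp
        (projBimodMap k S σ.1.1 σ.1.2.1 η.1.1 η.1.2.1 (morseCoeff M σ.1 η.1))

attribute [local instance] TensorProduct.Algebra.module in
open Classical in
/-- The augmentation, given by the multiplication `A e_a ⊗ e_b A → A` on each summand. Here `A` is
a module over the enveloping algebra by `(x ⊗ y) • z = x z y`. -/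
def morseAug (M : CellMatching k S) : MorseModule M 0 →ₗ[Env k S] QuiverAlgebra k S :=
  DirectSum.toModule (Env k S) (Crit M 0) (QuiverAlgebra k S) fun σ =>
    (LinearMap.toSpanSingleton (Env k S) (QuiverAlgebra k S) 1).comp
      (projBimod k S σ.1.1 σ.1.2.1).subtype

/-- The Morse complex, with its augmentation, is a projective resolution of the bimodule `A`. -/
structure IsProjectiveResolution (M : CellMatching k S) : Prop where
  projective : ∀ n, Module.Projective (Env k S) (MorseModule M n)
  surjective : Function.Surjective (morseAug M)
  exact_zero : Function.Exact (morseDiff M 0) (morseAug M)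
  exact_succ : ∀ n, Function.Exact (morseDiff M (n + 1)) (morseDiff M n)

variable (k S) in
/-- The ideal of the enveloping algebra generated by the arrows of the quiver, on either side. -/
def arrowIdeal : TwoSidedIdeal (Env k S) :=
  TwoSidedIdeal.span {x | ∃ (a b : V) (f : a ⟶ b),
    x = proj k S (ofPath k f.toPath) ⊗ₜ[k] 1 ∨
    x = 1 ⊗ₜ[k] MulOpposite.op (proj k S (ofPath k f.toPath))}

/-- The Morse complex is minimal: the image of each differential is contained in the product of the
ideal generated by the arrows with the target. -/
def IsMinimal (M : CellMatching k S) : Prop :=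
  ∀ n, LinearMap.range (morseDiff M n) ≤
    Submodule.span (Env k S) {y | ∃ r ∈ arrowIdeal k S, ∃ x : MorseModule M n, y = r • x}

/-! ### The Babson–Hersh matching on the geometric realization -/

variable (k S)

/-- The choices made in the construction of the Babson–Hersh matching: for each path class `p`, a
total ordering of the facets of the order complex of the open interval `(e, p)` (the maximal chains)
and, if the interval is nonempty, a point `base p` of it that is an unmatched 0-cell. -/
structure BHChoice where
  order : ∀ {a b : V}, PathClass k S a b → List (Finset (PathsFrom k S a))
  isFacetOrder : ∀ {a b : V} (p : PathClass k S a b),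
    IsFacetOrder (orderComplex p.openInterval) (order p)
  base : ∀ {a b : V}, PathClass k S a b → PathsFrom k S a
  base_mem : ∀ {a b : V} (p : PathClass k S a b), p.openInterval.Nonempty →
    base p ∈ p.openInterval
  base_unmatched : ∀ {a b : V} (p : PathClass k S a b), p.openInterval.Nonempty →
    ∀ s, ¬ BHMatched (order p) s {base p} ∧ ¬ BHMatched (order p) {base p} s

variable {k S}

/-- The chosen orderings are all shellings. -/
def BHChoice.IsShelling (B : BHChoice k S) : Prop :=
  ∀ {a b : V} (p : PathClass k S a b), HPA.IsShelling (B.order p)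

/-- The Babson–Hersh matching: `[e < s < p]` is matched with `[e < t < p]` when the
chains `s` and `t` are matched in the order complex of `(e, p)`, and `[e < base p < p]` is matched
with `[e < p]`. -/
inductive BHChoice.matching (B : BHChoice k S) : CellMatching k S
  | pair {a b : V} (σ τ : Cell k S a b) (htop : σ.top = τ.top)
      (h : BHMatched (B.order σ.top) σ.inner τ.inner) : B.matching ⟨a, b, σ⟩ ⟨a, b, τ⟩
  | base {a b : V} (σ τ : Cell k S a b) (htop : σ.top = τ.top)
      (hσ : σ.inner = {B.base σ.top}) (hτ : τ.inner = ∅) : B.matching ⟨a, b, σ⟩ ⟨a, b, τ⟩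

end Cells

end HPA

end

/-! The cells of `X_A` index the normalized bar resolution of `A`. Left cancellation makes
prepending a path, `l ⊗ [η] ⊗ r ↦ 1 ⊗ [l | η] ⊗ r`, a contracting homotopy
(`contract_homotopy_zero`, `contract_homotopy`). It never touches the right factor, so exactness
survives any change of the right coefficients along `ψ : Aᵐᵒᵖ → B`. With `B = Aᵐᵒᵖ` this is the
bimodule resolution of `A`; with `B = V → k`, the degree-zero part of `A`, it is a resolution of the
left module `A₀`.

An acyclic matching whose pairs share their top path splits the differential as `m + D`, where `m`
is the matched part, with entries `±1`. The perturbation lemma `Perturbation.exists_transfer`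
inverts `1 - D V` by a geometric series, where `V` is minus the inverse of `m`. That series is the
sum over gradient paths (`pathMatrix_eq`). The resulting transfer maps exhibit the Morse complex as
a retract of the bar complex (`exists_morse_transfer`), so it is exact too (`morse_exact_zero`,
`morse_exact_succ`), for each choice of `B`.

For a shelling, the minimal skipped intervals are singletons (`IsShelling.minimalSkipped_eq`). The
faces that first appear in a facet `F` form the Boolean interval between the restriction set of `F`
and `F`, and the Babson–Hersh matching toggles the least element of `F` outside the restriction set
(`bhMatched_iff`). A lexicographic potential shows acyclicity. An unmatched nonempty chain is either
a maximal chain or the least point of the first facet; pairing the empty chain with an unmatched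
point leaves only maximal chains critical (`inner_mem_facets_of_isCritical`). A finite set of points
is shellable in any order, so it needs no separate treatment.

Shellings are pure, so all maximal chains below a path have the same size. Hence path length is
well-defined and additive, and the top of a critical `n`-cell has length `n`. A gradient path from
`σ` to `η` yields a factorization `top σ = u · top η · w` with weight `± u ⊗ w`
(`GradientPath.isFactorWeight`). In consecutive dimensions the lengths of `u` and `w` add up to one,
so one factor is irreducible and the other trivial. This is minimality. Over `A₀` the terms with
nontrivial `w` vanish and the remaining entries have length one, so the resolution of `A₀` is
linear, which is Koszulness. -/

open scoped TensorProduct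

noncomputable section

namespace HPA

open Quiver

universe w v u

set_option linter.unusedSectionVars false

/-! ### The perturbation lemma -/

section Perturbation

/-- A differential `m + D` in a ring with corner unit `E`, in which `m` is contracted by `V` onto
the image of the idempotent `e`, and `D V` is nilpotent. -/
structure Perturbation {Λ : Type*} [Ring Λ] (E e m V D : Λ) : Prop where
  e_mul_e : e * e = e
  m_mul_m : m * m = 0
  V_mul_V : V * V = 0
  e_mul_V : e * V = 0
  V_mul_e : V * e = 0
  e_mul_m : e * m = 0
  m_mul_e : m * e = 0
  E_mul_D : E * D = D
  D_mul_E : D * E = D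
  homotopy_left : m * V = e - E - V * m
  sq_zero : (m + D) * (m + D) = 0
  nilpotent : ∃ n, (D * V) ^ n = 0

namespace Perturbation

variable {Λ : Type*} [Ring Λ] {E e m V D : Λ}

/-- The geometric series inverts `1 - x`. Both one-sided equations are recorded because later
computations expand `T` on either side. -/
theorem exists_inverse (n : ℕ) (x : Λ) (h : x ^ n = 0) :
    ∃ T : Λ, T = 1 + x * T ∧ T = 1 + T * x := by
  refine ⟨∑ i ∈ Finset.range n, x ^ i, ?_, ?_⟩
  · have h1 := mul_neg_geom_sum x n
    rw [h, sub_zero, sub_mul, one_mul] at h1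
    exact sub_eq_iff_eq_add.1 h1
  · have h1 := geom_sum_mul_neg x n
    rw [h, sub_zero, mul_sub, mul_one] at h1
    exact sub_eq_iff_eq_add.1 h1

/-- The transfer maps between the perturbed complex and the reduced complex with differential
`e * T * D * e`. -/
theorem exists_transfer (h : Perturbation E e m V D) :
    ∃ T S : Λ, T = 1 + D * V * T ∧ T = 1 + T * (D * V) ∧ S = 1 + S * (V * D) ∧
      e * T * (m + D) = e * (T * D) * e * T ∧
      (m + D) * (S * e) = S * e * (e * (T * D) * e) ∧ e * T * (S * e) = e := by
  obtain ⟨n, hn⟩ := h.nilpotent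
  obtain ⟨T, hT1, hT2⟩ := exists_inverse n (D * V) hn
  -- Nilpotency passes from `D V` to `V D` through `(V D)^(j+1) = V (D V)^j D`.
  have hn' : (V * D) ^ (n + 1) = 0 := by
    have : ∀ j : ℕ, (V * D) ^ (j + 1) = V * (D * V) ^ j * D := by
      intro j
      induction j with
      | zero => simp
      | succ j ih => rw [pow_succ', ih, pow_succ']; noncomm_ring
    rw [this, hn]; simp
  obtain ⟨S, hS1, hS2⟩ := exists_inverse (n + 1) (V * D) hn'
  have hTD : T * D = D * S := by
    have h1 : D * S = D + D * V * (D * S) := by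
      conv_lhs => rw [hS1]
      noncomm_ring
    have h2 : (1 - D * V) * (D * S) = D := by
      rw [sub_mul, one_mul]; nth_rw 1 [h1]; abel
    have h3 : T * (1 - D * V) = 1 := by
      rw [mul_sub, mul_one]; nth_rw 1 [hT2]; abel
    calc T * D = T * ((1 - D * V) * (D * S)) := by rw [h2]
      _ = (T * (1 - D * V)) * (D * S) := by noncomm_ring
      _ = D * S := by rw [h3, one_mul]
  have hVS : V * T = S * V := by
    have h1 : V * T = V + V * D * (V * T) := by
      conv_lhs => rw [hT1]
      noncomm_ring
    have h2 : (1 - V * D) * (V * T) = V := by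
      rw [sub_mul, one_mul]; nth_rw 1 [h1]; abel
    have h3 : S * (1 - V * D) = 1 := by
      rw [mul_sub, mul_one]; nth_rw 1 [hS2]; abel
    calc V * T = (S * (1 - V * D)) * (V * T) := by rw [h3, one_mul]
      _ = S * ((1 - V * D) * (V * T)) := by noncomm_ring
      _ = S * V := by rw [h2]
  have hsq : m * D + D * m + D * D = 0 := by
    have := h.sq_zero
    rw [add_mul, mul_add, mul_add, h.m_mul_m, zero_add] at this
    rw [← this]; abel
  refine ⟨T, S, hT1, hT2, hS2, ?_, ?_, ?_⟩
  -- Expand `e T m` by `T = 1 + T D V`, replace `V m` by `e - E - m V` and `D m` by `-(m + D) D`.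
  -- The outcome is `e T (m + D) (1 - D V) = e T D e`, and `T` cancels the factor `1 - D V`.
  · have hDm : D * m = -((m + D) * D) := by
      rw [add_mul, eq_neg_iff_add_eq_zero, ← hsq]; abel
    have h1 : e * T * m = e * T * D * e - e * T * D + e * T * (m + D) * D * V := by
      have h1 : e * T * m = e * m + e * T * D * (V * m) := by
        conv_lhs => rw [hT2]
        noncomm_ring
      have h2 : V * m = e - E - m * V := by rw [h.homotopy_left]; abel
      rw [h1, h2, h.e_mul_m]
      calc 0 + e * T * D * (e - E - m * V)
          = e * T * D * e - e * T * (D * E) - e * T * (D * m) * V := by noncomm_ring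
        _ = _ := by rw [h.D_mul_E, hDm]; noncomm_ring
    have h2 : e * T * (m + D) = e * T * D * e + e * T * (m + D) * D * V := by
      conv_lhs => rw [mul_add, h1]
      abel
    have h3 : e * T * (m + D) * (1 - D * V) = e * T * D * e := by
      rw [mul_sub, mul_one]
      nth_rw 1 [h2]
      noncomm_ring
    have h4 : (1 - D * V) * T = 1 := by
      rw [sub_mul, one_mul]; nth_rw 1 [hT1]; abel
    calc e * T * (m + D) = e * T * (m + D) * ((1 - D * V) * T) := by rw [h4, mul_one]
      _ = (e * T * (m + D) * (1 - D * V)) * T := by noncomm_ring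
      _ = _ := by rw [h3]; noncomm_ring
  -- The mirror image: `(1 - V D) (m + D) S e = e D S e`. Then `S` cancels the left factor, and `D S
  -- = T D` identifies the result with the reduced differential.
  · have hmD : m * D = -(D * (m + D)) := by
      rw [mul_add, eq_neg_iff_add_eq_zero, ← hsq]; abel
    have h1 : m * (S * e) = e * D * S * e - D * S * e + V * (D * (m + D)) * S * e := by
      have h1 : m * (S * e) = m * e + m * V * (D * S * e) := by
        conv_lhs => rw [hS1]
        noncomm_ring
      rw [h1, h.m_mul_e, h.homotopy_left]
      calc 0 + (e - E - V * m) * (D * S * e)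
          = e * D * S * e - (E * D) * S * e - V * (m * D) * S * e := by noncomm_ring
        _ = _ := by rw [h.E_mul_D, hmD]; noncomm_ring
    have h2 : (m + D) * (S * e) = e * D * S * e + V * D * ((m + D) * (S * e)) := by
      conv_lhs => rw [add_mul, h1]
      noncomm_ring
    have h3 : (1 - V * D) * ((m + D) * (S * e)) = e * D * S * e := by
      rw [sub_mul, one_mul]
      nth_rw 1 [h2]
      abel
    have h4 : S * (1 - V * D) = 1 := by
      rw [mul_sub, mul_one]; nth_rw 1 [hS2]; abel
    calc (m + D) * (S * e) = (S * (1 - V * D)) * ((m + D) * (S * e)) := by rw [h4, one_mul]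
      _ = S * ((1 - V * D) * ((m + D) * (S * e))) := by noncomm_ring
      _ = S * (e * (D * S) * e) := by rw [h3]; noncomm_ring
      _ = S * ((e * e) * (T * D) * e) := by rw [h.e_mul_e, hTD]
      _ = _ := by noncomm_ring
  -- In the product `(e + e T D V) (e + V D S e)` every term except `e e` contains `e V`, `V e` or
  -- `V V`.
  · have h1 : S * e = e + V * (D * S * e) := by
      conv_lhs => rw [hS1]
      noncomm_ring
    have h2 : e * T = e + e * T * D * V := by
      conv_lhs => rw [hT2]
      noncomm_ring
    rw [h1, h2]
    calc (e + e * T * D * V) * (e + V * (D * S * e))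
        = e * e + (e * V) * (D * S * e) + e * T * D * (V * e)
          + e * T * D * (V * V) * (D * S * e) := by noncomm_ring
      _ = e := by rw [h.e_mul_e, h.e_mul_V, h.V_mul_e, h.V_mul_V]; simp

end Perturbation

end Perturbation

/-! ### Finiteness -/

section Finiteness

variable {V : Type u} [Quiver.{v} V]

/-- Being joined by a nontrivial path is transitive, and irreflexive because there are no oriented
cycles. On a finite set such a relation is well-founded. -/
theorem wellFounded_arrow [Finite V] [AcyclicQuiver V] :
    WellFounded fun a b : V => Nonempty (a ⟶ b) := by
  let r : V → V → Prop := fun a b => ∃ p : Path a b, p.length ≠ 0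
  have htrans : IsTrans V r := ⟨fun a b c ⟨p, hp⟩ ⟨q, hq⟩ =>
    ⟨p.comp q, by rw [Path.length_comp]; omega⟩⟩
  have hirrefl : Std.Irrefl r := ⟨fun a ⟨p, hp⟩ => hp (by rw [AcyclicQuiver.eq_nil p]; rfl)⟩
  have : WellFounded r := Finite.wellFounded_of_trans_of_irrefl r
  exact Subrelation.wf (fun {a b} ⟨f⟩ => ⟨f.toPath, by simp⟩) this

/-- Induction on the head along arrows: a path is trivial, or it is given by its last arrow and a
path to the tail of that arrow. -/
theorem finite_path [Finite V] [∀ a b : V, Finite (a ⟶ b)] [AcyclicQuiver V] (a b : V) :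
    Finite (Path a b) := by
  refine wellFounded_arrow.induction (C := fun b => Finite (Path a b)) b fun b ih => ?_
  have : ∀ c : {c : V // Nonempty (c ⟶ b)}, Finite (Path a c.1) := fun c => ih c.1 c.2
  let f : Path a b → Option (Σ c : {c : V // Nonempty (c ⟶ b)}, Path a c.1 × (c.1 ⟶ b)) :=
    fun p => match b, p with
      | _, Path.nil => none
      | _, Path.cons (b := c) p e => some ⟨⟨c, ⟨e⟩⟩, p, e⟩
  refine Finite.of_injective f fun p q h => ?_
  cases p with
  | nil => rw [AcyclicQuiver.eq_nil q]
  | cons p e =>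
    cases q with
    | nil => simp [f] at h
    | cons q e' =>
      simp only [f, Option.some.injEq, Sigma.mk.injEq, Subtype.mk.injEq] at h
      obtain ⟨rfl, h⟩ := h
      simp only [heq_eq_eq, Prod.mk.injEq] at h
      rw [h.1, h.2]

end Finiteness

/-! ### Path classes inside the quiver algebra -/

section Algebra

variable {k : Type w} {V : Type u} [Quiver.{v} V] [CommRing k] [Fintype V] {S : PathRelations V}

instance finite_pathClass [∀ a b : V, Finite (a ⟶ b)] [AcyclicQuiver V] (a b : V) :
    Finite (PathClass k S a b) :=
  haveI := finite_path a b
  inferInstanceAs (Finite (Quotient (pathSetoid k S a b)))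

instance finite_pathsFrom [∀ a b : V, Finite (a ⟶ b)] [AcyclicQuiver V] (a : V) :
    Finite (PathsFrom k S a) :=
  Finite.of_injective (fun p : PathsFrom k S a => (⟨p.head, p.path⟩ : Σ b, PathClass k S a b))
    fun p q h => by cases p; cases q; simpa using h

variable (k S) in
/-- All path classes, with their tail and head. -/
abbrev AnyClass := Σ a b : V, PathClass k S a b

namespace PathClass

theorem mk_surjective {a b : V} (p : PathClass k S a b) : ∃ q : Path a b, mk q = p :=
  Quotient.exists_rep p

theorem mk_eq_mk {a b : V} {p q : Path a b} :
    (mk p : PathClass k S a b) = mk q ↔ ofPath k p - ofPath k q ∈ relIdeal k S :=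
  Quotient.eq

theorem mk_comp_mk {a b c : V} (p : Path a b) (q : Path b c) :
    (mk p : PathClass k S a b).comp (mk q) = mk (p.comp q) := rfl

theorem toAlg_mk {a b : V} (p : Path a b) :
    (mk p : PathClass k S a b).toAlg = proj k S (ofPath k p) := rfl

theorem toAlg_mul {a b c : V} (p : PathClass k S a b) (q : PathClass k S b c) :
    p.toAlg * q.toAlg = (p.comp q).toAlg := by
  obtain ⟨p, rfl⟩ := p.mk_surjective
  obtain ⟨q, rfl⟩ := q.mk_surjective
  rw [mk_comp_mk, toAlg_mk, toAlg_mk, toAlg_mk, ← map_mul, ofPath_mul_ofPath]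

theorem toAlg_mul_of_ne {a b c d : V} (p : PathClass k S a b) (q : PathClass k S c d)
    (h : b ≠ c) : p.toAlg * q.toAlg = 0 := by
  obtain ⟨p, rfl⟩ := p.mk_surjective
  obtain ⟨q, rfl⟩ := q.mk_surjective
  rw [toAlg_mk, toAlg_mk, ← map_mul, ofPath_mul_of_ne k _ _ h, map_zero]

theorem id_mul_toAlg {a b : V} (p : PathClass k S a b) : (id a).toAlg * p.toAlg = p.toAlg := by
  rw [toAlg_mul, id_comp]

theorem toAlg_mul_id {a b : V} (p : PathClass k S a b) : p.toAlg * (id b).toAlg = p.toAlg := by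
  rw [toAlg_mul, comp_id]

theorem sum_id_toAlg : ∑ a : V, (id a : PathClass k S a a).toAlg = 1 := by
  have : (1 : QuiverAlgebra k S) = proj k S 1 := (map_one _).symm
  rw [this, one_eq, map_sum]
  rfl

end PathClass

/-! ### The path classes form a basis -/

/-- The formal sum of path classes of an element of the path algebra. -/
def classSum (x : PathAlgebra k V) : AnyClass k S →₀ k :=
  Finsupp.mapDomain (fun p : AnyPath V => (⟨p.1, p.2.1, PathClass.mk p.2.2⟩ : AnyClass k S)) x

theorem classSum_add (x y : PathAlgebra k V) :
    (classSum (x + y) : AnyClass k S →₀ k) = classSum x + classSum y :=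
  Finsupp.mapDomain_add

theorem classSum_smul (r : k) (x : PathAlgebra k V) :
    (classSum (r • x) : AnyClass k S →₀ k) = r • classSum x :=
  Finsupp.mapDomain_smul r x

theorem classSum_zero : (classSum (0 : PathAlgebra k V) : AnyClass k S →₀ k) = 0 :=
  Finsupp.mapDomain_zero

theorem classSum_neg (x : PathAlgebra k V) :
    (classSum (-x) : AnyClass k S →₀ k) = -classSum x := by
  rw [eq_neg_iff_add_eq_zero, ← classSum_add, neg_add_cancel, classSum_zero]

theorem classSum_ofPath {a b : V} (p : Path a b) :
    (classSum (ofPath k p) : AnyClass k S →₀ k) = Finsupp.single ⟨a, b, PathClass.mk p⟩ 1 :=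
  Finsupp.mapDomain_single

open Classical in
/-- The product of two path classes, or zero. -/
def mulClass : AnyClass k S → AnyClass k S → (AnyClass k S →₀ k) := fun ⟨a, b, p⟩ ⟨c, d, q⟩ =>
  if h : c = b then Finsupp.single ⟨a, d, p.comp (h ▸ q)⟩ 1 else 0

/-- The class sum of a product depends only on the class sums of the factors. Hence the kernel of
`classSum` is a two-sided ideal. -/
theorem classSum_mul_ofPath (x y : PathAlgebra k V) :
    (classSum (x * y) : AnyClass k S →₀ k) =
      Finsupp.lift ((AnyClass k S →₀ k) →ₗ[k] (AnyClass k S →₀ k)) k (AnyClass k S) (fun p =>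
        Finsupp.lift (AnyClass k S →₀ k) k (AnyClass k S) fun q => mulClass p q)
        (classSum x) (classSum y) := by
  induction x using path_induction with
  | zero => rw [path_zero_mul, classSum_zero]; simp
  | add x x' h h' => 
    rw [path_add_mul, classSum_add, h, h', classSum_add, map_add, LinearMap.add_apply]
  | smul r p =>
    induction y using path_induction with
    | zero => rw [path_mul_zero, classSum_zero]; simp
    | add x x' h h' => rw [path_mul_add, classSum_add, h, h', classSum_add, map_add]
    | @smul s c d q =>
      rename_i a b
      rw [path_smul_mul, path_mul_smul, classSum_smul, classSum_smul, classSum_smul,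
        classSum_smul, classSum_ofPath, classSum_ofPath]
      by_cases h : b = c
      · subst h
        rw [ofPath_mul_ofPath, classSum_ofPath]
        simp [mulClass, PathClass.mk_comp_mk]
      · rw [ofPath_mul_of_ne _ _ _ h, classSum_zero]
        simp [mulClass, Ne.symm h]

/-- The kernel of `classSum` is a two-sided ideal, so it suffices that it contains the generating
differences, and the two paths of such a difference have the same class. This is what makes distinct
classes linearly independent in `A`. -/
theorem classSum_eq_zero {x : PathAlgebra k V} (hx : x ∈ relIdeal k S) :
    (classSum x : AnyClass k S →₀ k) = 0 := by
  let J : TwoSidedIdeal (PathAlgebra k V) := TwoSidedIdeal.mk' {x | classSum (S := S) x = 0}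
    classSum_zero
    (fun {x y} hx hy => by
      rw [Set.mem_ofPred_eq] at hx hy ⊢
      rw [classSum_add, hx, hy, add_zero])
    (fun {x} hx => by
      rw [Set.mem_ofPred_eq] at hx ⊢
      rw [classSum_neg, hx, neg_zero])
    (fun {x y} hy => by
      rw [Set.mem_ofPred_eq] at hy ⊢
      rw [classSum_mul_ofPath, hy, map_zero])
    (fun {x y} hx => by
      rw [Set.mem_ofPred_eq] at hx ⊢
      rw [classSum_mul_ofPath, hx, map_zero, LinearMap.zero_apply])
  have hJ : ∀ x, x ∈ J ↔ classSum (S := S) x = 0 := fun x => TwoSidedIdeal.mem_mk' ..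
  refine (hJ x).1 ((TwoSidedIdeal.span_le (I := J)).2 ?_ hx)
  rintro _ ⟨a, b, T, p, q, hT, hp, hq, rfl⟩
  refine (hJ _).2 ?_
  rw [sub_eq_add_neg, classSum_add, classSum_neg, classSum_ofPath, classSum_ofPath]
  have : (PathClass.mk p : PathClass k S a b) = PathClass.mk q :=
    PathClass.mk_eq_mk.2 (TwoSidedIdeal.subset_span ⟨a, b, T, p, q, hT, hp, hq, rfl⟩)
  rw [this, add_neg_cancel]

/-- The coordinates of an element of the quiver algebra with respect to the path classes. -/
def coords : QuiverAlgebra k S →ₗ[k] (AnyClass k S →₀ k) where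
  toFun := Quotient.lift classSum fun x y (h : (relIdeal k S).ringCon x y) => by
    have := classSum_eq_zero (((relIdeal k S).rel_iff _ _).1 h)
    rw [sub_eq_add_neg, classSum_add, classSum_neg] at this
    exact add_neg_eq_zero.1 this
  map_add' x y := by
    induction x using Quotient.inductionOn
    induction y using Quotient.inductionOn
    exact classSum_add _ _
  map_smul' r x := by
    induction x using Quotient.inductionOn
    exact classSum_smul _ _

theorem coords_toAlg {a b : V} (p : PathClass k S a b) :
    coords p.toAlg = Finsupp.single ⟨a, b, p⟩ 1 := by
  obtain ⟨p, rfl⟩ := p.mk_surjective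
  exact classSum_ofPath p

/-- The path classes form a basis of the quiver algebra. -/
def pathBasis : Module.Basis (AnyClass k S) k (QuiverAlgebra k S) where
  repr := LinearEquiv.ofLinearMap coords
    (Finsupp.lift (QuiverAlgebra k S) k (AnyClass k S) fun p => p.2.2.toAlg)
    (by
      ext p : 2
      simp [coords_toAlg])
    (by
      have h : ∀ x : PathAlgebra k V, (Finsupp.lift (QuiverAlgebra k S) k (AnyClass k S)
          fun p => p.2.2.toAlg) (coords (proj k S x)) = proj k S x := by
        intro x
        induction x using path_induction with
        | zero => simp
        | add x y hx hy => rw [map_add, map_add, map_add, hx, hy]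
        | smul r p =>
          rw [map_smul, map_smul, map_smul, ← PathClass.toAlg_mk, coords_toAlg]
          simp
      ext x
      obtain ⟨x, rfl⟩ := (relIdeal k S).ringCon.mk'_surjective x
      exact h x)

theorem pathBasis_apply (p : AnyClass k S) : pathBasis p = p.2.2.toAlg := by
  change (Finsupp.lift (QuiverAlgebra k S) k (AnyClass k S) fun p => p.2.2.toAlg)
    (Finsupp.single p 1) = _
  simp

theorem pathBasis_mk {a b : V} (p : PathClass k S a b) :
    pathBasis (⟨a, b, p⟩ : AnyClass k S) = p.toAlg := pathBasis_apply _

theorem quiverAlgebra_induction {P : QuiverAlgebra k S → Prop} (x : QuiverAlgebra k S)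
    (zero : P 0) (add : ∀ x y, P x → P y → P (x + y))
    (smul : ∀ (r : k) {a b : V} (p : PathClass k S a b), P (r • p.toAlg)) : P x := by
  have hx : x ∈ Submodule.span k (Set.range (pathBasis (k := k) (S := S))) := by
    rw [pathBasis.span_eq]; trivial
  induction hx using Submodule.span_induction with
  | mem x hx =>
    obtain ⟨p, rfl⟩ := hx
    rw [pathBasis_apply, ← one_smul k p.2.2.toAlg]
    exact smul 1 p.2.2
  | zero => exact zero
  | add x y _ _ hx hy => exact add x y hx hy
  | smul r x _ hx =>
    obtain ⟨f, rfl⟩ : ∃ f, pathBasis.repr.symm f = x := ⟨_, pathBasis.repr.symm_apply_apply x⟩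
    rw [← map_smul]
    induction (r • f) using Finsupp.induction_linear with
    | zero => rw [map_zero]; exact zero
    | add f g hf hg => rw [map_add]; exact add _ _ hf hg
    | single p s => rw [Module.Basis.repr_symm_single, pathBasis_apply]; exact smul s p.2.2

/-! ### Cancellation and the path posets -/

theorem ofPath_injective [Nontrivial k] {a b c d : V} {p : Path a b} {q : Path c d}
    (h : ofPath k p = ofPath k q) :
    (⟨a, b, p⟩ : AnyPath V) = ⟨c, d, q⟩ :=
  Finsupp.single_left_injective (one_ne_zero (α := k)) h

/-- The homotopy path algebra condition only concerns differences `rp - rq` that are nonzero in the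
path algebra. If the difference is already zero there, then `rp` and `rq` are the same path and
cancellation is that of the free category. -/
theorem IsHPA.comp_left_cancel [Nontrivial k] (hA : IsHPA k S) {a b c : V}
    {r : PathClass k S a b} {p q : PathClass k S b c} (h : r.comp p = r.comp q) : p = q := by
  obtain ⟨r, rfl⟩ := r.mk_surjective
  obtain ⟨p, rfl⟩ := p.mk_surjective
  obtain ⟨q, rfl⟩ := q.mk_surjective
  rw [PathClass.mk_comp_mk, PathClass.mk_comp_mk, PathClass.mk_eq_mk, ← ofPath_mul_ofPath,
    ← ofPath_mul_ofPath] at h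
  by_cases h0 : ofPath k r * ofPath k p - ofPath k r * ofPath k q = 0
  · rw [sub_eq_zero, ofPath_mul_ofPath, ofPath_mul_ofPath] at h0
    have := ofPath_injective h0
    simp only [Sigma.mk.injEq, heq_eq_eq, true_and, Path.comp_inj_right] at this
    rw [this]
  · exact PathClass.mk_eq_mk.2 (hA.left_cancel r p q h0 h)

namespace PathsFrom

variable [AcyclicQuiver V]

theorem bot_def (a : V) : (⊥ : PathsFrom k S a) = ⟨a, PathClass.id a⟩ := rfl

end PathsFrom

namespace PathClass

variable [AcyclicQuiver V]

theorem eq_id {a : V} (p : PathClass k S a a) : p = id a := by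
  obtain ⟨p, rfl⟩ := p.mk_surjective
  rw [AcyclicQuiver.eq_nil p]
  rfl

theorem toPoset_id (a : V) : (id a : PathClass k S a a).toPoset = ⊥ := rfl

theorem toPoset_injective {a b : V} {p q : PathClass k S a b} (h : p.toPoset = q.toPoset) :
    p = q := by
  simpa [toPoset] using h

theorem bot_lt_iff_ne {a b : V} (p : PathClass k S a b) : ⊥ < p.toPoset ↔ a ≠ b := by
  rw [bot_lt_iff_ne_bot, not_iff_not]
  constructor
  · intro h
    exact (congrArg PathsFrom.head h).symm
  · rintro rfl
    rw [p.eq_id, toPoset_id]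

theorem isEmpty_or {a b : V} (p : PathClass k S a b) (q : PathClass k S b a) : a = b := by
  have h := PathsFrom.eq_of_comp p q p
  by_contra hab
  exact hab (congrArg PathsFrom.head h).symm

theorem toPoset_le_comp {a b c : V} (p : PathClass k S a b) (r : PathClass k S b c) :
    p.toPoset ≤ (p.comp r).toPoset := ⟨r, rfl⟩

theorem toPoset_lt_comp {a b c : V} (p : PathClass k S a b) (r : PathClass k S b c) :
    p.toPoset < (p.comp r).toPoset ↔ b ≠ c := by
  rw [(toPoset_le_comp p r).lt_iff_ne, not_iff_not]
  constructor
  · exact fun h => congrArg PathsFrom.head h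
  · rintro rfl
    rw [r.eq_id, comp_id]

end PathClass

namespace PathsFrom

variable [AcyclicQuiver V]

/-- Multiplication on the left by a path class. -/
def lcomp {a b : V} (r : PathClass k S a b) (q : PathsFrom k S b) : PathsFrom k S a :=
  (r.comp q.path).toPoset

theorem lcomp_toPoset {a b c : V} (r : PathClass k S a b) (q : PathClass k S b c) :
    lcomp r q.toPoset = (r.comp q).toPoset := rfl

theorem lcomp_bot {a b : V} (r : PathClass k S a b) : lcomp r ⊥ = r.toPoset := by
  rw [bot_def, lcomp, PathClass.comp_id]

theorem lcomp_lcomp {a b c : V} (r : PathClass k S a b) (s : PathClass k S b c)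
    (q : PathsFrom k S c) : lcomp r (lcomp s q) = lcomp (r.comp s) q := by
  rw [lcomp, lcomp, lcomp, PathClass.comp_assoc]
  rfl

theorem toPoset_le_lcomp {a b : V} (r : PathClass k S a b) (q : PathsFrom k S b) :
    r.toPoset ≤ lcomp r q := ⟨q.path, rfl⟩

theorem bot_lt_lcomp {a b : V} {r : PathClass k S a b} (hr : ⊥ < r.toPoset)
    (q : PathsFrom k S b) : ⊥ < lcomp r q := hr.trans_le (toPoset_le_lcomp r q)

theorem toPoset_le_iff {a b : V} {r : PathClass k S a b} {q : PathsFrom k S a} :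
    r.toPoset ≤ q ↔ ∃ s : PathClass k S b q.head, q.path = r.comp s := Iff.rfl

theorem lcomp_le_iff {a b : V} {r : PathClass k S a b} {p q : PathsFrom k S b} :
    lcomp r p ≤ lcomp r q ↔
      ∃ s : PathClass k S p.head q.head, r.comp q.path = (r.comp p.path).comp s := Iff.rfl

theorem exists_lcomp {a b : V} {r : PathClass k S a b} {q : PathsFrom k S a}
    (h : r.toPoset ≤ q) : ∃ q', lcomp r q' = q := by
  obtain ⟨s, hs⟩ := toPoset_le_iff.1 h
  refine ⟨⟨q.head, s⟩, ?_⟩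
  change (r.comp s).toPoset = q
  rw [← hs]
  rfl

theorem lcomp_mono {a b : V} (r : PathClass k S a b) {p q : PathsFrom k S b} (h : p ≤ q) :
    lcomp r p ≤ lcomp r q := by
  obtain ⟨s, hs⟩ := h
  exact lcomp_le_iff.2 ⟨s, by rw [hs, ← PathClass.comp_assoc]⟩

variable [Nontrivial k] (hA : IsHPA k S)
include hA

theorem lcomp_injective {a b : V} (r : PathClass k S a b) :
    Function.Injective (lcomp r : PathsFrom k S b → PathsFrom k S a) := by
  rintro ⟨c, p⟩ ⟨d, q⟩ h
  obtain rfl : c = d := congrArg PathsFrom.head h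
  have h' : p = q := hA.comp_left_cancel (PathClass.toPoset_injective h)
  rw [h']

/-- Reflecting the order is left cancellation. With `exists_lcomp`, left multiplication identifies
the path poset at `b` with the paths above `r`. -/
theorem lcomp_le_lcomp {a b : V} (r : PathClass k S a b) {p q : PathsFrom k S b} :
    lcomp r p ≤ lcomp r q ↔ p ≤ q := by
  refine ⟨?_, lcomp_mono r⟩
  intro h
  obtain ⟨s, hs⟩ := lcomp_le_iff.1 h
  refine ⟨s, hA.comp_left_cancel (r := r) ?_⟩
  rw [← PathClass.comp_assoc]
  exact hs

theorem lcomp_lt_lcomp {a b : V} (r : PathClass k S a b) {p q : PathsFrom k S b} :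
    lcomp r p < lcomp r q ↔ p < q := by
  rw [lt_iff_le_not_ge, lt_iff_le_not_ge, lcomp_le_lcomp hA, lcomp_le_lcomp hA]

end PathsFrom

end Algebra

/-! ### Cells as chains, and prepending a path to a cell -/

section CellCombinatorics

variable {k : Type w} {V : Type u} [Quiver.{v} V] [CommRing k] [Fintype V] {S : PathRelations V}
  [AcyclicQuiver V]

namespace Cell

/-- The top path is recovered as the greatest vertex. -/
theorem ext_verts {a b : V} {σ τ : Cell k S a b} (h : σ.verts = τ.verts) : σ = τ := by
  refine Cell.ext (PathClass.toPoset_injective (σ.isGreatest.unique ?_)) h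
  rw [h]
  exact τ.isGreatest

theorem anyCell_ext {a b c : V} {σ : Cell k S a b} {τ : Cell k S a c} (h : σ.verts = τ.verts) :
    (⟨a, b, σ⟩ : AnyCell k S) = ⟨a, c, τ⟩ := by
  have h1 : σ.top.toPoset = τ.top.toPoset := σ.isGreatest.unique (by rw [h]; exact τ.isGreatest)
  obtain rfl : b = c := congrArg PathsFrom.head h1
  rw [ext_verts h]

theorem card_verts {a b : V} (σ : Cell k S a b) : σ.verts.card = σ.dim + 1 := by
  have : 0 < σ.verts.card := Finset.card_pos.2 ⟨_, σ.bot_mem⟩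
  unfold dim
  omega

theorem top_mem {a b : V} (σ : Cell k S a b) : σ.top.toPoset ∈ σ.verts := σ.isGreatest.1

theorem le_top {a b : V} (σ : Cell k S a b) {x : PathsFrom k S a} (hx : x ∈ σ.verts) :
    x ≤ σ.top.toPoset := σ.isGreatest.2 hx

/-- The 0-cell at a vertex. -/
def vertex (a : V) : Cell k S a a where
  top := PathClass.id a
  verts := {⊥}
  chain := by simp
  bot_mem := by simp
  isGreatest := by simp [PathClass.toPoset_id]

theorem dim_vertex (a : V) : (vertex a : Cell k S a a).dim = 0 := rfl

theorem verts_eq_of_dim_eq_zero {a b : V} (σ : Cell k S a b) (h : σ.dim = 0) :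
    σ.verts = {⊥} := by
  have := σ.card_verts
  rw [h, zero_add, Finset.card_eq_one] at this
  obtain ⟨x, hx⟩ := this
  have := σ.bot_mem
  rw [hx, Finset.mem_singleton] at this
  rw [hx, this]

theorem eq_vertex_of_dim_eq_zero {a b : V} (σ : Cell k S a b) (h : σ.dim = 0) :
    (⟨a, b, σ⟩ : AnyCell k S) = ⟨a, a, vertex a⟩ :=
  anyCell_ext (σ.verts_eq_of_dim_eq_zero h)

theorem bot_lt_top_of_dim_ne_zero {a b : V} (σ : Cell k S a b) (h : σ.dim ≠ 0) :
    ⊥ < σ.top.toPoset := by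
  rw [bot_lt_iff_ne_bot]
  intro h0
  have : σ.verts = {⊥} := by
    refine Finset.eq_singleton_iff_unique_mem.2 ⟨σ.bot_mem, fun x hx => ?_⟩
    have := σ.le_top hx
    rwa [h0, le_bot_iff] at this
  have h1 := σ.card_verts
  rw [this, Finset.card_singleton] at h1
  omega

open Classical in
/-- The cell `[e < l < l p₁ < ⋯ < l pₙ]`. -/
def cons {a b c : V} (l : PathClass k S a b) (σ : Cell k S b c) : Cell k S a c where
  top := l.comp σ.top
  verts := insert ⊥ (σ.verts.image (PathsFrom.lcomp l))
  chain := by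
    rw [Finset.coe_insert, Finset.coe_image]
    refine (IsChain.image_of_map_rel (· ≤ ·) (· ≤ ·) _ (fun _ _ h => PathsFrom.lcomp_mono l h)
      σ.chain).insert ?_
    exact fun _ _ _ => Or.inl bot_le
  bot_mem := Finset.mem_insert_self _ _
  isGreatest := by
    constructor
    · simp only [Finset.coe_insert, Finset.coe_image]
      exact Or.inr ⟨_, σ.top_mem, rfl⟩
    · rintro x hx
      simp only [Finset.coe_insert, Finset.coe_image] at hx
      rcases hx with rfl | ⟨x, hx, rfl⟩
      · exact bot_le
      · exact PathsFrom.lcomp_mono l (σ.le_top hx)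

theorem mem_cons {a b c : V} (l : PathClass k S a b) (σ : Cell k S b c) {x : PathsFrom k S a} :
    x ∈ (cons l σ).verts ↔ x = ⊥ ∨ ∃ y ∈ σ.verts, PathsFrom.lcomp l y = x := by
  simp [cons]

theorem bot_notMem_image {a b c : V} {l : PathClass k S a b} (hl : ⊥ < l.toPoset)
    (σ : Cell k S b c) [DecidableEq (PathsFrom k S a)] :
    ⊥ ∉ σ.verts.image (PathsFrom.lcomp l) := by
  rw [Finset.mem_image]
  rintro ⟨y, -, hy⟩
  exact (PathsFrom.bot_lt_lcomp hl y).ne' hy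

variable [Nontrivial k] (hA : IsHPA k S)
include hA

theorem lcomp_mem_cons {a b c : V} {l : PathClass k S a b} (hl : ⊥ < l.toPoset)
    {σ : Cell k S b c} {x : PathsFrom k S b} :
    PathsFrom.lcomp l x ∈ (cons l σ).verts ↔ x ∈ σ.verts := by
  rw [mem_cons]
  constructor
  · rintro (h | ⟨y, hy, h⟩)
    · exact ((PathsFrom.bot_lt_lcomp hl x).ne' h).elim
    · rwa [← PathsFrom.lcomp_injective hA l h]
  · exact fun h => Or.inr ⟨x, h, rfl⟩

theorem dim_cons {a b c : V} {l : PathClass k S a b} (hl : ⊥ < l.toPoset) (σ : Cell k S b c) :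
    (cons l σ).dim = σ.dim + 1 := by
  classical
  have h1 := (cons l σ).card_verts
  have h2 := σ.card_verts
  have h3 : (cons l σ).verts.card = σ.verts.card + 1 := by
    rw [cons, Finset.card_insert_of_notMem (bot_notMem_image hl σ),
      Finset.card_image_of_injective _ (PathsFrom.lcomp_injective hA l)]
  omega

open Classical in
theorem card_filter_cons {a b c : V} {l : PathClass k S a b} (hl : ⊥ < l.toPoset)
    (σ : Cell k S b c) (x : PathsFrom k S b) :
    ((cons l σ).verts.filter (· < PathsFrom.lcomp l x)).card =
      (σ.verts.filter (· < x)).card + 1 := by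
  have : (cons l σ).verts.filter (· < PathsFrom.lcomp l x) =
      insert ⊥ ((σ.verts.filter (· < x)).image (PathsFrom.lcomp l)) := by
    ext y
    rw [Finset.mem_filter, mem_cons, Finset.mem_insert, Finset.mem_image]
    constructor
    · rintro ⟨rfl | ⟨z, hz, rfl⟩, h⟩
      · exact Or.inl rfl
      · exact Or.inr ⟨z, Finset.mem_filter.2 ⟨hz, (PathsFrom.lcomp_lt_lcomp hA l).1 h⟩, rfl⟩
    · rintro (rfl | ⟨z, hz, rfl⟩)
      · exact ⟨Or.inl rfl, PathsFrom.bot_lt_lcomp hl x⟩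
      · rw [Finset.mem_filter] at hz
        exact ⟨Or.inr ⟨z, hz.1, rfl⟩, (PathsFrom.lcomp_lt_lcomp hA l).2 hz.2⟩
  rw [this, Finset.card_insert_of_notMem, Finset.card_image_of_injective _
    (PathsFrom.lcomp_injective hA l)]
  rw [Finset.mem_image]
  rintro ⟨y, -, hy⟩
  exact (PathsFrom.bot_lt_lcomp hl y).ne' hy

variable [∀ a b : V, Finite (a ⟶ b)]

/-- All nontrivial vertices lie above the least one, `l`, so the whole chain can be divided by `l`
on the left. Cancellation makes the preimage under `lcomp l` a chain again. -/
theorem exists_cons {a c : V} (σ : Cell k S a c) (h : σ.dim ≠ 0) :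
    ∃ (b : V) (l : PathClass k S a b) (τ : Cell k S b c), ⊥ < l.toPoset ∧ cons l τ = σ := by
  classical
  have hne : (σ.verts.erase ⊥).Nonempty :=
    ⟨_, Finset.mem_erase.2 ⟨(σ.bot_lt_top_of_dim_ne_zero h).ne', σ.top_mem⟩⟩
  obtain ⟨p, hp⟩ := Finset.exists_minimal hne
  have hmin : ∀ x ∈ σ.verts, x ≠ ⊥ → p ≤ x := by
    intro x hx hx0
    rcases σ.chain.total (Finset.mem_of_mem_erase hp.1) hx with h | h
    · exact h
    · exact hp.2 (Finset.mem_erase.2 ⟨hx0, hx⟩) h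
  have hp0 : p ≠ ⊥ := Finset.ne_of_mem_erase hp.1
  have hpσ : p ∈ σ.verts := Finset.mem_of_mem_erase hp.1
  obtain ⟨b, l⟩ := p
  have : Fintype (PathsFrom k S b) := Fintype.ofFinite _
  obtain ⟨t, ht⟩ : ∃ t : PathClass k S b c, σ.top = l.comp t := PathsFrom.toPoset_le_iff.1
    (hmin _ σ.top_mem (σ.bot_lt_top_of_dim_ne_zero h).ne')
  have hl : ⊥ < l.toPoset := bot_lt_iff_ne_bot.2 hp0
  let τ : Cell k S b c :=
    { top := t
      verts := Finset.univ.filter fun q => PathsFrom.lcomp l q ∈ σ.verts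
      chain := by
        intro x hx y hy _
        simp only [Finset.coe_filter, Finset.mem_univ, true_and, Set.mem_ofPred_eq] at hx hy
        change x ≤ y ∨ y ≤ x
        rw [← PathsFrom.lcomp_le_lcomp hA l, ← PathsFrom.lcomp_le_lcomp hA l]
        exact σ.chain.total hx hy
      bot_mem := by
        simp only [Finset.mem_filter, Finset.mem_univ, true_and]
        rw [PathsFrom.lcomp_bot]
        exact hpσ
      isGreatest := by
        have h1 : PathsFrom.lcomp l t.toPoset = σ.top.toPoset := by
          rw [PathsFrom.lcomp_toPoset]; exact congrArg PathClass.toPoset ht.symm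
        constructor
        · simp only [Finset.coe_filter, Finset.mem_univ, true_and, Set.mem_ofPred_eq]
          rw [h1]
          exact σ.top_mem
        · intro x hx
          simp only [Finset.coe_filter, Finset.mem_univ, true_and, Set.mem_ofPred_eq] at hx
          rw [← PathsFrom.lcomp_le_lcomp hA l, h1]
          exact σ.le_top hx }
  refine ⟨b, l, τ, hl, ext_verts ?_⟩
  ext x
  rw [mem_cons]
  constructor
  · rintro (rfl | ⟨y, hy, rfl⟩)
    · exact σ.bot_mem
    · simpa [τ] using hy
  · intro hx
    by_cases hx0 : x = ⊥
    · exact Or.inl hx0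
    · obtain ⟨y, rfl⟩ := PathsFrom.exists_lcomp (hmin x hx hx0)
      exact Or.inr ⟨y, by simpa [τ] using hx, rfl⟩

end Cell

/-! ### Facets of cells -/

namespace Facet

/-- The vertex of the cell omitted by the facet. -/
def vertex {σ τ : AnyCell k S} : Facet σ τ → PathsFrom k S σ.1
  | initial .. => ⊥
  | internal x .. => x
  | terminal _ _ σ .. => σ.top.toPoset

theorem mem_inner {a b : V} {σ : Cell k S a b} {x : PathsFrom k S a} :
    x ∈ σ.inner ↔ x ≠ σ.top.toPoset ∧ x ≠ ⊥ ∧ x ∈ σ.verts := by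
  simp [Cell.inner]

theorem vertex_mem {σ τ : AnyCell k S} (f : Facet σ τ) : f.vertex ∈ σ.2.2.verts := by
  cases f with
  | initial r hr σ τ h => exact σ.bot_mem
  | internal x σ τ hx h => exact (mem_inner.1 hx).2.2
  | terminal r hr σ τ h htop => exact σ.top_mem

theorem terminal_notMem {a b c : V} {r : PathClass k S b c} (hr : ⊥ < r.toPoset)
    {σ : Cell k S a c} {τ : Cell k S a b} (htop : σ.top = τ.top.comp r) :
    σ.top.toPoset ∉ τ.verts := by
  intro h
  have h1 := τ.le_top h
  rw [htop] at h1
  exact h1.not_gt ((PathClass.toPoset_lt_comp _ _).2 ((PathClass.bot_lt_iff_ne r).1 hr))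

theorem initial_top {a b c : V} {r : PathClass k S a b} {σ : Cell k S a c} {τ : Cell k S b c}
    (h : σ.verts = (Cell.cons r τ).verts) : σ.top = r.comp τ.top :=
  congrArg Cell.top (Cell.ext_verts h)

variable [Nontrivial k] (hA : IsHPA k S)

theorem dim_eq {σ τ : AnyCell k S} (hA : IsHPA k S) (f : Facet σ τ) :
    σ.2.2.dim = τ.2.2.dim + 1 := by
  classical
  cases f with
  | initial r hr σ τ h =>
    have : σ = Cell.cons r τ := Cell.ext_verts (by rw [h]; simp [Cell.cons]; rfl)
    subst this
    exact Cell.dim_cons hA hr τ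
  | internal x σ τ hx h =>
    have h1 := σ.card_verts
    have h2 := τ.card_verts
    have h3 := Finset.card_erase_add_one (mem_inner.1 hx).2.2
    rw [← h] at h3
    dsimp only
    omega
  | terminal r hr σ τ h htop =>
    have h1 := σ.card_verts
    have h2 := τ.card_verts
    rw [h, Finset.card_insert_of_notMem (terminal_notMem hr htop)] at h1
    dsimp only
    omega

open Classical in
theorem sign_eq {σ τ : AnyCell k S} (f : Facet σ τ) :
    f.sign = (-1) ^ (σ.2.2.verts.filter (· < f.vertex)).card := by
  cases f with
  | initial r hr σ τ h => simp [sign, vertex]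
  | internal x σ τ hx h => rfl
  | terminal r hr σ τ h htop =>
    have h1 : σ.verts.filter (· < σ.top.toPoset) = σ.verts.erase σ.top.toPoset := by
      ext x
      rw [Finset.mem_filter, Finset.mem_erase, and_comm]
      refine and_congr_left fun hx => ?_
      rw [(σ.le_top hx).lt_iff_ne]
    change (-1) ^ σ.dim = (-1) ^ (σ.verts.filter (· < σ.top.toPoset)).card
    rw [h1, Finset.card_erase_of_mem σ.top_mem]
    rfl

/-- For an initial facet, `r` has to be the least nontrivial vertex of the cell. For a terminal
facet, left cancellation recovers `r` from the two tops. Facets can therefore be compared through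
the vertex they omit. -/
theorem vertex_injective {σ τ τ' : AnyCell k S} (hA : IsHPA k S) (f : Facet σ τ)
    (f' : Facet σ τ') (h : f.vertex = f'.vertex) :
    (⟨τ, f⟩ : Σ τ, Facet σ τ) = ⟨τ', f'⟩ := by
  classical
  have key : ∀ {a b c : V} {r : PathClass k S a b} (hr : ⊥ < r.toPoset)
      {σ : Cell k S a c} {τ : Cell k S b c} (_ : σ.verts = (Cell.cons r τ).verts),
      r.toPoset ∈ σ.verts ∧ ∀ x ∈ σ.verts, x ≠ ⊥ → r.toPoset ≤ x := by
    intro a b c r hr σ τ h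
    rw [h]
    refine ⟨(Cell.mem_cons r τ).2 (Or.inr ⟨⊥, τ.bot_mem, PathsFrom.lcomp_bot r⟩), ?_⟩
    rintro x hx hx0
    rcases (Cell.mem_cons r τ).1 hx with rfl | ⟨y, -, rfl⟩
    · exact (hx0 rfl).elim
    · exact PathsFrom.toPoset_le_lcomp r y
  cases f with
  | @initial a b c r hr σ τ h1 =>
    cases f' with
    | @initial _ b' _ r' hr' _ τ' h2 =>
      have h1' : σ.verts = (Cell.cons r τ).verts := by rw [h1]; simp [Cell.cons]; rfl
      have h2' : σ.verts = (Cell.cons r' τ').verts := by rw [h2]; simp [Cell.cons]; rfl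
      obtain ⟨k1, k2⟩ := key hr h1'
      obtain ⟨k3, k4⟩ := key hr' h2'
      have h3 := le_antisymm (k2 _ k3 hr'.ne') (k4 _ k1 hr.ne')
      obtain rfl : b = b' := congrArg PathsFrom.head h3
      obtain rfl := PathClass.toPoset_injective h3
      have : τ = τ' := by
        apply Cell.ext_verts
        ext x
        rw [← Cell.lcomp_mem_cons hA hr, ← Cell.lcomp_mem_cons hA hr, ← h1', h2']
      subst this
      rfl
    | internal x _ τ' hx h2 => exact ((mem_inner.1 hx).2.1 h.symm).elim
    | terminal r' hr' _ τ' h2 htop =>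
      have h1' : σ.verts = (Cell.cons r τ).verts := by rw [h1]; simp [Cell.cons]; rfl
      have h3 := σ.le_top (key hr h1').1
      rw [← show ⊥ = σ.top.toPoset from h, le_bot_iff] at h3
      exact (hr.ne' h3).elim
  | internal x σ τ hx h1 =>
    cases f' with
    | initial r' hr' _ τ' h2 => exact ((mem_inner.1 hx).2.1 h).elim
    | internal x' _ τ' hx' h2 =>
      obtain rfl : x = x' := h
      obtain rfl : τ = τ' := Cell.ext_verts (h1.trans h2.symm)
      rfl
    | terminal r' hr' _ τ' h2 htop => exact ((mem_inner.1 hx).1 h).elim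
  | terminal r hr σ τ h1 htop1 =>
    cases f' with
    | initial r' hr' _ τ' h2 =>
      have h1' : σ.verts = (Cell.cons r' τ').verts := by rw [h2]; simp [Cell.cons]; rfl
      have h3 := σ.le_top (key hr' h1').1
      rw [show σ.top.toPoset = ⊥ from h, le_bot_iff] at h3
      exact (hr'.ne' h3).elim
    | internal x' _ τ' hx' h2 => exact ((mem_inner.1 hx').1 h.symm).elim
    | terminal r' hr' _ τ' h2 htop2 =>
      have h3 : τ.verts = τ'.verts := by
        rw [← Finset.erase_insert (terminal_notMem hr htop1), ← h1, h2,
          Finset.erase_insert (terminal_notMem hr' htop2)]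
      have h4 := Cell.anyCell_ext h3
      rw [Sigma.mk.injEq, heq_eq_eq, Sigma.mk.injEq] at h4
      obtain ⟨-, rfl, h4⟩ := h4
      obtain rfl := eq_of_heq h4
      obtain rfl : r = r' := hA.comp_left_cancel (htop1.symm.trans htop2)
      rfl

theorem dim_ne_zero {σ τ : AnyCell k S} (hA : IsHPA k S) (f : Facet σ τ) : σ.2.2.dim ≠ 0 := by
  rw [f.dim_eq hA]
  omega

/-- With `vertex_injective`, the facets of a cell of positive dimension correspond to its vertices.
In dimension zero no facet omits the single vertex. -/
theorem exists_vertex_eq [∀ a b : V, Finite (a ⟶ b)] (hA : IsHPA k S) {a c : V}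
    (σ : Cell k S a c) (h : σ.dim ≠ 0) {x : PathsFrom k S a} (hx : x ∈ σ.verts) :
    ∃ (τ : AnyCell k S) (f : Facet ⟨a, c, σ⟩ τ), f.vertex = x := by
  classical
  by_cases hx0 : x = ⊥
  · subst hx0
    obtain ⟨b, l, τ, hl, rfl⟩ := σ.exists_cons hA h
    exact ⟨_, Facet.initial l hl _ τ (by simp [Cell.cons]; rfl), rfl⟩
  by_cases hxt : x = σ.top.toPoset
  · subst hxt
    have hne : (σ.verts.erase σ.top.toPoset).Nonempty :=
      ⟨⊥, Finset.mem_erase.2 ⟨(σ.bot_lt_top_of_dim_ne_zero h).ne, σ.bot_mem⟩⟩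
    obtain ⟨p, hp⟩ := Finset.exists_maximal hne
    have hpσ : p ∈ σ.verts := Finset.mem_of_mem_erase hp.1
    obtain ⟨b, t⟩ := p
    let τ : Cell k S a b :=
      { top := t
        verts := σ.verts.erase σ.top.toPoset
        chain := σ.chain.mono (Finset.coe_subset.2 (Finset.erase_subset _ _))
        bot_mem := Finset.mem_erase.2 ⟨(σ.bot_lt_top_of_dim_ne_zero h).ne, σ.bot_mem⟩
        isGreatest := by
          refine ⟨hp.1, fun x hx => ?_⟩
          rcases σ.chain.total hpσ (Finset.mem_of_mem_erase hx) with h | h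
          · exact hp.2 hx h
          · exact h }
    obtain ⟨r, hr⟩ : ∃ r : PathClass k S b c, σ.top = t.comp r := σ.le_top hpσ
    have hr0 : ⊥ < r.toPoset := by
      rw [PathClass.bot_lt_iff_ne, ← PathClass.toPoset_lt_comp t r, ← hr]
      exact lt_of_le_of_ne (σ.le_top hpσ) (Finset.ne_of_mem_erase hp.1)
    exact ⟨_, Facet.terminal r hr0 σ τ (Finset.insert_erase σ.top_mem).symm hr, rfl⟩
  · let τ : Cell k S a c :=
      { top := σ.top
        verts := σ.verts.erase x
        chain := σ.chain.mono (Finset.coe_subset.2 (Finset.erase_subset _ _))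
        bot_mem := Finset.mem_erase.2 ⟨Ne.symm hx0, σ.bot_mem⟩
        isGreatest := ⟨Finset.mem_erase.2 ⟨Ne.symm hxt, σ.top_mem⟩,
          fun y hy => σ.le_top (Finset.mem_of_mem_erase hy)⟩ }
    exact ⟨_, Facet.internal x σ τ (mem_inner.2 ⟨hxt, hx0, hx⟩) rfl, rfl⟩

/-- The facet of `cons l σ` corresponding to a facet of `σ`. -/
def cons (hA : IsHPA k S) {a : V} : ∀ {σ τ : AnyCell k S} (_ : Facet σ τ)
    (l : PathClass k S a σ.1) (_ : ⊥ < l.toPoset),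
    Σ τ, Facet (⟨a, σ.2.1, Cell.cons l σ.2.2⟩ : AnyCell k S) τ
  -- After prepending, the old base point has become the vertex `l`. Omitting it merges `l` and `r`,
  -- so an initial facet turns into an internal one with left coefficient `1`.
  | _, _, initial r hr σ τ h, l, hl => ⟨_, internal l.toPoset (Cell.cons l σ) (Cell.cons (l.comp r) τ)
      (by
        have h' : σ = Cell.cons r τ := Cell.ext_verts (by rw [h]; simp [Cell.cons]; rfl)
        refine mem_inner.2 ⟨?_, hl.ne', ?_⟩
        · rw [h']
          refine ((PathClass.toPoset_lt_comp _ _).2 ?_).ne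
          refine (PathClass.bot_lt_iff_ne (r.comp τ.top)).1 (hr.trans_le ?_)
          exact PathClass.toPoset_le_comp _ _
        · exact (Cell.mem_cons _ _).2 (Or.inr ⟨⊥, σ.bot_mem, PathsFrom.lcomp_bot l⟩))
      (by
        classical
        have h' : σ = Cell.cons r τ := Cell.ext_verts (by rw [h]; simp [Cell.cons]; rfl)
        ext x
        rw [Finset.mem_erase, Cell.mem_cons, Cell.mem_cons, h']
        have hlr : ∀ z : PathsFrom k S _, PathsFrom.lcomp l (PathsFrom.lcomp r z) ≠ l.toPoset :=
          fun z hz => by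
            rw [← PathsFrom.lcomp_bot l] at hz
            exact (PathsFrom.bot_lt_lcomp hr z).ne' (PathsFrom.lcomp_injective hA l hz)
        constructor
        · rintro (rfl | ⟨y, hy, rfl⟩)
          · exact ⟨hl.ne, Or.inl rfl⟩
          · rw [← PathsFrom.lcomp_lcomp]
            exact ⟨hlr y, Or.inr ⟨_, (Cell.mem_cons _ _).2 (Or.inr ⟨y, hy, rfl⟩), rfl⟩⟩
        · rintro ⟨hx, rfl | ⟨y, hy, rfl⟩⟩
          · exact Or.inl rfl
          · rcases (Cell.mem_cons _ _).1 hy with rfl | ⟨z, hz, rfl⟩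
            · exact (hx (PathsFrom.lcomp_bot l)).elim
            · exact Or.inr ⟨z, hz, (PathsFrom.lcomp_lcomp _ _ _).symm⟩)⟩
  | _, _, internal x σ τ hx h, l, hl => ⟨_, internal (PathsFrom.lcomp l x) (Cell.cons l σ) (Cell.cons l τ)
      (by
        obtain ⟨h1, h2, h3⟩ := mem_inner.1 hx
        refine mem_inner.2 ⟨?_, (PathsFrom.bot_lt_lcomp hl x).ne',
          (Cell.lcomp_mem_cons hA hl).2 h3⟩
        exact fun h => h1 (PathsFrom.lcomp_injective hA l h))
      (by
        classical
        ext y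
        rw [Finset.mem_erase, Cell.mem_cons, Cell.mem_cons, h]
        constructor
        · rintro (rfl | ⟨y, hy, rfl⟩)
          · exact ⟨(PathsFrom.bot_lt_lcomp hl x).ne, Or.inl rfl⟩
          · exact ⟨fun h => Finset.ne_of_mem_erase hy (PathsFrom.lcomp_injective hA l h),
              Or.inr ⟨y, Finset.mem_of_mem_erase hy, rfl⟩⟩
        · rintro ⟨hx, rfl | ⟨y, hy, rfl⟩⟩
          · exact Or.inl rfl
          · exact Or.inr ⟨y, Finset.mem_erase.2 ⟨fun h => hx (by rw [h]), hy⟩, rfl⟩)⟩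
  | _, _, terminal r hr σ τ h htop, l, hl => ⟨_, terminal r hr (Cell.cons l σ) (Cell.cons l τ)
      (by
        classical
        ext y
        rw [Finset.mem_insert, Cell.mem_cons, Cell.mem_cons, h]
        simp only [Finset.mem_insert, exists_eq_or_imp]
        constructor
        · rintro (rfl | rfl | h)
          · exact Or.inr (Or.inl rfl)
          · exact Or.inl rfl
          · exact Or.inr (Or.inr h)
        · rintro (rfl | rfl | h)
          · exact Or.inr (Or.inl rfl)
          · exact Or.inl rfl
          · exact Or.inr (Or.inr h))
      (by
        change l.comp σ.top = (l.comp τ.top).comp r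
        rw [htop, PathClass.comp_assoc])⟩

theorem vertex_cons {σ τ : AnyCell k S} {a : V} (f : Facet σ τ) (l : PathClass k S a σ.1)
    (hl : ⊥ < l.toPoset) : (f.cons hA l hl).2.vertex = PathsFrom.lcomp l f.vertex := by
  cases f with
  | initial r hr σ τ h => exact (PathsFrom.lcomp_bot l).symm
  | internal x σ τ hx h => rfl
  | terminal r hr σ τ h htop => rfl

/-- The new vertex `⊥` lies below all translated vertices, which raises the index of each of them by
one. -/
theorem sign_cons {σ τ : AnyCell k S} {a : V} (f : Facet σ τ) (l : PathClass k S a σ.1)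
    (hl : ⊥ < l.toPoset) : (f.cons hA l hl).2.sign = -f.sign := by
  rw [sign_eq, sign_eq, vertex_cons, Cell.card_filter_cons hA hl, pow_succ]
  simp

theorem left_cons {σ τ : AnyCell k S} {a : V} (f : Facet σ τ) (l : PathClass k S a σ.1)
    (hl : ⊥ < l.toPoset) : (f.cons hA l hl).2.left = 1 := by
  cases f <;> rfl

theorem right_cons {σ τ : AnyCell k S} {a : V} (f : Facet σ τ) (l : PathClass k S a σ.1)
    (hl : ⊥ < l.toPoset) : (f.cons hA l hl).2.right = f.right := by
  cases f <;> rfl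

/-- The facets of `cons l σ`. -/
def consOption (hA : IsHPA k S) {σ : AnyCell k S} {a : V} (l : PathClass k S a σ.1)
    (hl : ⊥ < l.toPoset) :
    Option (Σ τ, Facet σ τ) → Σ τ, Facet (⟨a, σ.2.1, Cell.cons l σ.2.2⟩ : AnyCell k S) τ
  | none => ⟨σ, initial l hl (Cell.cons l σ.2.2) σ.2.2 (by simp [Cell.cons]; rfl)⟩
  | some f => f.2.cons hA l hl

/-- The vertices of `cons l σ` are `⊥`, omitted by the facet `σ`, and the translates of the vertices
of `σ`. The dimension of `σ` must be positive, because prepending `l` to a 0-cell creates a terminal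
facet that comes from no facet of the 0-cell. -/
theorem consOption_bijective [∀ a b : V, Finite (a ⟶ b)] {σ : AnyCell k S} {a : V}
    (l : PathClass k S a σ.1) (hl : ⊥ < l.toPoset) (hσ : σ.2.2.dim ≠ 0) :
    Function.Bijective (consOption hA l hl) := by
  have h0 : (consOption hA l hl none).2.vertex = ⊥ := rfl
  constructor
  · intro f g h
    have hv : (consOption hA l hl f).2.vertex = (consOption hA l hl g).2.vertex := by rw [h]
    match f, g with
    | none, none => rfl
    | none, some g =>
      rw [h0] at hv
      exact ((PathsFrom.bot_lt_lcomp hl _).ne (hv.trans (vertex_cons hA g.2 l hl))).elim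
    | some f, none =>
      rw [h0] at hv
      exact ((PathsFrom.bot_lt_lcomp hl _).ne' ((vertex_cons hA f.2 l hl).symm.trans hv)).elim
    | some f, some g =>
      have := (vertex_cons hA f.2 l hl).symm.trans (hv.trans (vertex_cons hA g.2 l hl))
      exact congrArg some (vertex_injective hA f.2 g.2 (PathsFrom.lcomp_injective hA l this))
  · rintro ⟨τ, f⟩
    rcases (Cell.mem_cons _ _).1 f.vertex_mem with h | ⟨y, hy, h⟩
    · exact ⟨none, vertex_injective hA _ f (h0.trans h.symm)⟩
    · obtain ⟨τ', g, rfl⟩ := exists_vertex_eq hA σ.2.2 hσ hy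
      exact ⟨some ⟨τ', g⟩, vertex_injective hA _ f ((vertex_cons hA g l hl).trans h)⟩

end Facet

end CellCombinatorics

/-! ### The bar complex and its contraction, with arbitrary right coefficients -/

section BarComplex

variable {k : Type w} {V : Type u} [Quiver.{v} V] [CommRing k] [Fintype V] {S : PathRelations V}
  [AcyclicQuiver V] [∀ a b : V, Finite (a ⟶ b)]

instance finite_cell (a b : V) : Finite (Cell k S a b) :=
  Finite.of_injective (fun σ => σ.verts) fun _ _ h => Cell.ext_verts h

instance fintype_anyCell : Fintype (AnyCell k S) := Fintype.ofFinite _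

instance finite_facet (σ τ : AnyCell k S) : Finite (Facet σ τ) := by
  let g : ∀ {σ τ : AnyCell k S}, Facet σ τ →
      PathsFrom k S σ.1 ⊕ PathsFrom k S σ.1 ⊕ PathClass k S τ.2.1 σ.2.1 := fun f => match f with
    | Facet.initial r .. => Sum.inl r.toPoset
    | Facet.internal x .. => Sum.inr (Sum.inl x)
    | Facet.terminal r .. => Sum.inr (Sum.inr r)
  have hg : ∀ {σ τ : AnyCell k S} (f f' : Facet σ τ), g f = g f' → f = f' := by
    intro σ τ f f' h
    cases f with
    | initial r hr σ τ h1 =>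
      cases f' with
      | initial r' hr' _ _ h2 =>
        have : r = r' := PathClass.toPoset_injective (Sum.inl_injective h)
        subst this
        rfl
      | internal x _ _ hx h2 => exact (Sum.inl_ne_inr h).elim
      | terminal r' hr' _ _ h2 htop2 => exact (Sum.inl_ne_inr h).elim
    | internal x σ τ hx h1 =>
      cases f' with
      | initial r' hr' _ _ h2 => exact (Sum.inr_ne_inl h).elim
      | internal x' _ _ hx' h2 =>
        have : x = x' := Sum.inl_injective (Sum.inr_injective h)
        subst this
        rfl
      | terminal r' hr' _ _ h2 htop2 => exact (Sum.inl_ne_inr (Sum.inr_injective h)).elim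
    | terminal r hr σ τ h1 htop1 =>
      cases f' with
      | initial r' hr' _ _ h2 => exact (Sum.inr_ne_inl h).elim
      | internal x _ _ hx h2 => exact (Sum.inr_ne_inl (Sum.inr_injective h)).elim
      | terminal r' hr' _ _ h2 htop2 =>
        have : r = r' := Sum.inr_injective (Sum.inr_injective h)
        subst this
        rfl
  exact Finite.of_injective g fun f f' h => hg f f' h

instance fintype_facet (σ τ : AnyCell k S) : Fintype (Facet σ τ) := Fintype.ofFinite _

/-- The coefficient of a facet in the enveloping algebra. -/
def Facet.coeff {σ τ : AnyCell k S} (f : Facet σ τ) : Env k S :=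
  f.left ⊗ₜ[k] MulOpposite.op f.right

variable (k S) in
/-- The matrix of the differential of the bar complex. -/
def barMatrix : Matrix (AnyCell k S) (AnyCell k S) (Env k S) :=
  fun σ τ => ∑ f : Facet σ τ, f.sign • f.coeff

variable {B : Type*} [Ring B] [Algebra k B] (ψ : (QuiverAlgebra k S)ᵐᵒᵖ →ₐ[k] B)

/-- Change of coefficients on the right. -/
def changeRight : Env k S →ₐ[k] QuiverAlgebra k S ⊗[k] B :=
  Algebra.TensorProduct.map (AlgHom.id k (QuiverAlgebra k S)) ψ

theorem changeRight_tmul (x : QuiverAlgebra k S) (y : (QuiverAlgebra k S)ᵐᵒᵖ) :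
    changeRight ψ (x ⊗ₜ[k] y) = x ⊗ₜ[k] ψ y := by
  simp [changeRight]

/-- The differential of the bar complex, with coefficients changed along `ψ`. -/
def barDiff : (AnyCell k S → QuiverAlgebra k S ⊗[k] B) →ₗ[k]
    (AnyCell k S → QuiverAlgebra k S ⊗[k] B) where
  toFun v := Matrix.vecMul v ((barMatrix k S).map (changeRight ψ))
  map_add' v w := Matrix.add_vecMul _ v w
  map_smul' r v := Matrix.smul_vecMul r v _

theorem barDiff_apply (v : AnyCell k S → QuiverAlgebra k S ⊗[k] B) :
    barDiff ψ v = Matrix.vecMul v ((barMatrix k S).map (changeRight ψ)) := rfl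

theorem barDiff_smul (r : QuiverAlgebra k S ⊗[k] B) (v : AnyCell k S → QuiverAlgebra k S ⊗[k] B) :
    barDiff ψ (r • v) = r • barDiff ψ v := Matrix.smul_vecMul r v _

open Classical in
theorem barDiff_single (σ : AnyCell k S) (x : QuiverAlgebra k S) (y : B) :
    barDiff ψ (Pi.single σ (x ⊗ₜ y)) = ∑ f : (Σ τ, Facet σ τ), f.2.sign •
      (Pi.single f.1 ((x * f.2.left) ⊗ₜ[k] (y * ψ (MulOpposite.op f.2.right))) :
        AnyCell k S → QuiverAlgebra k S ⊗[k] B) := by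
  rw [barDiff_apply, Matrix.single_vecMul, Fintype.sum_sigma]
  ext τ
  rw [Finset.sum_apply, Finset.sum_eq_single τ]
  · simp only [Pi.smul_apply, Matrix.row, Matrix.map_apply, barMatrix, smul_eq_mul, map_sum,
      Finset.sum_apply, Pi.single_eq_same, Finset.mul_sum]
    refine Finset.sum_congr rfl fun f _ => ?_
    rw [map_zsmul, mul_smul_comm, Facet.coeff, changeRight_tmul,
      Algebra.TensorProduct.tmul_mul_tmul]
  · intro τ' _ hτ
    rw [Finset.sum_apply]
    refine Finset.sum_eq_zero fun f _ => ?_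
    rw [Pi.smul_apply, Pi.single_eq_of_ne (Ne.symm hτ), smul_zero]
  · simp

open Classical in
/-- The contraction on a generator. -/
def contractAux (σ : AnyCell k S) :
    AnyClass k S → (B →ₗ[k] (AnyCell k S → QuiverAlgebra k S ⊗[k] B)) := fun ⟨a, b, l⟩ =>
  -- For a trivial `l` the cell `[l | η]` would be degenerate, so the contraction is zero there.
  -- Without oriented cycles, `a ≠ b` says that `l` is nontrivial.
  if h : b = σ.1 ∧ a ≠ b then
    (LinearMap.single k (fun _ : AnyCell k S => QuiverAlgebra k S ⊗[k] B)
      (⟨a, σ.2.1, Cell.cons (h.1 ▸ l) σ.2.2⟩ : AnyCell k S)) ∘ₗ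
      TensorProduct.mk k (QuiverAlgebra k S) B (PathClass.id a).toAlg
  else 0

variable (k S B) in
/-- The contracting homotopy of the bar complex: `l ⊗ [η] ⊗ r ↦ 1 ⊗ [l | η] ⊗ r`. -/
def contract : (AnyCell k S → QuiverAlgebra k S ⊗[k] B) →ₗ[k]
    (AnyCell k S → QuiverAlgebra k S ⊗[k] B) :=
  ∑ σ, (TensorProduct.lift (pathBasis.constr k (contractAux σ))) ∘ₗ LinearMap.proj σ

open Classical in
theorem contract_single {a : V} (σ : AnyCell k S) (l : PathClass k S a σ.1) (h : a ≠ σ.1)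
    (y : B) :
    contract k S B (Pi.single σ (l.toAlg ⊗ₜ[k] y)) =
      Pi.single (⟨a, σ.2.1, Cell.cons l σ.2.2⟩ : AnyCell k S)
        ((PathClass.id a).toAlg ⊗ₜ[k] y) := by
  rw [contract, LinearMap.sum_apply, Finset.sum_eq_single σ]
  · rw [LinearMap.comp_apply, LinearMap.proj_apply, Pi.single_eq_same, TensorProduct.lift.tmul,
      ← pathBasis_mk, Module.Basis.constr_basis]
    simp [contractAux, h]
  · intro τ _ hτ
    rw [LinearMap.comp_apply, LinearMap.proj_apply, Pi.single_eq_of_ne hτ, map_zero]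
  · simp

open Classical in
theorem contract_single_self (σ : AnyCell k S) (l : PathClass k S σ.1 σ.1) (y : B) :
    contract k S B (Pi.single σ (l.toAlg ⊗ₜ[k] y)) = 0 := by
  rw [contract, LinearMap.sum_apply]
  refine Finset.sum_eq_zero fun τ _ => ?_
  rw [LinearMap.comp_apply, LinearMap.proj_apply]
  by_cases hτ : τ = σ
  · subst hτ
    rw [Pi.single_eq_same, TensorProduct.lift.tmul, ← pathBasis_mk, Module.Basis.constr_basis]
    simp [contractAux]
  · rw [Pi.single_eq_of_ne hτ, map_zero]

/-- The augmentation `x ⊗ y ↦ y ψ(x)` of the bar complex, on one summand. -/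
def augTerm : QuiverAlgebra k S ⊗[k] B →ₗ[k] B :=
  TensorProduct.lift ((LinearMap.mul k B).flip ∘ₗ ψ.toLinearMap ∘ₗ
    (MulOpposite.opLinearEquiv k).toLinearMap)

theorem augTerm_tmul (x : QuiverAlgebra k S) (y : B) :
    augTerm ψ (x ⊗ₜ y) = y * ψ (MulOpposite.op x) := rfl

/-- The augmentation of the bar complex. -/
def barAug : (AnyCell k S → QuiverAlgebra k S ⊗[k] B) →ₗ[k] B :=
  ∑ a : V, augTerm ψ ∘ₗ LinearMap.proj (⟨a, a, Cell.vertex a⟩ : AnyCell k S)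

theorem barAug_apply (v : AnyCell k S → QuiverAlgebra k S ⊗[k] B) :
    barAug ψ v = ∑ a : V, augTerm ψ (v ⟨a, a, Cell.vertex a⟩) := by
  simp [barAug]

open Classical in
theorem barAug_single (a : V) (x : QuiverAlgebra k S ⊗[k] B) :
    barAug ψ (Pi.single (⟨a, a, Cell.vertex a⟩ : AnyCell k S) x) = augTerm ψ x := by
  rw [barAug_apply, Finset.sum_eq_single a]
  · rw [Pi.single_eq_same]
  · intro b _ hb
    rw [Pi.single_eq_of_ne, map_zero]
    exact fun h => hb (congrArg Sigma.fst h)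
  · simp

open Classical in
/-- The section of the augmentation. -/
def barUnit (y : B) : AnyCell k S → QuiverAlgebra k S ⊗[k] B :=
  ∑ a : V, Pi.single (⟨a, a, Cell.vertex a⟩ : AnyCell k S)
    ((PathClass.id a).toAlg ⊗ₜ[k] (y * ψ (MulOpposite.op (PathClass.id a).toAlg)))

open Classical in
/-- The term of the bar complex in degree `n`, as a submodule. -/
def barSubmodule (n : ℕ) : Submodule k (AnyCell k S → QuiverAlgebra k S ⊗[k] B) :=
  Submodule.span k {v | ∃ (a b c : V) (l : PathClass k S a b) (σ : Cell k S b c) (y : B),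
    σ.dim = n ∧ y * ψ (MulOpposite.op (PathClass.id c).toAlg) = y ∧
    v = Pi.single (⟨b, c, σ⟩ : AnyCell k S) (l.toAlg ⊗ₜ y)}

open Classical in
theorem single_mem_barSubmodule {a b c : V} (l : PathClass k S a b) (σ : Cell k S b c) (y : B)
    (hy : y * ψ (MulOpposite.op (PathClass.id c).toAlg) = y) :
    Pi.single (⟨b, c, σ⟩ : AnyCell k S) (l.toAlg ⊗ₜ y) ∈ barSubmodule ψ σ.dim :=
  Submodule.subset_span ⟨a, b, c, l, σ, y, rfl, hy, rfl⟩

theorem barUnit_mem (y : B) : barUnit ψ y ∈ barSubmodule (S := S) ψ 0 := by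
  refine Submodule.sum_mem _ fun a _ => single_mem_barSubmodule ψ _ (Cell.vertex a) _ ?_
  rw [mul_assoc, ← map_mul, ← MulOpposite.op_mul, PathClass.toAlg_mul, PathClass.comp_id]

variable [Nontrivial k] (hA : IsHPA k S)
include hA

theorem barDiff_mem {n : ℕ} {v : AnyCell k S → QuiverAlgebra k S ⊗[k] B}
    (hv : v ∈ barSubmodule ψ (n + 1)) : barDiff ψ v ∈ barSubmodule ψ n := by
  induction hv using Submodule.span_induction with
  | zero => rw [map_zero]; exact zero_mem _
  | add x y _ _ hx hy => rw [map_add]; exact add_mem hx hy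
  | smul r x _ hx => rw [map_smul]; exact Submodule.smul_mem _ r hx
  | mem v hv =>
    obtain ⟨a, b, c, l, σ, y, hn, hy, rfl⟩ := hv
    rw [barDiff_single]
    refine Submodule.sum_mem _ fun ⟨τ, f⟩ _ => ?_
    rw [← Int.cast_smul_eq_zsmul k]
    refine Submodule.smul_mem _ _ ?_
    have hd := f.dim_eq hA
    cases f with
    | initial r hr σ τ h =>
      obtain rfl : τ.dim = n := by dsimp only at hd; omega
      simp only [Facet.left, Facet.right, PathClass.toAlg_mul]
      refine single_mem_barSubmodule ψ _ τ _ ?_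
      rw [MulOpposite.op_one, map_one, mul_one, hy]
    | internal x σ τ hx h =>
      obtain rfl : τ.dim = n := by dsimp only at hd; omega
      simp only [Facet.left, Facet.right, mul_one]
      refine single_mem_barSubmodule ψ _ τ _ ?_
      rw [MulOpposite.op_one, map_one, mul_one, hy]
    | terminal r hr σ τ h htop =>
      obtain rfl : τ.dim = n := by dsimp only at hd; omega
      simp only [Facet.left, Facet.right, mul_one]
      refine single_mem_barSubmodule ψ _ τ _ ?_
      rw [mul_assoc, ← map_mul, ← MulOpposite.op_mul, PathClass.id_mul_toAlg]

theorem barDiff_eq_zero {v : AnyCell k S → QuiverAlgebra k S ⊗[k] B}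
    (hv : v ∈ barSubmodule ψ 0) : barDiff ψ v = 0 := by
  induction hv using Submodule.span_induction with
  | zero => rw [map_zero]
  | add x y _ _ hx hy => rw [map_add, hx, hy, add_zero]
  | smul r x _ hx => rw [map_smul, hx, smul_zero]
  | mem v hv =>
    obtain ⟨a, b, c, l, σ, y, hn, hy, rfl⟩ := hv
    rw [barDiff_single]
    exact Finset.sum_eq_zero fun f _ => (f.2.dim_ne_zero hA hn).elim

theorem contract_mem {n : ℕ} {v : AnyCell k S → QuiverAlgebra k S ⊗[k] B}
    (hv : v ∈ barSubmodule ψ n) : contract k S B v ∈ barSubmodule ψ (n + 1) := by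
  induction hv using Submodule.span_induction with
  | zero => rw [map_zero]; exact zero_mem _
  | add x y _ _ hx hy => rw [map_add]; exact add_mem hx hy
  | smul r x _ hx => rw [map_smul]; exact Submodule.smul_mem _ r hx
  | mem v hv =>
    obtain ⟨a, b, c, l, σ, y, rfl, hy, rfl⟩ := hv
    by_cases h : a = b
    · subst h
      rw [contract_single_self ⟨a, c, σ⟩ l]
      exact zero_mem _
    · rw [contract_single ⟨b, c, σ⟩ l h, ← Cell.dim_cons hA ((PathClass.bot_lt_iff_ne l).2 h) σ]
      exact single_mem_barSubmodule ψ _ _ _ hy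

-- The two facets of the 1-cell `[e < l]` are its end points: the head, with `l` on the left, and
-- the tail, with `l` on the right and a minus sign. The second term is the correction by the
-- augmentation in degree zero.
open Classical in
theorem barDiff_contract_single_zero {a b : V} (l : PathClass k S a b) (h : a ≠ b) (y : B) :
    barDiff ψ (Pi.single (⟨a, b, Cell.cons l (Cell.vertex b)⟩ : AnyCell k S) ((PathClass.id a).toAlg ⊗ₜ[k] y)) =
      Pi.single (⟨b, b, Cell.vertex b⟩ : AnyCell k S) (l.toAlg ⊗ₜ[k] y) -
      Pi.single (⟨a, a, Cell.vertex a⟩ : AnyCell k S)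
        ((PathClass.id a).toAlg ⊗ₜ[k] (y * ψ (MulOpposite.op l.toAlg))) := by
  have hl : ⊥ < l.toPoset := (PathClass.bot_lt_iff_ne l).2 h
  have hverts : ∀ x, x ∈ (Cell.cons l (Cell.vertex b)).verts ↔ x = ⊥ ∨ x = l.toPoset := by
    intro x
    simp [Cell.mem_cons, Cell.vertex, PathsFrom.lcomp_bot, eq_comm]
  let f₀ : Facet (⟨a, b, Cell.cons l (Cell.vertex b)⟩ : AnyCell k S) ⟨b, b, Cell.vertex b⟩ :=
    Facet.initial l hl _ _ (by simp [Cell.cons]; rfl)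
  let f₁ : Facet (⟨a, b, Cell.cons l (Cell.vertex b)⟩ : AnyCell k S) ⟨a, a, Cell.vertex a⟩ :=
    Facet.terminal l hl _ _ (by
      ext x
      rw [hverts, Finset.mem_insert, show (Cell.cons l (Cell.vertex b)).top = l from
        PathClass.comp_id l]
      simp [Cell.vertex, or_comm]) (by
      change l.comp (PathClass.id b) = (PathClass.id a).comp l
      rw [PathClass.comp_id, PathClass.id_comp])
  have hv₁ : f₁.vertex = l.toPoset := congrArg PathClass.toPoset (PathClass.comp_id l)
  rw [barDiff_single, Fintype.sum_eq_add (⟨_, f₀⟩ : Σ τ, Facet _ τ) ⟨_, f₁⟩]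
  · have h₁ : f₁.sign = -1 := by
      change (-1) ^ (Cell.cons l (Cell.vertex b)).dim = -1
      rw [Cell.dim_cons hA hl, Cell.dim_vertex]
      norm_num
    have h₀ : f₀.sign = 1 := rfl
    have e₀ : f₀.left = l.toAlg := rfl
    have e₁ : f₀.right = 1 := rfl
    have e₂ : f₁.left = 1 := rfl
    have e₃ : f₁.right = l.toAlg := rfl
    simp only [h₀, h₁, e₀, e₁, e₂, e₃]
    rw [one_smul, neg_one_smul, PathClass.id_mul_toAlg, MulOpposite.op_one, map_one, mul_one,
      mul_one, ← sub_eq_add_neg]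
  · intro h'
    exact h (congrArg Sigma.fst (congrArg Sigma.fst h')).symm
  · rintro ⟨τ, f⟩ ⟨h0, h1⟩
    exfalso
    rcases (hverts _).1 f.vertex_mem with h | h
    · exact h0 (Facet.vertex_injective hA f f₀ h)
    · exact h1 (Facet.vertex_injective hA f f₁ (h.trans hv₁.symm))

theorem contract_homotopy_zero {v : AnyCell k S → QuiverAlgebra k S ⊗[k] B}
    (hv : v ∈ barSubmodule ψ 0) :
    barDiff ψ (contract k S B v) = v - barUnit ψ (barAug ψ v) := by
  classical
  have hadd : ∀ x y : B, barUnit (S := S) ψ (x + y) = barUnit ψ x + barUnit ψ y := by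
    intro x y
    rw [barUnit, barUnit, barUnit, ← Finset.sum_add_distrib]
    refine Finset.sum_congr rfl fun a _ => ?_
    rw [add_mul, TensorProduct.tmul_add, Pi.single_add]
  have hsmul : ∀ (r : k) (x : B), barUnit (S := S) ψ (r • x) = r • barUnit ψ x := by
    intro r x
    rw [barUnit, barUnit, Finset.smul_sum]
    refine Finset.sum_congr rfl fun a _ => ?_
    rw [smul_mul_assoc, TensorProduct.tmul_smul, Pi.single_smul]
  induction hv using Submodule.span_induction with
  | zero => simp [barUnit]
  | add x y _ _ hx hy => rw [map_add, map_add, hx, hy, map_add, hadd]; abel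
  | smul r x _ hx => rw [map_smul, map_smul, hx, map_smul, hsmul, smul_sub]
  | mem v hv =>
    obtain ⟨a, b, c, l, σ, y, hn, hy, rfl⟩ := hv
    have hσ := σ.eq_vertex_of_dim_eq_zero hn
    obtain rfl : b = c := (congrArg (fun τ : AnyCell k S => τ.2.1) hσ).symm
    obtain rfl : σ = Cell.vertex b := by simpa using hσ
    have hU : barUnit ψ (y * ψ (MulOpposite.op l.toAlg)) = Pi.single (⟨a, a, Cell.vertex a⟩ : AnyCell k S)
        ((PathClass.id a).toAlg ⊗ₜ[k] (y * ψ (MulOpposite.op l.toAlg))) := by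
      rw [barUnit, Finset.sum_eq_single a]
      · rw [mul_assoc, ← map_mul, ← MulOpposite.op_mul, PathClass.id_mul_toAlg]
      · intro a' _ ha'
        rw [mul_assoc, ← map_mul, ← MulOpposite.op_mul, PathClass.toAlg_mul_of_ne _ _ ha']
        simp
      · simp
    rw [barAug_single, augTerm_tmul, hU]
    by_cases h : a = b
    · subst h
      rw [contract_single_self ⟨a, a, Cell.vertex a⟩ l, map_zero, l.eq_id, hy, sub_self]
    · rw [contract_single ⟨b, b, Cell.vertex b⟩ l h]
      exact barDiff_contract_single_zero ψ hA l h y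

-- An initial facet carries its path `r` as left coefficient, and prepending `l r` gives the cell
-- obtained from `[l | r | ⋯]` by omitting `l`. The other facets have left coefficient `1`, and
-- prepending `l` commutes with passing to them.
omit [Nontrivial k] hA in
open Classical in
theorem contract_facet {a : V} {σ τ : AnyCell k S} (f : Facet σ τ) [Nontrivial k]
    (hA : IsHPA k S) (l : PathClass k S a σ.1) (hl : ⊥ < l.toPoset) (y : B) :
    contract k S B (Pi.single τ ((l.toAlg * f.left) ⊗ₜ[k] y)) =
      Pi.single (f.cons hA l hl).1
        ((PathClass.id a).toAlg ⊗ₜ[k] y) := by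
  cases f with
  | @initial _ b c r hr σ τ h =>
    rw [Facet.left, PathClass.toAlg_mul]
    refine contract_single ⟨b, c, τ⟩ (l.comp r) ?_ y
    rw [← PathClass.bot_lt_iff_ne (l.comp r)]
    exact hl.trans_le (PathClass.toPoset_le_comp l r)
  | @internal b c x σ τ hx h =>
    rw [Facet.left, mul_one]
    exact contract_single ⟨b, c, τ⟩ l ((PathClass.bot_lt_iff_ne l).1 hl) y
  | @terminal b c d r hr σ τ h htop =>
    rw [Facet.left, mul_one]
    exact contract_single ⟨b, c, τ⟩ l ((PathClass.bot_lt_iff_ne l).1 hl) y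

/-- For nontrivial `l`, the boundary of `[l | η]` consists of `η`, with `l` on the left, and of the
terms `[l | η']` for the facets `η'` of `η`, with the opposite sign. The latter make up minus the
contraction of the boundary. -/
theorem contract_homotopy {n : ℕ} {v : AnyCell k S → QuiverAlgebra k S ⊗[k] B}
    (hv : v ∈ barSubmodule ψ (n + 1)) :
    barDiff ψ (contract k S B v) = v - contract k S B (barDiff ψ v) := by
  classical
  induction hv using Submodule.span_induction with
  | zero => simp
  | add x y _ _ hx hy => rw [map_add, map_add, hx, hy, map_add, map_add]; abel
  | smul r x _ hx => rw [map_smul, map_smul, hx, map_smul, map_smul, smul_sub]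
  | mem v hv =>
    obtain ⟨a, b, c, l, σ, y, hn, hy, rfl⟩ := hv
    have hσ : σ.dim ≠ 0 := by omega
    rw [barDiff_single ψ ⟨b, c, σ⟩, map_sum]
    simp only [map_zsmul]
    by_cases h : a = b
    · subst h
      obtain rfl := l.eq_id
      -- The contraction kills a generator with trivial left factor, so the generator has to come
      -- back from its boundary. Only the initial facet acquires a nontrivial left factor, and
      -- prepending that factor again restores the cell.
      rw [contract_single_self ⟨a, c, σ⟩, map_zero, eq_comm, sub_eq_zero, eq_comm]
      obtain ⟨b, p, τ, hp, rfl⟩ := σ.exists_cons hA hσ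
      let f₀ : Facet (⟨a, c, Cell.cons p τ⟩ : AnyCell k S) ⟨b, c, τ⟩ :=
        Facet.initial p hp _ _ (by simp [Cell.cons]; rfl)
      rw [Finset.sum_eq_single (⟨_, f₀⟩ : Σ τ, Facet _ τ)]
      · have e₀ : f₀.left = p.toAlg := rfl
        have e₁ : f₀.right = 1 := rfl
        have e₂ : f₀.sign = 1 := rfl
        simp only [e₀, e₁, e₂]
        rw [one_smul, MulOpposite.op_one, map_one, mul_one, PathClass.id_mul_toAlg]
        exact contract_single ⟨b, c, τ⟩ p ((PathClass.bot_lt_iff_ne p).1 hp) y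
      · rintro ⟨τ', f⟩ _ hf
        have key : ∀ {σ : Cell k S a c} {τ' : AnyCell k S} (f : Facet ⟨a, c, σ⟩ τ'),
            f.vertex ≠ ⊥ → contract k S B (Pi.single τ' (((PathClass.id a).toAlg * f.left)
            ⊗ₜ[k] (y * ψ (MulOpposite.op f.right)))) = 0 := by
          intro σ τ' f hv
          cases f with
          | initial r hr σ τ h => exact (hv rfl).elim
          | internal x σ τ hx h =>
            rw [Facet.left, mul_one]
            exact contract_single_self ⟨a, c, τ⟩ _ _
          | @terminal _ b' _ r hr σ τ h htop =>
            rw [Facet.left, mul_one]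
            exact contract_single_self ⟨a, b', τ⟩ _ _
        rw [key f fun h => hf (Facet.vertex_injective hA f f₀ h), smul_zero]
      · simp
    · have hl : ⊥ < l.toPoset := (PathClass.bot_lt_iff_ne l).2 h
      rw [contract_single ⟨b, c, σ⟩ l h, barDiff_single,
        ← (Facet.consOption_bijective hA (σ := ⟨b, c, σ⟩) l hl hσ).sum_comp, Fintype.sum_option,
        sub_eq_add_neg, ← Finset.sum_neg_distrib]
      congr 1
      · simp only [Facet.consOption, Facet.sign, Facet.left, Facet.right]
        rw [one_smul, MulOpposite.op_one, map_one, mul_one, PathClass.id_mul_toAlg]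
      · refine Finset.sum_congr rfl fun f _ => ?_
        simp only [Facet.consOption]
        rw [Facet.sign_cons, Facet.left_cons, Facet.right_cons, neg_smul, mul_one,
          contract_facet f.2 hA l hl]

omit [∀ a b : V, Finite (a ⟶ b)] hA [Nontrivial k] in
open Classical in
theorem smul_single (x : QuiverAlgebra k S) (σ : AnyCell k S) (z : QuiverAlgebra k S) (y : B) :
    (x ⊗ₜ[k] (1 : B)) • (Pi.single σ (z ⊗ₜ[k] y) : AnyCell k S → QuiverAlgebra k S ⊗[k] B) =
      Pi.single σ ((x * z) ⊗ₜ[k] y) := by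
  ext τ
  rw [Pi.smul_apply, smul_eq_mul]
  by_cases h : τ = σ
  · subst h
    rw [Pi.single_eq_same, Pi.single_eq_same, Algebra.TensorProduct.tmul_mul_tmul, one_mul]
  · rw [Pi.single_eq_of_ne h, Pi.single_eq_of_ne h, mul_zero]

theorem barAug_barDiff {v : AnyCell k S → QuiverAlgebra k S ⊗[k] B}
    (hv : v ∈ barSubmodule ψ 1) : barAug ψ (barDiff ψ v) = 0 := by
  classical
  induction hv using Submodule.span_induction with
  | zero => simp
  | add x y _ _ hx hy => rw [map_add, map_add, hx, hy, add_zero]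
  | smul r x _ hx => rw [map_smul, map_smul, hx, smul_zero]
  | mem v hv =>
    obtain ⟨a, b, c, l, σ, y, hn, hy, rfl⟩ := hv
    obtain ⟨d, p, τ, hp, rfl⟩ := σ.exists_cons hA (by omega)
    rw [Cell.dim_cons hA hp] at hn
    have hτ := τ.eq_vertex_of_dim_eq_zero (by omega)
    obtain rfl : d = c := (congrArg (fun τ : AnyCell k S => τ.2.1) hτ).symm
    obtain rfl : τ = Cell.vertex d := by simpa using hτ
    rw [← l.toAlg_mul_id, ← smul_single, barDiff_smul,
      barDiff_contract_single_zero ψ hA p ((PathClass.bot_lt_iff_ne p).1 hp), smul_sub,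
      smul_single, smul_single, map_sub, barAug_single, barAug_single, augTerm_tmul, augTerm_tmul,
      l.toAlg_mul_id, mul_assoc, ← map_mul, ← MulOpposite.op_mul, sub_self]

/-- No cancellation of signs has to be checked. With `s` the contraction, the homotopy identity
gives `d d s u = s d d u`, which vanishes by induction on the degree, the lowest degrees using the
augmentation. Every generator of positive degree is a left multiple of some `s u`. -/
theorem barDiff_barDiff {n : ℕ} {v : AnyCell k S → QuiverAlgebra k S ⊗[k] B}
    (hv : v ∈ barSubmodule ψ n) : barDiff ψ (barDiff ψ v) = 0 := by
  classical
  induction n generalizing v with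
  | zero => rw [barDiff_eq_zero ψ hA hv, map_zero]
  | succ n ih =>
    have key : ∀ u ∈ barSubmodule ψ n, barDiff ψ (barDiff ψ (contract k S B u)) = 0 := by
      intro u hu
      rcases n with _ | _ | n
      · rw [contract_homotopy_zero ψ hA hu, map_sub, barDiff_eq_zero ψ hA hu,
          barDiff_eq_zero ψ hA (barUnit_mem ψ _), sub_zero]
      · rw [contract_homotopy ψ hA hu, map_sub, contract_homotopy_zero ψ hA (barDiff_mem ψ hA hu),
          barAug_barDiff ψ hA hu]
        simp [barUnit]
      · rw [contract_homotopy ψ hA hu, map_sub, contract_homotopy ψ hA (barDiff_mem ψ hA hu),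
          ih hu, map_zero, sub_zero, sub_self]
    induction hv using Submodule.span_induction with
    | zero => simp
    | add x y _ _ hx hy => rw [map_add, map_add, hx, hy, add_zero]
    | smul r x _ hx => rw [map_smul, map_smul, hx, smul_zero]
    | mem v hv =>
      obtain ⟨a, b, c, l, σ, y, hn, hy, rfl⟩ := hv
      obtain ⟨d, p, τ, hp, rfl⟩ := σ.exists_cons hA (by omega)
      rw [Cell.dim_cons hA hp] at hn
      obtain rfl : τ.dim = n := by omega
      have h1 := key _ (single_mem_barSubmodule ψ p τ y hy)
      rw [contract_single ⟨d, c, τ⟩ p ((PathClass.bot_lt_iff_ne p).1 hp)] at h1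
      rw [← l.toAlg_mul_id, ← smul_single, barDiff_smul, barDiff_smul, h1, smul_zero]

theorem bar_exact_succ {n : ℕ} {v : AnyCell k S → QuiverAlgebra k S ⊗[k] B}
    (hv : v ∈ barSubmodule ψ (n + 1)) (h : barDiff ψ v = 0) :
    ∃ u ∈ barSubmodule ψ (n + 2), barDiff ψ u = v :=
  ⟨_, contract_mem ψ hA hv, by rw [contract_homotopy ψ hA hv, h, map_zero, sub_zero]⟩

theorem bar_exact_zero {v : AnyCell k S → QuiverAlgebra k S ⊗[k] B}
    (hv : v ∈ barSubmodule ψ 0) (h : barAug ψ v = 0) :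
    ∃ u ∈ barSubmodule ψ 1, barDiff ψ u = v :=
  ⟨_, contract_mem ψ hA hv, by rw [contract_homotopy_zero ψ hA hv, h]; simp [barUnit]⟩

end BarComplex

/-! ### Discrete Morse theory of matchings that preserve the top path -/

section Morse

open scoped Classical

variable {k : Type w} {V : Type u} [Quiver.{v} V] [CommRing k] [Fintype V] {S : PathRelations V}
  [AcyclicQuiver V]

instance envRing : Ring (Env k S) := inferInstance

instance envNeg : Neg (Env k S) := envRing.toNeg

/-- Matched cells have the same top path. -/
def IsVertical (M : CellMatching k S) : Prop :=
  ∀ σ τ, M σ τ → ∃ (a b : V) (σ' τ' : Cell k S a b), σ'.top = τ'.top ∧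
    σ = ⟨a, b, σ'⟩ ∧ τ = ⟨a, b, τ'⟩

namespace Facet

theorem sign_mul_self [Nontrivial k] {σ τ : AnyCell k S} (f : Facet σ τ) : f.sign * f.sign = 1 := by
  rw [sign_eq, ← mul_pow]
  simp

/-- Without oriented cycles, an initial facet moves the tail and a terminal facet moves the head.
Between cells with the same ends only internal facets are left, so the matched part of the
differential has the invertible entries `±1`. -/
theorem coeff_vertical {a b : V} {σ τ : Cell k S a b}
    (f : Facet (⟨a, b, σ⟩ : AnyCell k S) ⟨a, b, τ⟩) : f.coeff = 1 := by
  have key : ∀ {σ τ : AnyCell k S} (f : Facet σ τ), σ.1 = τ.1 → σ.2.1 = τ.2.1 → f.coeff = 1 := by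
    intro σ τ f h1 h2
    cases f with
    | initial r hr σ τ h => exact ((PathClass.bot_lt_iff_ne r).1 hr h1).elim
    | internal x σ τ hx h => rfl
    | terminal r hr σ τ h htop => exact ((PathClass.bot_lt_iff_ne r).1 hr h2.symm).elim
  exact key f rfl rfl

theorem eq_of_vertical {a b : V} {σ τ : Cell k S a b}
    (f g : Facet (⟨a, b, σ⟩ : AnyCell k S) ⟨a, b, τ⟩) : f = g := by
  cases f with
  | initial r hr σ τ h => exact ((PathClass.bot_lt_iff_ne r).1 hr rfl).elim
  | terminal r hr σ τ h htop => exact ((PathClass.bot_lt_iff_ne r).1 hr rfl).elim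
  | internal x σ τ hx h =>
    cases g with
    | initial r hr σ τ h => exact ((PathClass.bot_lt_iff_ne r).1 hr rfl).elim
    | terminal r hr σ τ h htop => exact ((PathClass.bot_lt_iff_ne r).1 hr rfl).elim
    | internal x' _ _ hx' h' =>
      obtain rfl : x = x' := by
        by_contra hne
        have h1 : x ∈ τ.verts := by
          rw [h']
          exact Finset.mem_erase.2 ⟨hne, (mem_inner.1 hx).2.2⟩
        rw [h] at h1
        exact Finset.notMem_erase _ _ h1
      rfl

theorem idem_mul_coeff {σ τ : AnyCell k S} (f : Facet σ τ) :
    idem k S σ.1 σ.2.1 * f.coeff = f.coeff * idem k S τ.1 τ.2.1 := by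
  cases f with
  | initial r hr σ τ h =>
    simp only [coeff, left, right, idem, Algebra.TensorProduct.tmul_mul_tmul]
    rw [PathClass.id_mul_toAlg, PathClass.toAlg_mul_id, MulOpposite.op_one, one_mul, mul_one]
  | internal x σ τ hx h =>
    simp only [coeff, left, right, idem, Algebra.TensorProduct.tmul_mul_tmul]
    rw [MulOpposite.op_one, one_mul, mul_one, one_mul, mul_one]
  | terminal r hr σ τ h htop =>
    simp only [coeff, left, right, idem, Algebra.TensorProduct.tmul_mul_tmul]
    rw [← MulOpposite.op_mul, ← MulOpposite.op_mul, PathClass.id_mul_toAlg,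
      PathClass.toAlg_mul_id, one_mul, mul_one]

end Facet

theorem idem_mul_idem (a b : V) : idem k S a b * idem k S a b = idem k S a b := by
  simp only [idem, Algebra.TensorProduct.tmul_mul_tmul]
  rw [← MulOpposite.op_mul, PathClass.toAlg_mul_id, PathClass.toAlg_mul_id]

variable [∀ a b : V, Finite (a ⟶ b)]

/-! #### Ranks -/

/-- The number of cells that can be reached from `σ`. -/
def hasseRank (M : CellMatching k S) (σ : AnyCell k S) : ℕ :=
  (Finset.univ.filter fun τ => Relation.TransGen (HasseArrow M) σ τ).card

theorem IsAcyclicMatching.hasseRank_lt {M : CellMatching k S} (hM : IsAcyclicMatching M)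
    {σ τ : AnyCell k S} (h : HasseArrow M σ τ) : hasseRank M τ < hasseRank M σ := by
  classical
  refine Finset.card_lt_card (Finset.ssubset_iff_of_subset ?_ |>.2 ⟨τ, ?_, ?_⟩)
  · intro ρ hρ
    rw [Finset.mem_filter] at hρ ⊢
    exact ⟨hρ.1, Relation.TransGen.head h hρ.2⟩
  · rw [Finset.mem_filter]
    exact ⟨Finset.mem_univ _, Relation.TransGen.single h⟩
  · rw [Finset.mem_filter]
    exact fun h => hM.acyclic τ h.2

/-- A nonzero entry of `N ^ n` lowers `ρ` by at least `n`, which is impossible once `n` exceeds the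
maximum of `ρ`. -/
theorem matrix_pow_eq_zero {X R : Type*} [Fintype X] [DecidableEq X] [Ring R] (N : Matrix X X R)
    (ρ : X → ℕ) (hN : ∀ x y, N x y ≠ 0 → ρ y < ρ x) : ∃ n, N ^ n = 0 := by
  have key : ∀ n x y, (N ^ n) x y ≠ 0 → ρ y + n ≤ ρ x := by
    intro n
    induction n with
    | zero =>
      intro x y h
      by_cases hxy : x = y
      · rw [hxy, add_zero]
      · rw [pow_zero, Matrix.one_apply_ne hxy] at h
        exact (h rfl).elim
    | succ n ih =>
      intro x y h
      rw [pow_succ, Matrix.mul_apply] at h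
      obtain ⟨z, -, hz⟩ := Finset.exists_ne_zero_of_sum_ne_zero h
      have h1 := ih x z (left_ne_zero_of_mul hz)
      have h2 := hN z y (right_ne_zero_of_mul hz)
      omega
  refine ⟨Finset.univ.sup ρ + 1, ?_⟩
  ext x y
  by_contra h
  have h1 := key _ x y h
  have h2 : ρ x ≤ Finset.univ.sup ρ := Finset.le_sup (Finset.mem_univ x)
  omega

/-! #### Gradient paths -/

/-- A gradient path is either a single facet or begins with a downward and an upward step. -/
def gradientPathEquiv (M : CellMatching k S) (σ η : AnyCell k S) :
    GradientPath M σ η ≃ {_f : Facet σ η // ¬ M σ η} ⊕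
      Σ (τ : AnyCell k S) (σ' : AnyCell k S) (_ : {_f : Facet σ τ // ¬ M σ τ})
        (_ : {_g : Facet σ' τ // M σ' τ}), GradientPath M σ' η where
  toFun γ := match γ with
    | GradientPath.last f hf => Sum.inl ⟨f, hf⟩
    | GradientPath.step f hf g hg γ => Sum.inr ⟨_, _, ⟨f, hf⟩, ⟨g, hg⟩, γ⟩
  invFun x := match x with
    | Sum.inl f => GradientPath.last f.1 f.2
    | Sum.inr ⟨_, _, f, g, γ⟩ => GradientPath.step f.1 f.2 g.1 g.2 γ
  left_inv γ := by cases γ <;> rfl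
  right_inv x := by
    rcases x with f | ⟨_, _, f, g, γ⟩ <;> rfl

/-- The first downward and upward steps both lower `hasseRank`, and there are finitely many choices
for them. -/
theorem IsAcyclicMatching.finite_gradientPath {M : CellMatching k S} (hM : IsAcyclicMatching M)
    (σ η : AnyCell k S) : Finite (GradientPath M σ η) := by
  induction hn : hasseRank M σ using Nat.strong_induction_on generalizing σ with
  | _ n ih =>
    subst hn
    have : ∀ (τ σ' : AnyCell k S) (_ : {_f : Facet σ τ // ¬ M σ τ})
        (_ : {_g : Facet σ' τ // M σ' τ}), Finite (GradientPath M σ' η) := by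
      intro τ σ' f g
      have h1 : HasseArrow M σ τ := Or.inl ⟨⟨f.1⟩, f.2⟩
      have h2 : HasseArrow M τ σ' := Or.inr g.2
      exact ih _ ((hM.hasseRank_lt h2).trans (hM.hasseRank_lt h1)) σ' rfl
    have : ∀ (τ σ' : AnyCell k S), Finite (Σ (_ : {_f : Facet σ τ // ¬ M σ τ})
        (_ : {_g : Facet σ' τ // M σ' τ}), GradientPath M σ' η) := by
      intro τ σ'
      have := this τ σ'
      infer_instance
    exact Finite.of_equiv _ (gradientPathEquiv M σ η).symm

namespace GradientPath

variable {M : CellMatching k S}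

/-- The contribution of a gradient path to the Morse differential. -/
def weight {σ η : AnyCell k S} (γ : GradientPath M σ η) : Env k S :=
  γ.sign • (γ.left ⊗ₜ[k] MulOpposite.op γ.right)

theorem weight_last {σ τ : AnyCell k S} (f : Facet σ τ) (hf : ¬ M σ τ) :
    (last f hf).weight = f.sign • f.coeff := rfl

theorem weight_step {σ τ σ' η : AnyCell k S} (f : Facet σ τ) (hf : ¬ M σ τ) (g : Facet σ' τ)
    (hg : M σ' τ) (γ : GradientPath M σ' η) :
    (step f hf g hg γ).weight = (f.sign • f.coeff) * (-(g.sign • 1) * γ.weight) := by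
  simp only [weight, sign, left, right, Facet.coeff]
  simp only [neg_mul, smul_mul_assoc, one_mul, mul_neg, mul_smul_comm]
  rw [Algebra.TensorProduct.tmul_mul_tmul, ← MulOpposite.op_mul, smul_smul, smul_neg, smul_smul,
    neg_smul]
  congr 2
  ring

end GradientPath

/-! #### The matrices -/

section Matrices

variable (M : CellMatching k S)

/-- The part of the differential along unmatched facets. -/
def downMatrix : Matrix (AnyCell k S) (AnyCell k S) (Env k S) :=
  fun σ τ => if M σ τ then 0 else barMatrix k S σ τ

/-- The part of the differential along matched facets. -/
def matchedMatrix : Matrix (AnyCell k S) (AnyCell k S) (Env k S) :=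
  fun σ τ => if M σ τ then ∑ f : Facet σ τ, f.sign • 1 else 0

/-- The negative of the inverse of the matched part of the differential. -/
def upMatrix : Matrix (AnyCell k S) (AnyCell k S) (Env k S) :=
  fun τ σ => if M σ τ then -∑ f : Facet σ τ, f.sign • 1 else 0

variable (k S) in
/-- The diagonal matrix of the idempotents of the cells. -/
def idemMatrix : Matrix (AnyCell k S) (AnyCell k S) (Env k S) :=
  Matrix.diagonal fun σ => idem k S σ.1 σ.2.1

/-- The projection onto the critical cells. -/
def critMatrix : Matrix (AnyCell k S) (AnyCell k S) (Env k S) :=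
  Matrix.diagonal fun σ => if IsCritical M σ then idem k S σ.1 σ.2.1 else 0

variable (k S) in
/-- The projection onto the cells of dimension `n`. -/
def dimMatrix (n : ℕ) : Matrix (AnyCell k S) (AnyCell k S) (Env k S) :=
  Matrix.diagonal fun σ => if σ.2.2.dim = n then 1 else 0

/-- The matrix of the sums over gradient paths. -/
def pathMatrix : Matrix (AnyCell k S) (AnyCell k S) (Env k S) :=
  fun σ η => morseCoeff M σ η

/-- The matrix of the differential of the Morse complex. -/
def morseMatrix : Matrix (AnyCell k S) (AnyCell k S) (Env k S) :=
  fun σ η => if IsCritical M σ ∧ IsCritical M η then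
    morseCoeff M σ η * idem k S η.1 η.2.1 else 0

variable {M}

/-- Sorting the gradient paths by their first two steps gives a recursion. Its solution is the
geometric series of the perturbation lemma applied to `downMatrix`. -/
theorem IsAcyclicMatching.pathMatrix_eq (hM : IsAcyclicMatching M) :
    pathMatrix M = downMatrix M + downMatrix M * upMatrix M * pathMatrix M := by
  classical
  ext σ η
  have hfin := hM.finite_gradientPath
  have : ∀ σ η, Fintype (GradientPath M σ η) := fun σ η => Fintype.ofFinite _
  have hcoeff : ∀ σ η, morseCoeff M σ η = ∑ γ : GradientPath M σ η, γ.weight :=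
    fun σ η => finsum_eq_sum_of_fintype _
  simp only [pathMatrix, Matrix.add_apply, Matrix.mul_assoc, Matrix.mul_apply]
  rw [hcoeff, ← (gradientPathEquiv M σ η).symm.sum_comp, Fintype.sum_sum_type]
  congr 1
  · change ∑ f : {_f : Facet σ η // ¬ M σ η}, f.1.sign • f.1.coeff = _
    by_cases h : M σ η
    · have : IsEmpty {_f : Facet σ η // ¬ M σ η} := ⟨fun f => f.2 h⟩
      simp [downMatrix, h]
    · rw [downMatrix, if_neg h, barMatrix]
      exact Fintype.sum_equiv (Equiv.subtypeUnivEquiv fun _ => h) _ _ fun _ => rfl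
  · rw [Fintype.sum_sigma]
    refine Finset.sum_congr rfl fun τ _ => ?_
    rw [Fintype.sum_sigma, Finset.mul_sum]
    refine Finset.sum_congr rfl fun σ' _ => ?_
    rw [Fintype.sum_sigma]
    simp only [Fintype.sum_sigma]
    change ∑ f : {_f : Facet σ τ // ¬ M σ τ}, ∑ g : {_g : Facet σ' τ // M σ' τ},
      ∑ γ : GradientPath M σ' η, (GradientPath.step f.1 f.2 g.1 g.2 γ).weight = _
    simp only [GradientPath.weight_step]
    rw [hcoeff]
    simp only [← Finset.mul_sum, ← Finset.sum_mul]
    congr 1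
    · by_cases h : M σ τ
      · have : IsEmpty {_f : Facet σ τ // ¬ M σ τ} := ⟨fun f => f.2 h⟩
        simp [downMatrix, h]
      · rw [downMatrix, if_neg h, barMatrix]
        exact Fintype.sum_equiv (Equiv.subtypeUnivEquiv fun _ => h) _ _ fun _ => rfl
    · congr 1
      by_cases h : M σ' τ
      · rw [upMatrix, if_pos h, ← Finset.sum_neg_distrib]
        exact Fintype.sum_equiv (Equiv.subtypeUnivEquiv fun _ => h) _ _ fun _ => rfl
      · have : IsEmpty {_f : Facet σ' τ // M σ' τ} := ⟨fun f => h f.2⟩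
        simp [upMatrix, h]

theorem matchedMatrix_add_downMatrix (hv : IsVertical M) :
    matchedMatrix M + downMatrix M = barMatrix k S := by
  ext σ τ
  rw [Matrix.add_apply, matchedMatrix, downMatrix]
  by_cases h : M σ τ
  · rw [if_pos h, if_pos h, add_zero, barMatrix]
    obtain ⟨a, b, σ, τ, -, rfl, rfl⟩ := hv _ _ h
    simp only [Facet.coeff_vertical]
  · rw [if_neg h, if_neg h, zero_add]

theorem idemMatrix_mul_barMatrix :
    idemMatrix k S * barMatrix k S = barMatrix k S * idemMatrix k S := by
  ext σ τ
  rw [idemMatrix, Matrix.diagonal_mul, Matrix.mul_diagonal, barMatrix, Finset.mul_sum,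
    Finset.sum_mul]
  refine Finset.sum_congr rfl fun f _ => ?_
  rw [mul_smul_comm, smul_mul_assoc, f.idem_mul_coeff]

theorem idemMatrix_mul_downMatrix :
    idemMatrix k S * downMatrix M = downMatrix M * idemMatrix k S := by
  ext σ τ
  have := congrFun (congrFun (idemMatrix_mul_barMatrix (k := k) (S := S)) σ) τ
  rw [idemMatrix, Matrix.diagonal_mul, Matrix.mul_diagonal] at this ⊢
  rw [downMatrix]
  split_ifs
  · simp
  · exact this

theorem idemMatrix_mul_matchedMatrix (hv : IsVertical M) :
    idemMatrix k S * matchedMatrix M = matchedMatrix M * idemMatrix k S := by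
  have h1 := idemMatrix_mul_barMatrix (k := k) (S := S)
  rw [← matchedMatrix_add_downMatrix hv, mul_add, add_mul, idemMatrix_mul_downMatrix] at h1
  exact add_right_cancel h1

theorem idemMatrix_mul_upMatrix (hv : IsVertical M) :
    idemMatrix k S * upMatrix M = upMatrix M * idemMatrix k S := by
  ext σ τ
  rw [idemMatrix, Matrix.diagonal_mul, Matrix.mul_diagonal, upMatrix]
  split_ifs with h
  · obtain ⟨a, b, σ, τ, -, rfl, rfl⟩ := hv _ _ h
    rw [mul_neg, neg_mul, Finset.mul_sum, Finset.sum_mul]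
    simp only [mul_smul_comm, smul_mul_assoc, mul_one, one_mul]
  · simp

theorem idemMatrix_mul_idemMatrix : idemMatrix k S * idemMatrix k S = idemMatrix k S := by
  simp [idemMatrix, idem_mul_idem]

theorem sum_sign_mul_self [Nontrivial k] (hM : IsAcyclicMatching M) (hv : IsVertical M) {σ τ : AnyCell k S}
    (h : M σ τ) :
    (∑ f : Facet σ τ, f.sign • (1 : Env k S)) * ∑ f : Facet σ τ, f.sign • (1 : Env k S) = 1 := by
  obtain ⟨f⟩ := hM.facet _ _ h
  obtain ⟨a, b, σ, τ, -, rfl, rfl⟩ := hv _ _ h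
  rw [Fintype.sum_eq_single f fun g hg => (hg (Facet.eq_of_vertical g f)).elim,
    smul_mul_assoc, one_mul, smul_smul, f.sign_mul_self, one_smul]

theorem matchedMatrix_mul_upMatrix [Nontrivial k] (hM : IsAcyclicMatching M) (hv : IsVertical M) :
    matchedMatrix M * upMatrix M = -Matrix.diagonal fun σ => if ∃ τ, M σ τ then 1 else 0 := by
  ext σ σ'
  rw [Matrix.mul_apply, Matrix.neg_apply]
  by_cases h : ∃ τ, M σ τ
  · obtain ⟨τ, hτ⟩ := h
    rw [Finset.sum_eq_single τ]
    · by_cases hσ : σ = σ'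
      · subst hσ
        rw [Matrix.diagonal_apply_eq, if_pos ⟨τ, hτ⟩, matchedMatrix, upMatrix, if_pos hτ,
          if_pos hτ, mul_neg, sum_sign_mul_self hM hv hτ]
      · rw [Matrix.diagonal_apply_ne _ hσ, upMatrix,
          if_neg fun h => hσ (hM.up_unique _ _ _ hτ h), mul_zero, neg_zero]
    · intro τ' _ hτ'
      rw [matchedMatrix, if_neg fun h => hτ' (hM.down_unique _ _ _ h hτ), zero_mul]
    · simp
  · rw [Finset.sum_eq_zero]
    · by_cases hσ : σ = σ'
      · subst hσ
        rw [Matrix.diagonal_apply_eq, if_neg h, neg_zero]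
      · rw [Matrix.diagonal_apply_ne _ hσ, neg_zero]
    · intro τ _
      rw [matchedMatrix, if_neg fun hτ => h ⟨τ, hτ⟩, zero_mul]

theorem upMatrix_mul_matchedMatrix [Nontrivial k] (hM : IsAcyclicMatching M) (hv : IsVertical M) :
    upMatrix M * matchedMatrix M = -Matrix.diagonal fun σ => if ∃ τ, M τ σ then 1 else 0 := by
  ext σ σ'
  rw [Matrix.mul_apply, Matrix.neg_apply]
  by_cases h : ∃ τ, M τ σ
  · obtain ⟨τ, hτ⟩ := h
    rw [Finset.sum_eq_single τ]
    · by_cases hσ : σ = σ'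
      · subst hσ
        rw [Matrix.diagonal_apply_eq, if_pos ⟨τ, hτ⟩, matchedMatrix, upMatrix, if_pos hτ,
          if_pos hτ, neg_mul, sum_sign_mul_self hM hv hτ]
      · rw [Matrix.diagonal_apply_ne _ hσ, matchedMatrix,
          if_neg fun h => hσ (hM.down_unique _ _ _ hτ h), mul_zero, neg_zero]
    · intro τ' _ hτ'
      rw [upMatrix, if_neg fun h => hτ' (hM.up_unique _ _ _ h hτ), zero_mul]
    · simp
  · rw [Finset.sum_eq_zero]
    · by_cases hσ : σ = σ'
      · subst hσ
        rw [Matrix.diagonal_apply_eq, if_neg h, neg_zero]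
      · rw [Matrix.diagonal_apply_ne _ hσ, neg_zero]
    · intro τ _
      rw [upMatrix, if_neg fun hτ => h ⟨τ, hτ⟩, zero_mul]

/-- Each cell is exactly one of critical, upper member of a pair, or lower member of a pair. The two
products are minus the projections onto the upper and the lower members. -/
theorem critMatrix_eq [Nontrivial k] (hM : IsAcyclicMatching M) (hv : IsVertical M) :
    critMatrix M = idemMatrix k S +
      idemMatrix k S * (matchedMatrix M * upMatrix M + upMatrix M * matchedMatrix M) := by
  rw [matchedMatrix_mul_upMatrix hM hv, upMatrix_mul_matchedMatrix hM hv, mul_add, mul_neg,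
    mul_neg, critMatrix, idemMatrix, Matrix.diagonal_mul_diagonal, Matrix.diagonal_mul_diagonal]
  ext σ τ
  by_cases hστ : σ = τ
  swap
  · simp [hστ]
  subst hστ
  simp only [Matrix.add_apply, Matrix.neg_apply, Matrix.diagonal_apply_eq]
  by_cases h1 : ∃ τ, M σ τ
  · have h2 : ¬ ∃ τ, M τ σ := by
      rintro ⟨ρ, hρ⟩
      obtain ⟨τ, hτ⟩ := h1
      exact hM.not_both _ _ _ hρ hτ
    rw [if_neg fun h => (h h1.choose).1 h1.choose_spec, if_pos h1, if_neg h2]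
    simp
  · by_cases h2 : ∃ τ, M τ σ
    · rw [if_neg fun h => (h h2.choose).2 h2.choose_spec, if_neg h1, if_pos h2]
      simp
    · have hc : IsCritical M σ := fun τ => ⟨fun h => h1 ⟨τ, h⟩, fun h => h2 ⟨τ, h⟩⟩
      rw [if_pos hc, if_neg h1, if_neg h2]
      simp

theorem critMatrix_mul_apply (N : Matrix (AnyCell k S) (AnyCell k S) (Env k S))
    (σ τ : AnyCell k S) : (critMatrix M * N) σ τ =
      if IsCritical M σ then idem k S σ.1 σ.2.1 * N σ τ else 0 := by
  rw [critMatrix, Matrix.diagonal_mul]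
  split_ifs <;> simp

theorem mul_critMatrix_apply (N : Matrix (AnyCell k S) (AnyCell k S) (Env k S))
    (σ τ : AnyCell k S) : (N * critMatrix M) σ τ =
      if IsCritical M τ then N σ τ * idem k S τ.1 τ.2.1 else 0 := by
  rw [critMatrix, Matrix.mul_diagonal]
  split_ifs <;> simp

theorem critMatrix_mul_idemMatrix : critMatrix M * idemMatrix k S = critMatrix M := by
  rw [idemMatrix, critMatrix, Matrix.diagonal_mul_diagonal]
  congr 1
  ext σ
  split_ifs <;> simp [idem_mul_idem]

/-- The row of `σ` is read off from `barDiff_barDiff` for the generator of the summand of `σ`. That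
generator is the idempotent of `σ`, which accounts for the factor on the left. -/
theorem barMatrix_mul_barMatrix [Nontrivial k] (hA : IsHPA k S) :
    idemMatrix k S * (barMatrix k S * barMatrix k S) = 0 := by
  classical
  ext σ τ
  have h1 : (barMatrix k S).map (changeRight (AlgHom.id k (QuiverAlgebra k S)ᵐᵒᵖ)) =
      barMatrix k S := by
    have : changeRight (AlgHom.id k (QuiverAlgebra k S)ᵐᵒᵖ) = AlgHom.id k (Env k S) :=
      Algebra.TensorProduct.map_id
    rw [this]
    rfl
  have h2 := barDiff_barDiff (AlgHom.id k (QuiverAlgebra k S)ᵐᵒᵖ) hA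
    (single_mem_barSubmodule _ (PathClass.id σ.1) σ.2.2
      (MulOpposite.op (PathClass.id σ.2.1).toAlg)
      (by rw [AlgHom.id_apply, ← MulOpposite.op_mul, PathClass.toAlg_mul_id]))
  rw [barDiff_apply, barDiff_apply, h1, Matrix.vecMul_vecMul, Matrix.single_vecMul] at h2
  have h3 := congrFun h2 τ
  rw [idemMatrix, Matrix.diagonal_mul]
  exact h3

theorem mul_matrix_eq_zero {N N' : Matrix (AnyCell k S) (AnyCell k S) (Env k S)}
    (h : ∀ σ τ ρ, N σ τ ≠ 0 → N' τ ρ ≠ 0 → False) : N * N' = 0 := by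
  ext σ ρ
  rw [Matrix.mul_apply]
  refine Finset.sum_eq_zero fun τ _ => ?_
  by_contra h0
  exact h σ τ ρ (left_ne_zero_of_mul h0) (right_ne_zero_of_mul h0)

theorem matchedMatrix_ne_zero {σ τ : AnyCell k S} (h : matchedMatrix M σ τ ≠ 0) : M σ τ := by
  by_contra h0
  exact h (if_neg h0)

theorem upMatrix_ne_zero {σ τ : AnyCell k S} (h : upMatrix M σ τ ≠ 0) : M τ σ := by
  by_contra h0
  exact h (if_neg h0)

theorem critMatrix_ne_zero {σ τ : AnyCell k S} (h : critMatrix M σ τ ≠ 0) :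
    σ = τ ∧ IsCritical M σ := by
  by_cases h1 : σ = τ
  · subst h1
    refine ⟨rfl, ?_⟩
    by_contra h0
    rw [critMatrix, Matrix.diagonal_apply_eq, if_neg h0] at h
    exact h rfl
  · rw [critMatrix, Matrix.diagonal_apply_ne _ h1] at h
    exact (h rfl).elim

theorem downMatrix_ne_zero {σ τ : AnyCell k S} (h : downMatrix M σ τ ≠ 0) :
    Nonempty (Facet σ τ) ∧ ¬ M σ τ := by
  have h1 : ¬ M σ τ := fun h1 => h (if_pos h1)
  refine ⟨?_, h1⟩
  by_contra h0
  rw [not_nonempty_iff] at h0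
  rw [downMatrix, if_neg h1, barMatrix, Finset.univ_eq_empty, Finset.sum_empty] at h
  exact h rfl

theorem idemMatrix_mul_ne_zero {N : Matrix (AnyCell k S) (AnyCell k S) (Env k S)}
    {σ τ : AnyCell k S} (h : (idemMatrix k S * N) σ τ ≠ 0) : N σ τ ≠ 0 := by
  rw [idemMatrix, Matrix.diagonal_mul] at h
  exact right_ne_zero_of_mul h

/-- Multiplying by `idemMatrix` cuts the free modules on the cells down to the summands `A e ⊗ e A`.
It commutes with all the matrices involved, so the identities hold in the corner it defines.
Nilpotency holds because a downward step followed by an upward step lowers `hasseRank`. -/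
theorem perturbation [Nontrivial k] (hA : IsHPA k S) (hM : IsAcyclicMatching M)
    (hv : IsVertical M) :
    Perturbation (idemMatrix k S) (critMatrix M) (idemMatrix k S * matchedMatrix M)
      (idemMatrix k S * upMatrix M) (idemMatrix k S * downMatrix M) where
  e_mul_e := by
    rw [critMatrix, Matrix.diagonal_mul_diagonal]
    congr 1
    ext σ
    split_ifs <;> simp [idem_mul_idem]
  m_mul_m := mul_matrix_eq_zero fun σ τ ρ h1 h2 => hM.not_both _ _ _
    (matchedMatrix_ne_zero (idemMatrix_mul_ne_zero h1))
    (matchedMatrix_ne_zero (idemMatrix_mul_ne_zero h2))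
  V_mul_V := mul_matrix_eq_zero fun σ τ ρ h1 h2 => hM.not_both _ _ _
    (upMatrix_ne_zero (idemMatrix_mul_ne_zero h2))
    (upMatrix_ne_zero (idemMatrix_mul_ne_zero h1))
  e_mul_V := mul_matrix_eq_zero fun σ τ ρ h1 h2 => by
    obtain ⟨rfl, hc⟩ := critMatrix_ne_zero h1
    exact (hc _).2 (upMatrix_ne_zero (idemMatrix_mul_ne_zero h2))
  V_mul_e := mul_matrix_eq_zero fun σ τ ρ h1 h2 => by
    obtain ⟨rfl, hc⟩ := critMatrix_ne_zero h2
    exact (hc _).1 (upMatrix_ne_zero (idemMatrix_mul_ne_zero h1))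
  e_mul_m := mul_matrix_eq_zero fun σ τ ρ h1 h2 => by
    obtain ⟨rfl, hc⟩ := critMatrix_ne_zero h1
    exact (hc _).1 (matchedMatrix_ne_zero (idemMatrix_mul_ne_zero h2))
  m_mul_e := mul_matrix_eq_zero fun σ τ ρ h1 h2 => by
    obtain ⟨rfl, hc⟩ := critMatrix_ne_zero h2
    exact (hc _).2 (matchedMatrix_ne_zero (idemMatrix_mul_ne_zero h1))
  E_mul_D := by rw [← mul_assoc, idemMatrix_mul_idemMatrix]
  D_mul_E := by rw [mul_assoc, ← idemMatrix_mul_downMatrix, ← mul_assoc, idemMatrix_mul_idemMatrix]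
  homotopy_left := by
    have h1 := critMatrix_eq hM hv
    have h2 : ∀ N N' : Matrix (AnyCell k S) (AnyCell k S) (Env k S),
        idemMatrix k S * N = N * idemMatrix k S →
        idemMatrix k S * N * (idemMatrix k S * N') = idemMatrix k S * (N * N') := by
      intro N N' h
      rw [mul_assoc, ← mul_assoc N, ← h, mul_assoc, ← mul_assoc, idemMatrix_mul_idemMatrix]
    rw [h2 _ _ (idemMatrix_mul_matchedMatrix hv), h2 _ _ (idemMatrix_mul_upMatrix hv), h1,
      mul_add]
    abel
  sq_zero := by
    rw [← mul_add, matchedMatrix_add_downMatrix hv, mul_assoc, ← mul_assoc (barMatrix k S),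
      ← idemMatrix_mul_barMatrix, mul_assoc, ← mul_assoc, idemMatrix_mul_idemMatrix,
      barMatrix_mul_barMatrix hA]
  nilpotent := by
    refine matrix_pow_eq_zero _ (hasseRank M) fun σ τ h => ?_
    rw [Matrix.mul_apply] at h
    obtain ⟨ρ, -, hρ⟩ := Finset.exists_ne_zero_of_sum_ne_zero h
    have h1 := downMatrix_ne_zero (idemMatrix_mul_ne_zero (left_ne_zero_of_mul hρ))
    have h2 := upMatrix_ne_zero (idemMatrix_mul_ne_zero (right_ne_zero_of_mul hρ))
    exact (hM.hasseRank_lt (Or.inr h2)).trans (hM.hasseRank_lt (Or.inl h1))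

theorem dimMatrix_mul_apply (n : ℕ) (N : Matrix (AnyCell k S) (AnyCell k S) (Env k S))
    (σ τ : AnyCell k S) : (dimMatrix k S n * N) σ τ = if σ.2.2.dim = n then N σ τ else 0 := by
  rw [dimMatrix, Matrix.diagonal_mul]
  split_ifs <;> simp

theorem mul_dimMatrix_apply (n : ℕ) (N : Matrix (AnyCell k S) (AnyCell k S) (Env k S))
    (σ τ : AnyCell k S) : (N * dimMatrix k S n) σ τ = if τ.2.2.dim = n then N σ τ else 0 := by
  rw [dimMatrix, Matrix.mul_diagonal]
  split_ifs <;> simp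

theorem dimMatrix_mul_comm {n n' : ℕ} {N : Matrix (AnyCell k S) (AnyCell k S) (Env k S)}
    (h : ∀ σ τ, N σ τ ≠ 0 → (σ.2.2.dim = n ↔ τ.2.2.dim = n')) :
    dimMatrix k S n * N = N * dimMatrix k S n' := by
  ext σ τ
  rw [dimMatrix_mul_apply, mul_dimMatrix_apply]
  by_cases h0 : N σ τ = 0
  · rw [h0, ite_self, ite_self]
  · simp only [h σ τ h0]

/-- The transfer maps between the bar complex and the Morse complex. -/
theorem exists_morse_transfer [Nontrivial k] (hA : IsHPA k S) (hM : IsAcyclicMatching M)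
    (hv : IsVertical M) : ∃ T U : Matrix (AnyCell k S) (AnyCell k S) (Env k S),
      critMatrix M * T * (idemMatrix k S * barMatrix k S) = morseMatrix M * T ∧
      idemMatrix k S * barMatrix k S * U = U * morseMatrix M ∧
      critMatrix M * T * U = critMatrix M ∧ U * critMatrix M = U ∧
      (∀ n, dimMatrix k S n * T = T * dimMatrix k S n) ∧
      dimMatrix k S 0 * T = dimMatrix k S 0 ∧
      (∀ n, dimMatrix k S (n + 1) * morseMatrix M = morseMatrix M * dimMatrix k S n) ∧
      idemMatrix k S * T = T * idemMatrix k S ∧ morseMatrix M * morseMatrix M = 0 := by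
  have hP := perturbation hA hM hv
  obtain ⟨T, U, hT1, hT2, -, h1, h2, h3⟩ := hP.exists_transfer
  -- As `T` inverts `1 - D V`, a fixed-point equation `N = N' + D V N` forces `N = T N'`. This
  -- principle gives the commutation of `T` with the dimension and idempotent projections, and the
  -- formula for the gradient path sums.
  have hT : ∀ N N' : Matrix (AnyCell k S) (AnyCell k S) (Env k S),
      N = N' + (idemMatrix k S * downMatrix M) * (idemMatrix k S * upMatrix M) * N →
      N = T * N' := by
    intro N N' h
    set Y := (idemMatrix k S * downMatrix M) * (idemMatrix k S * upMatrix M)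
    have e1 : N' = N - Y * N := eq_sub_of_add_eq h.symm
    have e2 : T * Y = T - 1 := eq_sub_of_add_eq' hT2.symm
    rw [e1, mul_sub, ← mul_assoc, e2, sub_mul, one_mul, sub_sub_cancel]
  have hdown : ∀ σ τ, (idemMatrix k S * downMatrix M) σ τ ≠ 0 → σ.2.2.dim = τ.2.2.dim + 1 := by
    intro σ τ h
    obtain ⟨⟨f⟩, -⟩ := downMatrix_ne_zero (idemMatrix_mul_ne_zero h)
    exact f.dim_eq hA
  have hup : ∀ σ τ, (idemMatrix k S * upMatrix M) σ τ ≠ 0 → τ.2.2.dim = σ.2.2.dim + 1 := by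
    intro σ τ h
    obtain ⟨f⟩ := hM.facet _ _ (upMatrix_ne_zero (idemMatrix_mul_ne_zero h))
    exact f.dim_eq hA
  have hPD : ∀ n, dimMatrix k S (n + 1) * (idemMatrix k S * downMatrix M) =
      idemMatrix k S * downMatrix M * dimMatrix k S n := fun n =>
    dimMatrix_mul_comm fun σ τ h => by rw [hdown σ τ h]; omega
  -- A 0-cell has no facets, so `D` vanishes on the rows of dimension zero and `T` is the identity
  -- there. Hence `T` does not disturb the augmentation.
  have hPD0 : dimMatrix k S 0 * (idemMatrix k S * downMatrix M) = 0 := by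
    ext σ τ
    rw [dimMatrix_mul_apply]
    by_contra h
    rw [Matrix.zero_apply, ite_eq_right_iff] at h
    push Not at h
    have := hdown σ τ h.2
    omega
  have hPV : ∀ n, dimMatrix k S n * (idemMatrix k S * upMatrix M) =
      idemMatrix k S * upMatrix M * dimMatrix k S (n + 1) := fun n =>
    dimMatrix_mul_comm fun σ τ h => by rw [hup σ τ h]; omega
  have hPDV : ∀ n, dimMatrix k S n * (idemMatrix k S * downMatrix M *
      (idemMatrix k S * upMatrix M)) = idemMatrix k S * downMatrix M *
      (idemMatrix k S * upMatrix M) * dimMatrix k S n := by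
    rintro (_ | n)
    · rw [← mul_assoc, hPD0, zero_mul]
      ext σ τ
      rw [mul_dimMatrix_apply, eq_comm]
      by_contra h
      rw [Matrix.zero_apply, ite_eq_right_iff] at h
      push Not at h
      obtain ⟨ρ, -, hρ⟩ := Finset.exists_ne_zero_of_sum_ne_zero h.2
      have := hup _ _ (right_ne_zero_of_mul hρ)
      omega
    · rw [← mul_assoc, hPD, mul_assoc, hPV, mul_assoc, mul_assoc, mul_assoc]
      simp only [mul_assoc]
  have hPT : ∀ n, dimMatrix k S n * T = T * dimMatrix k S n := by
    intro n
    refine hT _ _ ?_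
    conv_lhs => rw [hT1]
    rw [mul_add, mul_one, ← mul_assoc, hPDV, mul_assoc]
  -- The recursion for gradient paths is the fixed-point equation solved by `T D`. So the reduced
  -- differential `e T D e` is given by the sums over gradient paths.
  have hG : idemMatrix k S * pathMatrix M = T * (idemMatrix k S * downMatrix M) := by
    refine hT _ _ ?_
    conv_lhs => rw [hM.pathMatrix_eq]
    have e1 := idemMatrix_mul_downMatrix (M := M)
    have e2 := idemMatrix_mul_upMatrix hv
    have e3 := idemMatrix_mul_idemMatrix (k := k) (S := S)
    set E := idemMatrix k S
    set D := downMatrix M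
    set W := upMatrix M
    set G := pathMatrix M
    rw [mul_add]
    congr 1
    calc E * (D * W * G) = E * D * W * G := by simp only [mul_assoc]
      _ = E * E * E * D * W * G := by rw [e3, e3]
      _ = E * (E * (E * D)) * W * G := by simp only [mul_assoc]
      _ = E * (E * (D * E)) * W * G := by rw [e1]
      _ = E * ((E * D) * (E * W)) * G := by simp only [mul_assoc]
      _ = E * ((D * E) * (W * E)) * G := by rw [e1, e2]
      _ = E * (D * (E * W)) * (E * G) := by simp only [mul_assoc]
      _ = E * D * (E * W) * (E * G) := by simp only [mul_assoc]
  have hcT : critMatrix M * (T * (idemMatrix k S * downMatrix M)) * critMatrix M =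
      morseMatrix M := by
    rw [← hG, ← mul_assoc, critMatrix_mul_idemMatrix]
    ext σ η
    have hEG : idem k S σ.1 σ.2.1 * pathMatrix M σ η * idem k S η.1 η.2.1 =
        pathMatrix M σ η * idem k S η.1 η.2.1 := by
      have : ∀ {σ η : AnyCell k S} (γ : GradientPath M σ η),
          idem k S σ.1 σ.2.1 * γ.weight = γ.weight * idem k S η.1 η.2.1 := by
        intro σ η γ
        induction γ with
        | last f hf =>
          rw [GradientPath.weight_last, mul_smul_comm, smul_mul_assoc, f.idem_mul_coeff]
        | step f hf g hg γ ih =>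
          obtain ⟨a, b, σ', τ', -, rfl, rfl⟩ := hv _ _ hg
          rw [GradientPath.weight_step]
          simp only [neg_mul, smul_mul_assoc, one_mul, mul_neg, mul_smul_comm]
          rw [← mul_assoc, f.idem_mul_coeff, mul_assoc, mul_assoc, ← ih]
      have hfin := hM.finite_gradientPath σ η
      rw [pathMatrix, morseCoeff, finsum_mul' _ _ (Set.toFinite _), mul_finsum' _ _ (Set.toFinite _),
        finsum_mul' _ _ (Set.toFinite _)]
      refine finsum_congr fun γ => ?_
      change idem k S σ.1 σ.2.1 * γ.weight * idem k S η.1 η.2.1 =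
        γ.weight * idem k S η.1 η.2.1
      rw [this, mul_assoc, idem_mul_idem]
    rw [mul_critMatrix_apply, critMatrix_mul_apply, morseMatrix]
    by_cases h1 : IsCritical M σ <;> by_cases h2 : IsCritical M η
    · rw [if_pos h1, if_pos h2, if_pos ⟨h1, h2⟩, hEG]
      rfl
    · rw [if_neg h2, if_neg (not_and_of_not_right _ h2)]
    · rw [if_neg h1, if_neg (not_and_of_not_left _ h1), zero_mul, ite_self]
    · rw [if_neg h2, if_neg (not_and_of_not_right _ h2)]
  have hbar : idemMatrix k S * matchedMatrix M + idemMatrix k S * downMatrix M =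
      idemMatrix k S * barMatrix k S := by
    rw [← mul_add, matchedMatrix_add_downMatrix hv]
  have hPe : ∀ n, dimMatrix k S n * critMatrix M = critMatrix M * dimMatrix k S n := fun n =>
    dimMatrix_mul_comm fun σ τ h => by rw [(critMatrix_ne_zero h).1]
  rw [hcT, hbar] at h1 h2
  refine ⟨T, U * critMatrix M, h1, h2, h3, ?_, hPT, ?_, ?_, ?_, ?_⟩
  · rw [mul_assoc, hP.e_mul_e]
  · rw [hT1, mul_add, mul_one, ← mul_assoc, ← mul_assoc, hPD0, zero_mul, zero_mul, add_zero]
  · intro n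
    rw [← hcT]
    have e1 := hPD n
    have e2 := hPe (n + 1)
    have e3 := hPT (n + 1)
    set X := idemMatrix k S * downMatrix M
    set P := dimMatrix k S (n + 1)
    calc P * (critMatrix M * (T * X) * critMatrix M)
        = (P * critMatrix M) * (T * X) * critMatrix M := by simp only [mul_assoc]
      _ = critMatrix M * (P * T) * X * critMatrix M := by rw [e2]; simp only [mul_assoc]
      _ = critMatrix M * T * (P * X) * critMatrix M := by rw [e3]; simp only [mul_assoc]
      _ = critMatrix M * T * X * (dimMatrix k S n * critMatrix M) := by
        rw [e1]; simp only [mul_assoc]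
      _ = _ := by rw [hPe]; simp only [mul_assoc]
  · refine hT _ _ ?_
    have e1 : idemMatrix k S * upMatrix M * idemMatrix k S = idemMatrix k S * upMatrix M := by
      rw [mul_assoc, ← idemMatrix_mul_upMatrix hv, ← mul_assoc, idemMatrix_mul_idemMatrix]
    conv_lhs => rw [hT1]
    rw [mul_add, mul_one, ← mul_assoc, ← mul_assoc, hP.E_mul_D]
    congr 1
    conv_lhs => rw [← e1]
    simp only [mul_assoc]
  · have e1 : critMatrix M * morseMatrix M = morseMatrix M := by
      rw [← hcT, ← mul_assoc, ← mul_assoc, hP.e_mul_e]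
    have e2 : morseMatrix M * critMatrix M = morseMatrix M := by
      rw [← hcT, mul_assoc _ (critMatrix M) (critMatrix M), hP.e_mul_e]
    have e3 := hP.sq_zero
    rw [hbar] at e3
    set b := idemMatrix k S * barMatrix k S
    -- Insert `e = e T U` between the two factors and move both differentials into the bar complex,
    -- where the square is zero.
    calc morseMatrix M * morseMatrix M
        = morseMatrix M * (critMatrix M * morseMatrix M) := by rw [e1]
      _ = morseMatrix M * (critMatrix M * T * (U * critMatrix M)) * morseMatrix M := by
        rw [h3, mul_assoc]
      _ = morseMatrix M * critMatrix M * T * (U * critMatrix M * morseMatrix M) := by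
        simp only [mul_assoc]
      _ = morseMatrix M * T * (b * (U * critMatrix M)) := by rw [e2, h2]
      _ = (morseMatrix M * T) * b * (U * critMatrix M) := by simp only [mul_assoc]
      _ = critMatrix M * T * (b * b) * (U * critMatrix M) := by
        rw [← h1]; simp only [mul_assoc]
      _ = 0 := by rw [e3]; simp

end Matrices

end Morse

/-! ### Exactness of the Morse complex as a retract of the bar complex -/

section MorseExact

open scoped Classical

variable {k : Type w} {V : Type u} [Quiver.{v} V] [CommRing k] [Fintype V] {S : PathRelations V}
  [AcyclicQuiver V] [∀ a b : V, Finite (a ⟶ b)]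

section Bar

variable {B : Type*} [Ring B] [Algebra k B] (ψ : (QuiverAlgebra k S)ᵐᵒᵖ →ₐ[k] B)

theorem single_mul_idem_mem (σ : AnyCell k S) (y : QuiverAlgebra k S ⊗[k] B) :
    Pi.single σ (y * changeRight ψ (idem k S σ.1 σ.2.1)) ∈ barSubmodule ψ σ.2.2.dim := by
  induction y using TensorProduct.induction_on with
  | zero => rw [zero_mul, Pi.single_zero]; exact zero_mem _
  | add x y hx hy => rw [add_mul, Pi.single_add]; exact add_mem hx hy
  | tmul x y =>
    rw [idem, changeRight_tmul, Algebra.TensorProduct.tmul_mul_tmul]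
    induction x using quiverAlgebra_induction with
    | zero => rw [zero_mul, TensorProduct.zero_tmul, Pi.single_zero]; exact zero_mem _
    | add x x' hx hx' =>
      rw [add_mul, TensorProduct.add_tmul, Pi.single_add]
      exact add_mem hx hx'
    | @smul r a b l =>
      rw [smul_mul_assoc, ← TensorProduct.smul_tmul', Pi.single_smul]
      refine Submodule.smul_mem _ _ ?_
      by_cases h : b = σ.1
      · subst h
        rw [PathClass.toAlg_mul_id]
        refine single_mem_barSubmodule ψ l σ.2.2 _ ?_
        rw [mul_assoc, ← map_mul, ← MulOpposite.op_mul, PathClass.toAlg_mul_id]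
      · rw [PathClass.toAlg_mul_of_ne _ _ h, TensorProduct.zero_tmul, Pi.single_zero]
        exact zero_mem _

theorem mem_barSubmodule {n : ℕ} {v : AnyCell k S → QuiverAlgebra k S ⊗[k] B}
    (h1 : ∀ σ, v σ * changeRight ψ (idem k S σ.1 σ.2.1) = v σ)
    (h2 : ∀ σ, σ.2.2.dim ≠ n → v σ = 0) : v ∈ barSubmodule ψ n := by
  rw [← Finset.univ_sum_single v]
  refine Submodule.sum_mem _ fun σ _ => ?_
  by_cases h : σ.2.2.dim = n
  · subst h
    rw [← h1]
    exact single_mul_idem_mem ψ σ _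
  · rw [h2 σ h, Pi.single_zero]
    exact zero_mem _

end Bar

section BarLift

variable [Nontrivial k] (hA : IsHPA k S) {B : Type*} [Ring B] [Algebra k B]
  (ψ : (QuiverAlgebra k S)ᵐᵒᵖ →ₐ[k] B) {R : Type*} [Ring R] [Algebra k R]
  (Θ : QuiverAlgebra k S ⊗[k] B ≃ₐ[k] R)

theorem vecMul_map_algEquiv (x : AnyCell k S → R)
    (N : Matrix (AnyCell k S) (AnyCell k S) (Env k S)) (σ : AnyCell k S) :
    Θ.symm (Matrix.vecMul x (N.map fun z => Θ (changeRight ψ z)) σ) =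
      Matrix.vecMul (fun σ => Θ.symm (x σ)) (N.map (changeRight ψ)) σ := by
  simp only [Matrix.vecMul, dotProduct, Matrix.map_apply, map_sum, map_mul, AlgEquiv.symm_apply_apply]

/-- The idempotents commute with the bar differential and fix `y`. Cutting any lift down by them
therefore gives another lift, which now has its components in the required corners. -/
theorem exists_fixed_lift {y : AnyCell k S → R} (u : AnyCell k S → QuiverAlgebra k S ⊗[k] B)
    (hy : ∀ σ, y σ * Θ (changeRight ψ (idem k S σ.1 σ.2.1)) = y σ)
    (hu : barDiff ψ u = fun σ => Θ.symm (y σ)) :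
    ∃ u : AnyCell k S → R, (∀ σ, u σ * Θ (changeRight ψ (idem k S σ.1 σ.2.1)) = u σ) ∧
      Matrix.vecMul u ((barMatrix k S).map fun z => Θ (changeRight ψ z)) = y := by
  refine ⟨fun σ => Θ (u σ * changeRight ψ (idem k S σ.1 σ.2.1)), fun σ => ?_, ?_⟩
  · rw [← map_mul, mul_assoc, ← map_mul, idem_mul_idem]
  · ext τ
    apply Θ.symm.injective
    rw [vecMul_map_algEquiv]
    simp only [AlgEquiv.symm_apply_apply]
    have h1 : (fun σ => u σ * changeRight ψ (idem k S σ.1 σ.2.1)) =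
        Matrix.vecMul u ((idemMatrix k S).map (changeRight ψ)) := by
      ext σ
      rw [idemMatrix, Matrix.diagonal_map (map_zero _), Matrix.vecMul_diagonal]
    rw [h1, Matrix.vecMul_vecMul, ← Matrix.map_mul, idemMatrix_mul_barMatrix, Matrix.map_mul,
      ← Matrix.vecMul_vecMul, ← barDiff_apply, hu, idemMatrix, Matrix.diagonal_map (map_zero _),
      Matrix.vecMul_diagonal]
    apply Θ.injective
    rw [map_mul, AlgEquiv.apply_symm_apply]
    exact hy τ

include hA

theorem bar_lift_succ {n : ℕ} {y : AnyCell k S → R}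
    (h1 : ∀ σ, y σ * Θ (changeRight ψ (idem k S σ.1 σ.2.1)) = y σ)
    (h2 : ∀ σ, σ.2.2.dim ≠ n + 1 → y σ = 0)
    (h3 : Matrix.vecMul y ((barMatrix k S).map fun z => Θ (changeRight ψ z)) = 0) :
    ∃ u : AnyCell k S → R, (∀ σ, u σ * Θ (changeRight ψ (idem k S σ.1 σ.2.1)) = u σ) ∧
      Matrix.vecMul u ((barMatrix k S).map fun z => Θ (changeRight ψ z)) = y := by
  have hv : (fun σ => Θ.symm (y σ)) ∈ barSubmodule ψ (n + 1) := by
    refine mem_barSubmodule ψ (fun σ => ?_) fun σ hσ => by rw [h2 σ hσ, map_zero]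
    apply Θ.injective
    rw [map_mul, AlgEquiv.apply_symm_apply]
    exact h1 σ
  obtain ⟨u, -, hu⟩ := bar_exact_succ ψ hA hv (by
    ext σ
    rw [barDiff_apply, ← vecMul_map_algEquiv, h3]
    exact map_zero _)
  exact exists_fixed_lift ψ Θ u h1 hu

theorem bar_lift_zero {y : AnyCell k S → R}
    (h1 : ∀ σ, y σ * Θ (changeRight ψ (idem k S σ.1 σ.2.1)) = y σ)
    (h2 : ∀ σ, σ.2.2.dim ≠ 0 → y σ = 0)
    (h3 : ∑ a : V, augTerm ψ (Θ.symm (y ⟨a, a, Cell.vertex a⟩)) = 0) :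
    ∃ u : AnyCell k S → R, (∀ σ, u σ * Θ (changeRight ψ (idem k S σ.1 σ.2.1)) = u σ) ∧
      Matrix.vecMul u ((barMatrix k S).map fun z => Θ (changeRight ψ z)) = y := by
  have hv : (fun σ => Θ.symm (y σ)) ∈ barSubmodule ψ 0 := by
    refine mem_barSubmodule ψ (fun σ => ?_) fun σ hσ => by rw [h2 σ hσ, map_zero]
    apply Θ.injective
    rw [map_mul, AlgEquiv.apply_symm_apply]
    exact h1 σ
  obtain ⟨u, -, hu⟩ := bar_exact_zero ψ hA hv (by rwa [barAug_apply])
  exact exists_fixed_lift ψ Θ u h1 hu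

end BarLift

variable [Nontrivial k] (hA : IsHPA k S) {M : CellMatching k S} (hM : IsAcyclicMatching M)
  (hv : IsVertical M)
include hA hM hv

section Transfer

variable {R : Type*} [Ring R] (Φ : Env k S →+* R)

/-- If `u` bounds `x T` in the bar complex, then `u U` bounds `x` in the Morse complex, since `u U δ
= u d U = x T U = x`. A projection onto dimension `n + 1` then discards superfluous components
without changing the boundary. -/
theorem morse_lift {n : ℕ} {x : AnyCell k S → R}
    (h1 : ∀ σ, x σ * Φ (idem k S σ.1 σ.2.1) = x σ)
    (h2 : ∀ σ, ¬ (IsCritical M σ ∧ σ.2.2.dim = n) → x σ = 0)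
    (T U : Matrix (AnyCell k S) (AnyCell k S) (Env k S))
    (hU1 : idemMatrix k S * barMatrix k S * U = U * morseMatrix M)
    (hU2 : critMatrix M * T * U = critMatrix M) (hU3 : U * critMatrix M = U)
    (hdim : dimMatrix k S (n + 1) * morseMatrix M = morseMatrix M * dimMatrix k S n)
    (u : AnyCell k S → R) (hu : ∀ σ, u σ * Φ (idem k S σ.1 σ.2.1) = u σ)
    (hux : Matrix.vecMul u ((barMatrix k S).map Φ) = Matrix.vecMul x (T.map Φ)) :
    ∃ w : AnyCell k S → R, (∀ σ, w σ * Φ (idem k S σ.1 σ.2.1) = w σ) ∧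
      (∀ σ, ¬ (IsCritical M σ ∧ σ.2.2.dim = n + 1) → w σ = 0) ∧
      Matrix.vecMul w ((morseMatrix M).map Φ) = x := by
  have hmap : ∀ N N' : Matrix (AnyCell k S) (AnyCell k S) (Env k S),
      (N * N').map Φ = N.map Φ * N'.map Φ := fun N N' => Matrix.map_mul
  have hx : Matrix.vecMul x ((critMatrix M).map Φ) = x := by
    ext σ
    rw [critMatrix, Matrix.diagonal_map (map_zero Φ), Matrix.vecMul_diagonal]
    split_ifs with h
    · exact h1 σ
    · rw [h2 σ fun h' => h h'.1, zero_mul]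
  have hxd : Matrix.vecMul x ((dimMatrix k S n).map Φ) = x := by
    ext σ
    rw [dimMatrix, Matrix.diagonal_map (map_zero Φ), Matrix.vecMul_diagonal]
    split_ifs with h
    · rw [map_one, mul_one]
    · rw [h2 σ fun h' => h h'.2, zero_mul]
  have huE : Matrix.vecMul u ((idemMatrix k S).map Φ) = u := by
    ext σ
    rw [idemMatrix, Matrix.diagonal_map (map_zero Φ), Matrix.vecMul_diagonal]
    exact hu σ
  let w₀ := Matrix.vecMul u (U.map Φ)
  have hw₀ : Matrix.vecMul w₀ ((morseMatrix M).map Φ) = x := by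
    rw [Matrix.vecMul_vecMul, ← hmap, ← hU1, hmap, ← Matrix.vecMul_vecMul, hmap,
      ← Matrix.vecMul_vecMul, huE, hux, Matrix.vecMul_vecMul, ← hmap]
    conv_lhs => rw [← hx]
    rw [Matrix.vecMul_vecMul, ← hmap, ← mul_assoc, hU2, hx]
  have hw₀c : Matrix.vecMul w₀ ((critMatrix M).map Φ) = w₀ := by
    rw [Matrix.vecMul_vecMul, ← hmap, hU3]
  refine ⟨Matrix.vecMul w₀ ((dimMatrix k S (n + 1)).map Φ), fun σ => ?_, fun σ hσ => ?_, ?_⟩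
  · rw [← hw₀c, critMatrix, dimMatrix, Matrix.diagonal_map (map_zero Φ),
      Matrix.diagonal_map (map_zero Φ), Matrix.vecMul_diagonal, Matrix.vecMul_diagonal]
    split_ifs
    · rw [map_one, mul_one, mul_assoc, ← map_mul, idem_mul_idem]
    · simp
    · simp
    · simp
  · rw [← hw₀c, critMatrix, dimMatrix, Matrix.diagonal_map (map_zero Φ),
      Matrix.diagonal_map (map_zero Φ), Matrix.vecMul_diagonal, Matrix.vecMul_diagonal]
    split_ifs with h3 h4
    · exact (hσ ⟨h3, h4⟩).elim
    all_goals simp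
  · rw [Matrix.vecMul_vecMul, ← hmap, hdim, hmap, ← Matrix.vecMul_vecMul, hw₀, hxd]

/-- The vector `x T` is the image of a Morse chain `x` under the transfer map into the bar complex.
It stays in the same degree and in the corners because `T` commutes with both projections. -/
theorem morse_push {n : ℕ} {x : AnyCell k S → R}
    (h1 : ∀ σ, x σ * Φ (idem k S σ.1 σ.2.1) = x σ)
    (h2 : ∀ σ, ¬ (IsCritical M σ ∧ σ.2.2.dim = n) → x σ = 0)
    (T : Matrix (AnyCell k S) (AnyCell k S) (Env k S))
    (hT : critMatrix M * T * (idemMatrix k S * barMatrix k S) = morseMatrix M * T)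
    (hTd : dimMatrix k S n * T = T * dimMatrix k S n)
    (hTE : idemMatrix k S * T = T * idemMatrix k S) :
    (∀ σ, Matrix.vecMul x (T.map Φ) σ * Φ (idem k S σ.1 σ.2.1) = Matrix.vecMul x (T.map Φ) σ) ∧
      (∀ σ, σ.2.2.dim ≠ n → Matrix.vecMul x (T.map Φ) σ = 0) ∧
      Matrix.vecMul (Matrix.vecMul x (T.map Φ)) ((barMatrix k S).map Φ) =
        Matrix.vecMul (Matrix.vecMul x ((morseMatrix M).map Φ)) (T.map Φ) := by
  have hmap : ∀ N N' : Matrix (AnyCell k S) (AnyCell k S) (Env k S),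
      (N * N').map Φ = N.map Φ * N'.map Φ := fun N N' => Matrix.map_mul
  have hx : Matrix.vecMul x ((critMatrix M).map Φ) = x := by
    ext σ
    rw [critMatrix, Matrix.diagonal_map (map_zero Φ), Matrix.vecMul_diagonal]
    split_ifs with h
    · exact h1 σ
    · rw [h2 σ fun h' => h h'.1, zero_mul]
  have hxE : ∀ y : AnyCell k S → R, Matrix.vecMul y ((idemMatrix k S).map Φ) =
      fun σ => y σ * Φ (idem k S σ.1 σ.2.1) := by
    intro y
    ext σ
    rw [idemMatrix, Matrix.diagonal_map (map_zero Φ), Matrix.vecMul_diagonal]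
  have hyd : ∀ (y : AnyCell k S → R) (n : ℕ), Matrix.vecMul y ((dimMatrix k S n).map Φ) =
      fun σ => if σ.2.2.dim = n then y σ else 0 := by
    intro y n
    ext σ
    rw [dimMatrix, Matrix.diagonal_map (map_zero Φ), Matrix.vecMul_diagonal]
    split_ifs with h
    · rw [map_one, mul_one]
    · rw [map_zero, mul_zero]
  have hxd : Matrix.vecMul x ((dimMatrix k S n).map Φ) = x := by
    rw [hyd]
    ext σ
    split_ifs with h
    · rfl
    · rw [h2 σ fun h' => h h'.2]
  have hxE' : Matrix.vecMul x ((idemMatrix k S).map Φ) = x := by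
    rw [hxE]
    exact funext h1
  let y := Matrix.vecMul x (T.map Φ)
  have hyE : ∀ σ, y σ * Φ (idem k S σ.1 σ.2.1) = y σ := by
    have : Matrix.vecMul y ((idemMatrix k S).map Φ) = y := by
      rw [Matrix.vecMul_vecMul, ← hmap, ← hTE, hmap, ← Matrix.vecMul_vecMul, hxE']
    rw [hxE] at this
    exact congrFun this
  have hyD : ∀ σ, σ.2.2.dim ≠ n → y σ = 0 := by
    have : Matrix.vecMul y ((dimMatrix k S n).map Φ) = y := by
      rw [Matrix.vecMul_vecMul, ← hmap, ← hTd, hmap, ← Matrix.vecMul_vecMul, hxd]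
    rw [hyd] at this
    intro σ hσ
    rw [← this]
    exact if_neg hσ
  have hybar : Matrix.vecMul y ((barMatrix k S).map Φ) =
      Matrix.vecMul (Matrix.vecMul x ((morseMatrix M).map Φ)) (T.map Φ) := by
    have : Matrix.vecMul (Matrix.vecMul y ((idemMatrix k S).map Φ)) ((barMatrix k S).map Φ) =
      Matrix.vecMul (Matrix.vecMul x ((morseMatrix M).map Φ)) (T.map Φ) := by
      rw [Matrix.vecMul_vecMul, ← hmap, Matrix.vecMul_vecMul, ← hmap]
      conv_lhs => rw [← hx]
      rw [Matrix.vecMul_vecMul, ← hmap, ← mul_assoc, hT, hmap, ← Matrix.vecMul_vecMul]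
    rwa [hxE, funext hyE] at this
  exact ⟨hyE, hyD, hybar⟩

end Transfer

variable {B : Type*} [Ring B] [Algebra k B] (ψ : (QuiverAlgebra k S)ᵐᵒᵖ →ₐ[k] B)
  {R : Type*} [Ring R] [Algebra k R] (Θ : QuiverAlgebra k S ⊗[k] B ≃ₐ[k] R)

/-- Exactness of the Morse complex in positive degrees, with coefficients changed. -/
theorem morse_exact_succ {n : ℕ} {x : AnyCell k S → R}
    (h1 : ∀ σ, x σ * Θ (changeRight ψ (idem k S σ.1 σ.2.1)) = x σ)
    (h2 : ∀ σ, ¬ (IsCritical M σ ∧ σ.2.2.dim = n + 1) → x σ = 0)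
    (h3 : Matrix.vecMul x ((morseMatrix M).map fun z => Θ (changeRight ψ z)) = 0) :
    ∃ w : AnyCell k S → R, (∀ σ, w σ * Θ (changeRight ψ (idem k S σ.1 σ.2.1)) = w σ) ∧
      (∀ σ, ¬ (IsCritical M σ ∧ σ.2.2.dim = n + 2) → w σ = 0) ∧
      Matrix.vecMul w ((morseMatrix M).map fun z => Θ (changeRight ψ z)) = x := by
  obtain ⟨T, U, hT, hU1, hU2, hU3, hTd, -, hdim, hTE, -⟩ := exists_morse_transfer hA hM hv
  let Φ : Env k S →+* R := (Θ.toAlgHom.comp (changeRight ψ)).toRingHom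
  obtain ⟨hyE, hyD, hybar⟩ := morse_push hA hM hv Φ h1 h2 T hT (hTd _) hTE
  have h3' : Matrix.vecMul x ((morseMatrix M).map Φ) = 0 := h3
  rw [h3', Matrix.zero_vecMul] at hybar
  obtain ⟨u, hu, huy⟩ := bar_lift_succ hA ψ Θ hyE hyD hybar
  exact morse_lift hA hM hv Φ (n := n + 1) h1 h2 T U hU1 hU2 hU3 (hdim _) u hu huy

/-- Exactness of the augmented Morse complex in degree zero, with coefficients changed. -/
theorem morse_exact_zero {x : AnyCell k S → R}
    (h1 : ∀ σ, x σ * Θ (changeRight ψ (idem k S σ.1 σ.2.1)) = x σ)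
    (h2 : ∀ σ, ¬ (IsCritical M σ ∧ σ.2.2.dim = 0) → x σ = 0)
    (h3 : ∑ a : V, augTerm ψ (Θ.symm (x ⟨a, a, Cell.vertex a⟩)) = 0) :
    ∃ w : AnyCell k S → R, (∀ σ, w σ * Θ (changeRight ψ (idem k S σ.1 σ.2.1)) = w σ) ∧
      (∀ σ, ¬ (IsCritical M σ ∧ σ.2.2.dim = 1) → w σ = 0) ∧
      Matrix.vecMul w ((morseMatrix M).map fun z => Θ (changeRight ψ z)) = x := by
  obtain ⟨T, U, hT, hU1, hU2, hU3, hTd, hT0, hdim, hTE, -⟩ := exists_morse_transfer hA hM hv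
  let Φ : Env k S →+* R := (Θ.toAlgHom.comp (changeRight ψ)).toRingHom
  have hmap : ∀ N N' : Matrix (AnyCell k S) (AnyCell k S) (Env k S),
      (N * N').map Φ = N.map Φ * N'.map Φ := fun N N' => Matrix.map_mul
  have hxd : Matrix.vecMul x ((dimMatrix k S 0).map Φ) = x := by
    ext σ
    rw [dimMatrix, Matrix.diagonal_map (map_zero Φ), Matrix.vecMul_diagonal]
    split_ifs with h
    · rw [map_one, mul_one]
    · rw [h2 σ fun h' => h h'.2, zero_mul]
  -- In degree zero `T` is the identity, so `x` itself is the bar chain that has to be lifted.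
  have hxT : Matrix.vecMul x (T.map Φ) = x := by
    conv_lhs => rw [← hxd]
    rw [Matrix.vecMul_vecMul, ← hmap, hT0, hxd]
  obtain ⟨u, hu, huy⟩ := bar_lift_zero hA ψ Θ h1 (fun σ hσ => h2 σ fun h => hσ h.2) h3
  exact morse_lift hA hM hv Φ (n := 0) h1 h2 T U hU1 hU2 hU3 (hdim _) u hu
    (huy.trans hxT.symm)

/-- The augmented Morse complex is a complex in degree zero. -/
theorem morse_aug_eq_zero {x : AnyCell k S → R}
    (h1 : ∀ σ, x σ * Θ (changeRight ψ (idem k S σ.1 σ.2.1)) = x σ)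
    (h2 : ∀ σ, ¬ (IsCritical M σ ∧ σ.2.2.dim = 1) → x σ = 0) :
    ∑ a : V, augTerm ψ (Θ.symm (Matrix.vecMul x
      ((morseMatrix M).map fun z => Θ (changeRight ψ z)) ⟨a, a, Cell.vertex a⟩)) = 0 := by
  obtain ⟨T, U, hT, -, -, -, hTd, hT0, hdim, hTE, -⟩ := exists_morse_transfer hA hM hv
  let Φ : Env k S →+* R := (Θ.toAlgHom.comp (changeRight ψ)).toRingHom
  have hmap : ∀ N N' : Matrix (AnyCell k S) (AnyCell k S) (Env k S),
      (N * N').map Φ = N.map Φ * N'.map Φ := fun N N' => Matrix.map_mul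
  obtain ⟨hyE, hyD, hybar⟩ := morse_push hA hM hv Φ h1 h2 T hT (hTd _) hTE
  have hxd : Matrix.vecMul x ((dimMatrix k S 1).map Φ) = x := by
    ext σ
    rw [dimMatrix, Matrix.diagonal_map (map_zero Φ), Matrix.vecMul_diagonal]
    split_ifs with h
    · rw [map_one, mul_one]
    · rw [h2 σ fun h' => h h'.2, zero_mul]
  have hmd : Matrix.vecMul (Matrix.vecMul x ((morseMatrix M).map Φ)) ((dimMatrix k S 0).map Φ) =
      Matrix.vecMul x ((morseMatrix M).map Φ) := by
    rw [Matrix.vecMul_vecMul, ← hmap, ← hdim, hmap, ← Matrix.vecMul_vecMul, hxd]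
  have hxT : Matrix.vecMul (Matrix.vecMul x ((morseMatrix M).map Φ)) (T.map Φ) =
      Matrix.vecMul x ((morseMatrix M).map Φ) := by
    conv_lhs => rw [← hmd]
    rw [Matrix.vecMul_vecMul, ← hmap, hT0, hmd]
  rw [hxT] at hybar
  have hmem : (fun σ => Θ.symm (Matrix.vecMul x (T.map Φ) σ)) ∈ barSubmodule ψ 1 := by
    refine mem_barSubmodule ψ (fun σ => ?_) fun σ hσ => by rw [hyD σ hσ, map_zero]
    apply Θ.injective
    rw [map_mul, AlgEquiv.apply_symm_apply]
    exact hyE σ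
  have h := barAug_barDiff ψ hA hmem
  rw [barAug_apply, barDiff_apply] at h
  refine Eq.trans (Finset.sum_congr rfl fun a _ => ?_) h
  rw [← vecMul_map_algEquiv]
  change augTerm ψ (Θ.symm (Matrix.vecMul x ((morseMatrix M).map Φ) _)) =
    augTerm ψ (Θ.symm (Matrix.vecMul _ ((barMatrix k S).map Φ) _))
  rw [hybar]

end MorseExact

/-! ### Shellings and the Babson–Hersh matching -/

section Shelling

open scoped Classical

variable {α : Type*}

/-- The restriction set of `F`: the elements whose removal gives a face of an earlier facet. -/
def restriction (E : List (Finset α)) (F : Finset α) : Finset α :=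
  F.filter fun x => ∃ F' ∈ E, F' ∩ F = F.erase x

/-- The index of the first facet containing a face. -/
def firstIdx (L : List (Finset α)) (t : Finset α) : ℕ := L.findIdx fun F => decide (t ⊆ F)

theorem mem_restriction {E : List (Finset α)} {F : Finset α} {x : α} :
    x ∈ restriction E F ↔ x ∈ F ∧ ∃ F' ∈ E, F' ∩ F = F.erase x := Finset.mem_filter

theorem restriction_nil (F : Finset α) : restriction [] F = ∅ := by
  simp [restriction]

theorem firstIdx_eq {L E R : List (Finset α)} {F t : Finset α} (hL : L = E ++ F :: R)
    (ht : t ⊆ F) (hE : ∀ F' ∈ E, ¬ t ⊆ F') : firstIdx L t = E.length := by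
  have h1 : E.findIdx (fun F => decide (t ⊆ F)) = E.length :=
    List.findIdx_eq_length_of_false fun F' hF' => by simpa using hE F' hF'
  rw [firstIdx, hL, List.findIdx_append, h1, if_neg (lt_irrefl _), List.findIdx_cons]
  simp [ht]

theorem firstIdx_mono (L : List (Finset α)) {s t : Finset α} (h : t ⊆ s) :
    firstIdx L t ≤ firstIdx L s :=
  List.findIdx_le_findIdx fun F _ hF => by
    simp only [decide_eq_true_eq] at hF ⊢
    exact h.trans hF

theorem firstIdx_empty (L : List (Finset α)) : firstIdx L ∅ = 0 := by
  cases L <;> simp [firstIdx, List.findIdx_cons]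

theorem subset_getD_firstIdx {L : List (Finset α)} {t : Finset α} (h : firstIdx L t < L.length) :
    t ⊆ L.getD (firstIdx L t) ∅ := by
  rw [List.getD_eq_getElem _ _ h]
  exact of_decide_eq_true (List.findIdx_getElem (w := h))

theorem not_subset_of_mem_take {L : List (Finset α)} {t F : Finset α}
    (h : F ∈ L.take (firstIdx L t)) : ¬ t ⊆ F := by
  obtain ⟨j, hj, rfl⟩ := List.getElem_of_mem h
  rw [List.getElem_take]
  have hj' : j < firstIdx L t := by
    rw [List.length_take] at hj
    omega
  simpa using List.not_of_lt_findIdx hj'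

theorem eq_take_append {L : List (Finset α)} {i : ℕ} (h : i < L.length) :
    L = L.take i ++ L.getD i ∅ :: L.drop (i + 1) := by
  rw [List.getD_eq_getElem _ _ h, List.getElem_cons_drop, List.take_append_drop]

theorem firstIdx_lt_length {L : List (Finset α)} {t F : Finset α} (hF : F ∈ L) (h : t ⊆ F) :
    firstIdx L t < L.length :=
  List.findIdx_lt_length.2 ⟨F, hF, by simpa using h⟩

/-- By the shelling condition each `F \ F'` contains an `x` with `F \ F'' = {x}` for an earlier
facet `F''`, so the minimal skipped sets are singletons. The assumption `hE` keeps the empty set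
from being skipped. -/
theorem IsShelling.minimalSkipped_eq {L : List (Finset α)} (hL : IsShelling L)
    {E R : List (Finset α)} {F : Finset α} (h : L = E ++ F :: R) (hE : ∀ F' ∈ E, ¬ F ⊆ F') :
    minimalSkipped E F = {I | ∃ x ∈ restriction E F, I = {x}} := by
  have key : ∀ {F'' : Finset α} {x : α}, x ∈ F → F'' ∩ F = F.erase x → F \ F'' = {x} := by
    intro F'' x hx h2
    rw [← Finset.sdiff_inter_self_right, h2, Finset.sdiff_erase hx, Finset.sdiff_self]
    rfl
  ext I
  constructor
  · rintro ⟨⟨F', hF', rfl⟩, hmin⟩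
    obtain ⟨F'', hF'', x, hx, h1, h2⟩ := hL.2 E F R h F' hF'
    refine ⟨x, mem_restriction.2 ⟨hx, F'', hF'', h2⟩, ?_⟩
    have h3 : ({x} : Finset α) ⊆ F \ F' := by
      rw [Finset.singleton_subset_iff, Finset.mem_sdiff]
      refine ⟨hx, fun hx' => ?_⟩
      exact Finset.notMem_erase x F (h1 (Finset.mem_inter.2 ⟨hx', hx⟩))
    exact (hmin ⟨F'', hF'', (key hx h2).symm⟩ h3).antisymm h3
  · rintro ⟨x, hx, rfl⟩
    obtain ⟨hx, F'', hF'', h2⟩ := mem_restriction.1 hx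
    refine ⟨⟨F'', hF'', (key hx h2).symm⟩, ?_⟩
    rintro _ ⟨F', hF', rfl⟩ hle
    obtain ⟨y, hy⟩ : (F \ F').Nonempty := Finset.sdiff_nonempty.2 (hE F' hF')
    obtain rfl := Finset.mem_singleton.1 (hle hy)
    exact Finset.singleton_subset_iff.2 hy

/-- A face of `F` that misses an `x` in the restriction set lies in the earlier facet meeting `F` in
`F.erase x`. Conversely, the shelling condition forces a face of an earlier facet to miss such an
`x`. The new faces of `F` thus form a Boolean interval. -/
theorem IsShelling.restriction_subset_iff {L : List (Finset α)} (hL : IsShelling L)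
    {E R : List (Finset α)} {F t : Finset α} (h : L = E ++ F :: R) (ht : t ⊆ F) :
    (∀ F' ∈ E, ¬ t ⊆ F') ↔ restriction E F ⊆ t := by
  constructor
  · intro hE x hx
    obtain ⟨hx, F', hF', h2⟩ := mem_restriction.1 hx
    by_contra hxt
    refine hE F' hF' fun y hy => ?_
    have : y ∈ F.erase x := Finset.mem_erase.2 ⟨by rintro rfl; exact hxt hy, ht hy⟩
    rw [← h2] at this
    exact (Finset.mem_inter.1 this).1
  · intro hr F' hF' htF'
    obtain ⟨F'', hF'', x, hx, h1, h2⟩ := hL.2 E F R h F' hF'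
    have hxt : x ∈ t := hr (mem_restriction.2 ⟨hx, F'', hF'', h2⟩)
    exact Finset.notMem_erase x F (h1 (Finset.mem_inter.2 ⟨htF' hxt, hx⟩))

variable [PartialOrder α]

/-- The element toggled by the matching at the faces whose first facet has index `i`. -/
def IsToggle (L : List (Finset α)) (i : ℕ) (x : α) : Prop :=
  IsLeast {y | y ∈ L.getD i ∅ ∧ y ∉ restriction (L.take i) (L.getD i ∅)} x

theorem IsToggle.unique {L : List (Finset α)} {i : ℕ} {x y : α} (hx : IsToggle L i x)
    (hy : IsToggle L i y) : x = y := IsLeast.unique hx hy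

theorem IsToggle.mem {L : List (Finset α)} {i : ℕ} {x : α} (hx : IsToggle L i x) :
    x ∈ L.getD i ∅ := hx.1.1

theorem IsToggle.lt_length {L : List (Finset α)} {i : ℕ} {x : α} (hx : IsToggle L i x) :
    i < L.length := by
  by_contra h
  have h1 := hx.mem
  rw [List.getD_eq_default _ _ (not_lt.1 h)] at h1
  exact Finset.notMem_empty _ h1

theorem exists_isLeast_of_isChain {s : Finset α} (hs : IsChain (· ≤ ·) (s : Set α))
    (hne : s.Nonempty) : ∃ x, IsLeast (s : Set α) x := by
  obtain ⟨x, hx⟩ := s.exists_minimal hne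
  refine ⟨x, hx.1, fun y hy => ?_⟩
  obtain h | h := hs.total hx.1 hy
  · exact h
  · exact hx.2 hy h

/-- Distinct singletons are disjoint and incomparable, so truncation deletes and discards nothing.
The recursion just lists them in increasing order. -/
theorem exists_jIntervals {r : Finset α} (hr : IsChain (· ≤ ·) (r : Set α)) :
    ∃ js, JIntervals {I | ∃ x ∈ r, I = {x}} js := by
  induction r using Finset.strongInduction with
  | H r ih =>
    obtain rfl | hne := r.eq_empty_or_nonempty
    · exact ⟨[], by convert JIntervals.nil; simp⟩
    obtain ⟨x, hx⟩ := exists_isLeast_of_isChain hr hne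
    obtain ⟨js, hjs⟩ := ih (r.erase x) (Finset.erase_ssubset hx.1)
      (hr.mono (by exact_mod_cast r.erase_subset x))
    refine ⟨{x} :: js, JIntervals.cons ⟨x, hx.1, rfl⟩ (Finset.mem_singleton_self x) ?_ ?_⟩
    · rintro _ ⟨y, hy, rfl⟩ z hz
      rw [Finset.mem_singleton.1 hz]
      exact hx.2 hy
    · convert hjs using 1
      have hsd : ∀ y ≠ x, ({y} : Finset α) \ {x} = {y} := fun y hy => by
        rw [Finset.sdiff_eq_self_iff_disjoint, Finset.disjoint_singleton]
        exact hy
      ext K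
      constructor
      · rintro ⟨⟨_, ⟨y, hy, rfl⟩, hne, rfl⟩, -⟩
        have hyx : y ≠ x := fun h => hne (by rw [h])
        exact ⟨y, Finset.mem_erase.2 ⟨hyx, hy⟩, hsd y hyx⟩
      · rintro ⟨y, hy, rfl⟩
        obtain ⟨hyx, hy⟩ := Finset.mem_erase.1 hy
        refine ⟨⟨{y}, ⟨y, hy, rfl⟩, fun h => hyx (Finset.singleton_injective h),
          (hsd y hyx).symm⟩, ?_⟩
        rintro _ ⟨_, ⟨z, hz, rfl⟩, hne, rfl⟩ hle
        have hzx : z ≠ x := fun h => hne (by rw [h])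
        rw [hsd z hzx] at hle ⊢
        rw [Finset.singleton_subset_singleton.1 hle]

/-- Truncation does not alter distinct singletons, so every derivation ends up with all of them. -/
theorem JIntervals.mem_iff {𝓘 : Set (Finset α)} {js : List (Finset α)} (h : JIntervals 𝓘 js)
    (h𝓘 : ∀ I ∈ 𝓘, ∃ x, I = {x}) (K : Finset α) : K ∈ js ↔ K ∈ 𝓘 := by
  induction h with
  | nil => simp
  | @cons 𝓘 J x js hJ hx hlow hrest ih =>
    have hsd : ∀ I ∈ 𝓘, I ≠ J → I \ J = I := by
      intro I hI hne
      obtain ⟨y, rfl⟩ := h𝓘 I hI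
      obtain ⟨z, rfl⟩ := h𝓘 J hJ
      rw [Finset.sdiff_eq_self_iff_disjoint, Finset.disjoint_singleton]
      exact fun h => hne (by rw [h])
    have heq : ∀ K, Minimal (fun K => ∃ I ∈ 𝓘, I ≠ J ∧ K = I \ J) K ↔ K ∈ 𝓘 ∧ K ≠ J := by
      intro K
      constructor
      · rintro ⟨⟨I, hI, hne, rfl⟩, -⟩
        rw [hsd I hI hne]
        exact ⟨hI, hne⟩
      · rintro ⟨hK, hne⟩
        refine ⟨⟨K, hK, hne, (hsd K hK hne).symm⟩, ?_⟩
        rintro _ ⟨I, hI, hneI, rfl⟩ hle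
        rw [hsd I hI hneI] at hle ⊢
        obtain ⟨y, rfl⟩ := h𝓘 I hI
        obtain ⟨z, rfl⟩ := h𝓘 K hK
        rw [Finset.singleton_subset_singleton.1 hle]
    have h1 := ih fun I hI => h𝓘 I ((heq I).1 hI).1
    rw [List.mem_cons, h1, Set.mem_ofPred_eq, heq]
    by_cases hKJ : K = J
    · simp [hKJ, hJ]
    · simp [hKJ]

theorem meetsInLeast_singleton {t : Finset α} {x : α} : MeetsInLeast t {x} ↔ x ∈ t := by
  constructor
  · rintro ⟨y, hy, h⟩
    have : y = x := by simpa using hy.1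
    subst this
    have h1 : y ∈ t ∩ {y} := by rw [h]; exact Finset.mem_singleton_self y
    exact (Finset.mem_inter.1 h1).1
  · intro h
    refine ⟨x, by simp, ?_⟩
    rw [Finset.inter_singleton_of_mem h]

/-- The matching of a shelling adds to a face the least element of its first facet outside the
restriction set. -/
theorem bhMatched_iff {L : List (Finset α)} (hL : IsShelling L)
    (hchain : ∀ F ∈ L, IsChain (· ≤ ·) (F : Set α)) {s t : Finset α} :
    BHMatched L s t ↔ t.Nonempty ∧ ∃ x, IsToggle L (firstIdx L t) x ∧ x ∉ t ∧ s = insert x t := by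
  constructor
  · rintro ⟨ht, E, F, R, js, x, h1, h2, h3, hjs, hpiv, hx, hs⟩
    refine ⟨ht, x, ?_, hx, hs⟩
    have hidx := firstIdx_eq h1 h2 h3
    have hmin := hL.minimalSkipped_eq h1 fun F' hF' h => h3 F' hF' (h2.trans h)
    have hres := (hL.restriction_subset_iff h1 h2).1 h3
    have hmem := hjs.mem_iff (by rw [hmin]; rintro I ⟨y, -, rfl⟩; exact ⟨y, rfl⟩)
    rw [hmin] at hmem
    have htake : L.take (firstIdx L t) = E := by rw [hidx, h1, List.take_left]
    have hget : L.getD (firstIdx L t) ∅ = F := by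
      rw [hidx, h1, List.getD_append_right _ _ _ _ le_rfl]
      simp
    rw [IsToggle, htake, hget]
    -- The first alternative cannot occur: the face contains the restriction set, so it meets every
    -- singleton `J`-interval in its least element.
    obtain ⟨as, J, bs, rfl, -, hJ, -⟩ | ⟨-, hleast⟩ := hpiv
    · obtain ⟨y, hy, rfl⟩ := (hmem J).1 (by simp)
      exact (hJ (meetsInLeast_singleton.2 (hres hy))).elim
    · convert hleast using 1
      ext y
      refine and_congr_right fun _ => ?_
      constructor
      · rintro hy K hK hyK
        obtain ⟨z, hz, rfl⟩ := (hmem K).1 hK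
        rw [Finset.mem_singleton.1 hyK] at hy
        exact hy hz
      · intro h hy
        exact h {y} ((hmem _).2 ⟨y, hy, rfl⟩) (Finset.mem_singleton_self y)
  · rintro ⟨ht, x, hx, hxt, hs⟩
    have hlt := hx.lt_length
    have h1 := eq_take_append hlt
    have h2 := subset_getD_firstIdx hlt
    have h3 : ∀ F' ∈ L.take (firstIdx L t), ¬ t ⊆ F' := fun F' h => not_subset_of_mem_take h
    set E := L.take (firstIdx L t)
    set F := L.getD (firstIdx L t) ∅ with hF
    have hFL : F ∈ L := by rw [h1]; simp
    have hmin := hL.minimalSkipped_eq h1 fun F' hF' h => h3 F' hF' (h2.trans h)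
    have hres := (hL.restriction_subset_iff h1 h2).1 h3
    obtain ⟨js, hjs⟩ := exists_jIntervals (r := restriction E F)
      ((hchain F hFL).mono (by exact_mod_cast Finset.filter_subset _ _))
    rw [← hmin] at hjs
    have hmem := hjs.mem_iff (by rw [hmin]; rintro I ⟨y, -, rfl⟩; exact ⟨y, rfl⟩)
    rw [hmin] at hmem
    refine ⟨ht, E, F, _, js, x, h1, h2, h3, hjs, Or.inr ⟨?_, ?_⟩, hxt, hs⟩
    · intro K hK
      obtain ⟨y, hy, rfl⟩ := (hmem K).1 hK
      exact meetsInLeast_singleton.2 (hres hy)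
    · have hx' : IsLeast {y | y ∈ F ∧ y ∉ restriction E F} x := hx
      convert hx' using 1
      ext y
      refine and_congr_right fun _ => ?_
      constructor
      · intro h hy
        exact h {y} ((hmem _).2 ⟨y, hy, rfl⟩) (Finset.mem_singleton_self y)
      · rintro hy K hK hyK
        obtain ⟨z, hz, rfl⟩ := (hmem K).1 hK
        rw [Finset.mem_singleton.1 hyK] at hy
        exact hy hz

theorem IsToggle.firstIdx_insert {L : List (Finset α)} {t : Finset α} {x : α}
    (hx : IsToggle L (firstIdx L t) x) : firstIdx L (insert x t) = firstIdx L t := by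
  have hlt := hx.lt_length
  rw [firstIdx_eq (eq_take_append hlt) (t := insert x t), List.length_take]
  · omega
  · exact Finset.insert_subset hx.mem (subset_getD_firstIdx hlt)
  · intro F' hF' h
    exact not_subset_of_mem_take hF' ((Finset.subset_insert x t).trans h)

theorem IsShelling.restriction_subset {L : List (Finset α)} (hL : IsShelling L) {t : Finset α}
    (ht : firstIdx L t < L.length) :
    restriction (L.take (firstIdx L t)) (L.getD (firstIdx L t) ∅) ⊆ t :=
  (hL.restriction_subset_iff (eq_take_append ht) (subset_getD_firstIdx ht)).1
    fun _ h => not_subset_of_mem_take h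

/-- Erasing an element outside the restriction set stays inside the Boolean interval of new faces of
the same facet. -/
theorem IsShelling.firstIdx_erase {L : List (Finset α)} (hL : IsShelling L) {t : Finset α} {x : α}
    (ht : firstIdx L t < L.length)
    (hx : x ∉ restriction (L.take (firstIdx L t)) (L.getD (firstIdx L t) ∅)) :
    firstIdx L (t.erase x) = firstIdx L t := by
  have hsub := (Finset.erase_subset x t).trans (subset_getD_firstIdx ht)
  rw [firstIdx_eq (eq_take_append ht) hsub, List.length_take]
  · omega
  · refine (hL.restriction_subset_iff (eq_take_append ht) hsub).2 fun y hy => ?_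
    refine Finset.mem_erase.2 ⟨?_, hL.restriction_subset ht hy⟩
    rintro rfl
    exact hx hy

/-- A potential on the faces with a given first facet, decreasing along the arrows of the modified
Hasse diagram. -/
def togglePotential (L : List (Finset α)) (t : Finset α) : ℕ :=
  2 * (t.filter fun y => ¬ IsToggle L (firstIdx L t) y).card +
    if ∃ y, IsToggle L (firstIdx L t) y ∧ y ∉ t then 1 else 0

theorem IsToggle.togglePotential_insert_lt {L : List (Finset α)} {t : Finset α} {x : α}
    (hx : IsToggle L (firstIdx L t) x) (hxt : x ∉ t) :
    togglePotential L (insert x t) < togglePotential L t := by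
  rw [togglePotential, togglePotential, hx.firstIdx_insert, Finset.filter_insert, if_neg (not_not.2 hx),
    if_pos (⟨x, hx, hxt⟩ : ∃ y, IsToggle L (firstIdx L t) y ∧ y ∉ t), if_neg]
  · omega
  · rintro ⟨y, hy, hyt⟩
    rw [hy.unique hx] at hyt
    exact hyt (Finset.mem_insert_self _ _)

/-- Losing an element other than the toggle costs two, while the indicator of an absent toggle
contributes at most one. This is why the cardinality is doubled in the potential. -/
theorem togglePotential_erase_lt {L : List (Finset α)} {t : Finset α} {y : α} (hy : y ∈ t)
    (hidx : firstIdx L (t.erase y) = firstIdx L t) (hny : ¬ IsToggle L (firstIdx L t) y) :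
    togglePotential L (t.erase y) < togglePotential L t := by
  rw [togglePotential, togglePotential, hidx, Finset.filter_erase]
  have h1 : y ∈ t.filter fun y => ¬ IsToggle L (firstIdx L t) y := Finset.mem_filter.2 ⟨hy, hny⟩
  have h2 := Finset.card_erase_add_one h1
  have h3 : (if ∃ z, IsToggle L (firstIdx L t) z ∧ z ∉ t.erase y then 1 else 0) ≤ 1 := by
    split_ifs <;> omega
  omega

/-- An unmatched nonempty face either is a facet or consists of the least element of the first
facet. -/
theorem IsShelling.eq_facet_or_of_unmatched {L : List (Finset α)} (hL : IsShelling L)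
    (hchain : ∀ F ∈ L, IsChain (· ≤ ·) (F : Set α)) {t : Finset α} (ht : t.Nonempty)
    (hlt : firstIdx L t < L.length) (hun : ∀ s, ¬ BHMatched L s t ∧ ¬ BHMatched L t s) :
    t ∈ L ∨ ∃ x, t = {x} ∧ IsToggle L 0 x := by
  have h1 := eq_take_append hlt
  have h2 := subset_getD_firstIdx hlt
  have hFL : L.getD (firstIdx L t) ∅ ∈ L := by
    rw [List.getD_eq_getElem _ _ hlt]
    exact List.getElem_mem _
  by_cases hne : (L.getD (firstIdx L t) ∅ \
    restriction (L.take (firstIdx L t)) (L.getD (firstIdx L t) ∅)).Nonempty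
  · right
    obtain ⟨x, hx⟩ := exists_isLeast_of_isChain
      ((hchain _ hFL).mono (by exact_mod_cast Finset.sdiff_subset)) hne
    have hx : IsToggle L (firstIdx L t) x := by
      rw [Finset.coe_sdiff] at hx
      exact hx
    -- If the toggle is absent, `t` is matched upwards. If it is present, `t` is matched downwards
    -- unless erasing it leaves the empty chain, whose first facet has index `0`.
    by_cases hxt : x ∈ t
    · have hidx := hL.firstIdx_erase hlt hx.1.2
      obtain he | he := (t.erase x).eq_empty_or_nonempty
      · have ht' : t = {x} := by
          rw [← Finset.insert_erase hxt, he]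
          rfl
        refine ⟨x, ht', ?_⟩
        rw [he, firstIdx_empty] at hidx
        rwa [hidx]
      · refine ((hun (t.erase x)).2 ((bhMatched_iff hL hchain).2
          ⟨he, x, by rwa [hidx], Finset.notMem_erase x t, (Finset.insert_erase hxt).symm⟩)).elim
    · exact ((hun (insert x t)).1 ((bhMatched_iff hL hchain).2 ⟨ht, x, hx, hxt, rfl⟩)).elim
  · left
    rw [Finset.not_nonempty_iff_eq_empty, Finset.sdiff_eq_empty_iff_subset] at hne
    rwa [h2.antisymm (hne.trans (hL.restriction_subset hlt))]

theorem isChain_of_isFacetOrder {P : Set α} {L : List (Finset α)}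
    (hL : IsFacetOrder (orderComplex P) L) : ∀ F ∈ L, IsChain (· ≤ ·) (F : Set α) :=
  fun F hF => ((hL.2 F).1 hF).1.2.2

theorem exists_facet_of_mem_faces {P : Set α} (hP : P.Finite) {t : Finset α}
    (ht : t ∈ (orderComplex P).faces) : ∃ F ∈ facets (orderComplex P), t ⊆ F := by
  have hfin : {s : Finset α | s ∈ (orderComplex P).faces}.Finite := by
    refine (hP.toFinset.powerset.finite_toSet).subset fun s hs => ?_
    simp only [Finset.coe_powerset, Set.Finite.coe_toFinset, Set.mem_preimage, Set.mem_powerset_iff]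
    exact hs.2.1
  obtain ⟨F, hle, hF⟩ := hfin.exists_le_maximal ht
  exact ⟨F, hF, hle⟩

theorem singleton_mem_faces {P : Set α} {x : α} (hx : x ∈ P) :
    {x} ∈ (orderComplex P).faces :=
  ⟨Finset.singleton_nonempty x, by simpa using hx, by simp⟩

/-- The least element of the first facet of a shelling is unmatched. -/
theorem exists_unmatched_point {P : Set α} (hfin : P.Finite) (hne : P.Nonempty)
    {L : List (Finset α)} (hL : IsFacetOrder (orderComplex P) L) (hs : IsShelling L) :
    ∃ b ∈ P, ∀ s, ¬ BHMatched L s {b} ∧ ¬ BHMatched L {b} s := by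
  obtain ⟨y, hy⟩ := hne
  obtain ⟨F', hF', -⟩ := exists_facet_of_mem_faces hfin (singleton_mem_faces hy)
  obtain _ | ⟨F, R⟩ := L
  · exact absurd ((hL.2 F').2 hF') List.not_mem_nil
  have hF := (hL.2 F).1 (by simp)
  obtain ⟨b, hb⟩ := exists_isLeast_of_isChain hF.1.2.2 hF.1.1
  have hchain := isChain_of_isFacetOrder hL
  -- No facet precedes the first one, so its restriction set is empty and its toggle is its least
  -- element.
  have htog : IsToggle (F :: R) 0 b := by
    simp only [IsToggle, List.getD_cons_zero, List.take_zero, restriction_nil]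
    simpa using hb
  have hidx : firstIdx (F :: R) {b} = 0 :=
    firstIdx_eq (E := []) rfl (by simpa using hb.1) (by simp)
  refine ⟨b, hF.1.2.1 hb.1, fun s => ⟨fun h => ?_, fun h => ?_⟩⟩
  · obtain ⟨-, x, hx, hxb, -⟩ := (bhMatched_iff hs hchain).1 h
    rw [hidx] at hx
    exact hxb (Finset.mem_singleton.2 (hx.unique htog))
  · obtain ⟨hsne, x, hx, hxs, heq⟩ := (bhMatched_iff hs hchain).1 h
    obtain ⟨z, hz⟩ := hsne
    have h1 : z = b := by
      have : z ∈ ({b} : Finset α) := by rw [heq]; exact Finset.mem_insert_of_mem hz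
      simpa using this
    have h2 : x = b := by
      have : x ∈ ({b} : Finset α) := by rw [heq]; exact Finset.mem_insert_self _ _
      simpa using this
    exact hxs (by rw [h2, ← h1]; exact hz)

/-- Any ordering of the facets of a finite set of points is a shelling. -/
theorem IsFinitePointSet.isShellable {K : PreAbstractSimplicialComplex α}
    (hK : IsFinitePointSet K) : IsShellable K := by
  have hfin : (facets K).Finite := hK.1.subset fun F hF => hF.1
  have hcard : ∀ F ∈ hfin.toFinset.toList, F.card = 1 := fun F hF => by
    simp only [Finset.mem_toList, Set.Finite.mem_toFinset] at hF
    exact hK.2 F hF.1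
  refine ⟨hfin.toFinset.toList, ⟨Finset.nodup_toList _, by simp⟩, ?_, ?_⟩
  · intro F hF F' hF'
    rw [hcard F hF, hcard F' hF']
  · intro E F R h F' hF'
    have hnd := hfin.toFinset.nodup_toList
    rw [h] at hnd hcard
    obtain ⟨x, rfl⟩ := Finset.card_eq_one.1 (hcard F (by simp))
    obtain ⟨y, rfl⟩ := Finset.card_eq_one.1 (hcard F' (by simp [hF']))
    have hxy : y ≠ x := by
      rintro rfl
      exact List.disjoint_of_nodup_append hnd hF' (by simp)
    -- Two distinct points meet in the empty set, the codimension-one face of a point.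
    have h1 : ({y} : Finset α) ∩ {x} = ({x} : Finset α).erase x := by
      rw [Finset.erase_singleton, ← Finset.disjoint_iff_inter_eq_empty,
        Finset.disjoint_singleton]
      exact hxy
    exact ⟨{y}, hF', x, by simp, h1.le, h1⟩

end Shelling

/-! ### The Babson–Hersh matching of the cells -/

section CellMatching

open scoped Classical

variable {k : Type w} {V : Type u} [Quiver.{v} V] [CommRing k] [Fintype V] {S : PathRelations V}
  [AcyclicQuiver V]

namespace Cell

variable {a b : V}

theorem ext_inner {σ τ : Cell k S a b} (htop : σ.top = τ.top) (h : σ.inner = τ.inner) : σ = τ := by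
  refine ext_verts (Finset.ext fun x => ?_)
  have h1 : x ∈ σ.inner ↔ x ∈ τ.inner := by rw [h]
  rw [Facet.mem_inner, Facet.mem_inner, htop] at h1
  by_cases hx : x = τ.top.toPoset
  · subst hx
    exact iff_of_true (by rw [← htop]; exact σ.top_mem) τ.top_mem
  by_cases hx' : x = ⊥
  · subst hx'
    exact iff_of_true σ.bot_mem τ.bot_mem
  simpa [hx, hx'] using h1

theorem inner_subset (σ : Cell k S a b) {x : PathsFrom k S a} (hx : x ∈ σ.inner) :
    x ∈ σ.top.openInterval := by
  obtain ⟨h1, h2, h3⟩ := Facet.mem_inner.1 hx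
  exact ⟨bot_lt_iff_ne_bot.2 h2, lt_of_le_of_ne (σ.le_top h3) h1⟩

theorem inner_mem_faces (σ : Cell k S a b) (h : σ.inner.Nonempty) :
    σ.inner ∈ (orderComplex σ.top.openInterval).faces :=
  ⟨h, fun _ => σ.inner_subset, σ.chain.mono fun _ hx => (Facet.mem_inner.1 hx).2.2⟩

/-- The cell given by a path and a chain of intermediate paths. -/
def ofInner (p : PathClass k S a b) (t : Finset (PathsFrom k S a))
    (ht : ∀ x ∈ t, x ∈ p.openInterval) (hc : IsChain (· ≤ ·) (t : Set (PathsFrom k S a))) :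
    Cell k S a b where
  top := p
  verts := insert ⊥ (insert p.toPoset t)
  chain := by
    rw [Finset.coe_insert, Finset.coe_insert]
    exact (hc.insert fun x hx _ => Or.inr (ht x hx).2.le).insert fun x _ _ => Or.inl bot_le
  bot_mem := Finset.mem_insert_self _ _
  isGreatest := by
    refine ⟨by simp, fun x hx => ?_⟩
    rw [Finset.mem_coe, Finset.mem_insert, Finset.mem_insert] at hx
    obtain rfl | rfl | hx := hx
    · exact bot_le
    · exact le_rfl
    · exact (ht x hx).2.le

theorem inner_ofInner (p : PathClass k S a b) (t : Finset (PathsFrom k S a))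
    (ht : ∀ x ∈ t, x ∈ p.openInterval) (hc : IsChain (· ≤ ·) (t : Set (PathsFrom k S a))) :
    (ofInner p t ht hc).inner = t := by
  ext x
  rw [Facet.mem_inner]
  change x ≠ p.toPoset ∧ x ≠ ⊥ ∧ x ∈ insert ⊥ (insert p.toPoset t) ↔ _
  rw [Finset.mem_insert, Finset.mem_insert]
  constructor
  · rintro ⟨h1, h2, h3⟩
    exact (h3.resolve_left h2).resolve_left h1
  · intro h
    exact ⟨(ht x h).2.ne, (ht x h).1.ne', Or.inr (Or.inr h)⟩

theorem dim_eq_card_inner (σ : Cell k S a b) (h : a ≠ b) : σ.dim = σ.inner.card + 1 := by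
  have h1 : ⊥ ≠ σ.top.toPoset := ((PathClass.bot_lt_iff_ne _).2 h).ne
  have h2 : σ.top.toPoset ∈ σ.verts.erase ⊥ := Finset.mem_erase.2 ⟨h1.symm, σ.top_mem⟩
  have h3 := Finset.card_erase_add_one h2
  have h4 := Finset.card_erase_add_one σ.bot_mem
  have h5 := σ.card_verts
  rw [inner]
  omega

theorem inner_erase {σ τ : Cell k S a b} (htop : σ.top = τ.top) {x : PathsFrom k S a}
    (h : τ.inner = σ.inner.erase x) (hx : x ∈ σ.inner) : τ.verts = σ.verts.erase x := by
  obtain ⟨h1, h2, h3⟩ := Facet.mem_inner.1 hx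
  ext y
  rw [Finset.mem_erase]
  have h4 : y ∈ τ.inner ↔ y ∈ σ.inner.erase x := by rw [h]
  rw [Finset.mem_erase, Facet.mem_inner, Facet.mem_inner, htop] at h4
  by_cases hy : y = τ.top.toPoset
  · subst hy
    refine iff_of_true τ.top_mem ⟨?_, by rw [← htop]; exact σ.top_mem⟩
    rintro rfl
    exact h1 (by rw [htop])
  by_cases hy' : y = ⊥
  · subst hy'
    exact iff_of_true τ.bot_mem ⟨h2.symm, σ.bot_mem⟩
  simpa [hy, hy'] using h4

end Cell

theorem Facet.internal_top {a b : V} {x : PathsFrom k S a} {σ τ : Cell k S a b} (hx : x ∈ σ.inner)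
    (h : τ.verts = σ.verts.erase x) : σ.top = τ.top := by
  apply PathClass.toPoset_injective
  refine le_antisymm (τ.le_top ?_) (σ.le_top ?_)
  · rw [h]
    exact Finset.mem_erase.2 ⟨(Facet.mem_inner.1 hx).1.symm, σ.top_mem⟩
  · have := τ.top_mem
    rw [h] at this
    exact Finset.mem_of_mem_erase this

theorem Facet.internal_inner {a b : V} {x : PathsFrom k S a} {σ τ : Cell k S a b}
    (hx : x ∈ σ.inner) (h : τ.verts = σ.verts.erase x) : τ.inner = σ.inner.erase x := by
  ext y
  rw [Facet.mem_inner, Finset.mem_erase, Facet.mem_inner, internal_top hx h, h, Finset.mem_erase]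
  tauto

variable [∀ a b : V, Finite (a ⟶ b)]

/-- The number of initial segments of a path. -/
def pathHeight {a b : V} (p : PathClass k S a b) : ℕ := (Set.Iic p.toPoset).ncard

theorem pathHeight_lt_comp {a b c : V} (p : PathClass k S a b) (r : PathClass k S b c)
    (hr : ⊥ < r.toPoset) : pathHeight p < pathHeight (p.comp r) := by
  refine Set.ncard_lt_ncard ?_ (Set.toFinite _)
  have h : p.toPoset < (p.comp r).toPoset :=
    (PathClass.toPoset_lt_comp p r).2 ((PathClass.bot_lt_iff_ne r).1 hr)
  exact Set.Iic_ssubset_Iic.2 h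

/-- Left multiplication by `r` embeds the initial segments of `p` into those of `r p` and misses the
trivial one. -/
theorem pathHeight_lt_comp' (hA : IsHPA k S) [Nontrivial k] {a b c : V} (r : PathClass k S a b)
    (p : PathClass k S b c) (hr : ⊥ < r.toPoset) : pathHeight p < pathHeight (r.comp p) := by
  rw [pathHeight, ← Set.ncard_image_of_injective _ (PathsFrom.lcomp_injective hA r)]
  refine Set.ncard_lt_ncard ?_ (Set.toFinite _)
  refine (Set.ssubset_iff_of_subset ?_).2 ⟨⊥, Set.mem_Iic.2 bot_le, ?_⟩
  · rintro _ ⟨q, hq, rfl⟩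
    exact PathsFrom.lcomp_mono r hq
  · rintro ⟨q, -, hq⟩
    exact (PathsFrom.bot_lt_lcomp hr q).ne' hq

namespace BHChoice

variable (B : BHChoice k S)

theorem isVertical : IsVertical B.matching := by
  intro σ τ h
  obtain ⟨σ, τ, htop, -⟩ | ⟨σ, τ, htop, -, -⟩ := h
  · exact ⟨_, _, σ, τ, htop, rfl, rfl⟩
  · exact ⟨_, _, σ, τ, htop, rfl, rfl⟩

theorem matching_iff {a b : V} {σ τ : Cell k S a b} :
    B.matching ⟨a, b, σ⟩ ⟨a, b, τ⟩ ↔ σ.top = τ.top ∧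
      (BHMatched (B.order τ.top) σ.inner τ.inner ∨
        (σ.inner = {B.base τ.top} ∧ τ.inner = ∅)) := by
  constructor
  · intro h
    generalize hσ : (⟨a, b, σ⟩ : AnyCell k S) = σ' at h
    generalize hτ : (⟨a, b, τ⟩ : AnyCell k S) = τ' at h
    obtain ⟨σ', τ', htop, h⟩ | ⟨σ', τ', htop, h, h'⟩ := h
    · cases hσ
      cases hτ
      rw [htop] at h
      exact ⟨htop, Or.inl h⟩
    · cases hσ
      cases hτ
      rw [htop] at h
      exact ⟨htop, Or.inr ⟨h, h'⟩⟩
  · rintro ⟨htop, h | ⟨h, h'⟩⟩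
    · exact matching.pair σ τ htop (by rwa [htop])
    · exact matching.base σ τ htop (by rwa [htop]) h'

theorem exists_of_matching {σ τ : AnyCell k S} (h : B.matching σ τ) :
    ∃ (a b : V) (σ' τ' : Cell k S a b), σ = ⟨a, b, σ'⟩ ∧ τ = ⟨a, b, τ'⟩ ∧ σ'.top = τ'.top := by
  obtain ⟨a, b, σ', τ', h1, h2, h3⟩ := B.isVertical σ τ h
  exact ⟨a, b, σ', τ', h2, h3, h1⟩

theorem isChain_order {a b : V} (p : PathClass k S a b) :
    ∀ F ∈ B.order p, IsChain (· ≤ ·) (F : Set (PathsFrom k S a)) :=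
  isChain_of_isFacetOrder (B.isFacetOrder p)

theorem firstIdx_lt {a b : V} (σ : Cell k S a b) (h : σ.inner.Nonempty) :
    firstIdx (B.order σ.top) σ.inner < (B.order σ.top).length := by
  obtain ⟨F, hF, hle⟩ := exists_facet_of_mem_faces (Set.toFinite _) (σ.inner_mem_faces h)
  exact firstIdx_lt_length (((B.isFacetOrder σ.top).2 F).2 hF) hle

theorem base_unmatched_of_mem {a b : V} {p : PathClass k S a b} {x : PathsFrom k S a}
    (hx : x ∈ p.openInterval) (s : Finset (PathsFrom k S a)) :
    ¬ BHMatched (B.order p) s {B.base p} ∧ ¬ BHMatched (B.order p) {B.base p} s :=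
  B.base_unmatched p ⟨x, hx⟩ s

variable {B} (hB : B.IsShelling)

/-- The kind of a cell: `0` for the partner of a cell without inner vertices, `1` for a cell without
inner vertices, and `2` for all other cells. -/
def cellKind (B : BHChoice k S) {a b : V} (σ : Cell k S a b) : ℕ :=
  if σ.inner = ∅ then 1 else if σ.inner = {B.base σ.top} then 0 else 2

/-- A potential that decreases along the arrows of the modified Hasse diagram. -/
def potential (B : BHChoice k S) (σ : AnyCell k S) : ℕ ×ₗ ℕ ×ₗ ℕ ×ₗ ℕ :=
  toLex (pathHeight σ.2.2.top, toLex (cellKind B σ.2.2,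
    toLex (firstIdx (B.order σ.2.2.top) σ.2.2.inner,
      togglePotential (B.order σ.2.2.top) σ.2.2.inner)))

include hB

/-- The top path is unchanged. Passing from `[e < p]` to the cell of the base point lowers the kind
from `1` to `0`. For the other pairs both cells have kind `2`, since the base point is unmatched;
the first facet is the same, and adding the toggle lowers `togglePotential`. -/
theorem potential_lt_of_matching {σ τ : AnyCell k S} (h : B.matching σ τ) :
    potential B σ < potential B τ := by
  obtain ⟨a, b, σ, τ, rfl, rfl, htop⟩ := B.exists_of_matching h
  obtain ⟨-, h | ⟨h, h'⟩⟩ := B.matching_iff.1 h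
  · have h0 := h
    obtain ⟨hne, x, hx, hxt, hs⟩ := (bhMatched_iff (hB _) (B.isChain_order _)).1 h
    obtain ⟨y, hy⟩ := hne
    have hτ : cellKind B τ = 2 := by
      rw [cellKind, if_neg (Finset.ne_empty_of_mem hy), if_neg]
      intro h1
      rw [h1] at h
      exact (B.base_unmatched_of_mem (τ.inner_subset hy) _).1 h
    have hσ : cellKind B σ = 2 := by
      rw [cellKind, if_neg, if_neg]
      · intro h1
        rw [h1, htop] at h
        exact (B.base_unmatched_of_mem (τ.inner_subset hy) _).2 h
      · rw [hs]
        exact Finset.insert_ne_empty _ _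
    simp only [potential, hσ, hτ, htop, hs, hx.firstIdx_insert, Prod.Lex.toLex_lt_toLex,
      lt_self_iff_false, true_and, false_or]
    exact hx.togglePotential_insert_lt hxt
  · have hτ : cellKind B τ = 1 := if_pos h'
    have hσ : cellKind B σ = 0 := by
      rw [cellKind, if_neg, if_pos]
      · rw [h, htop]
      · rw [h]
        exact Finset.singleton_ne_empty _
    simp only [potential, hσ, hτ, htop, Prod.Lex.toLex_lt_toLex]
    simp

/-- Initial and terminal facets shorten the top path. An unmatched internal facet starts at kind
`2`: it either reaches a smaller kind, or moves to an earlier first facet, or loses an element other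
than the toggle, as erasing the toggle would be a matched step. -/
theorem potential_lt_of_facet [Nontrivial k] (hA : IsHPA k S) {σ τ : AnyCell k S} (f : Facet σ τ)
    (hf : ¬ B.matching σ τ) : potential B τ < potential B σ := by
  cases f with
  | @initial a b c r hr σ τ h =>
    refine Prod.Lex.toLex_lt_toLex.2 (Or.inl ?_)
    have htop : σ.top = r.comp τ.top := Facet.initial_top (by rw [h]; simp [Cell.cons]; rfl)
    change pathHeight τ.top < pathHeight σ.top
    rw [htop]
    exact pathHeight_lt_comp' hA r _ hr
  | @terminal a b c r hr σ τ h htop =>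
    refine Prod.Lex.toLex_lt_toLex.2 (Or.inl ?_)
    change pathHeight τ.top < pathHeight σ.top
    rw [htop]
    exact pathHeight_lt_comp _ r hr
  | @internal a b x σ τ hx h =>
    have htop := Facet.internal_top hx h
    have hinner := Facet.internal_inner hx h
    have hσ : cellKind B σ = 2 := by
      rw [cellKind, if_neg (Finset.ne_empty_of_mem hx), if_neg]
      intro h1
      refine hf (B.matching_iff.2 ⟨htop, Or.inr ⟨by rw [← htop, h1], ?_⟩⟩)
      rw [hinner, h1]
      rw [h1] at hx
      rw [Finset.mem_singleton.1 hx, Finset.erase_singleton]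
    have hlt : cellKind B τ < 2 → potential B ⟨a, b, τ⟩ < potential B ⟨a, b, σ⟩ := by
      intro hlt
      simp only [potential, hσ, htop, Prod.Lex.toLex_lt_toLex, lt_self_iff_false, true_and,
        false_or]
      exact Or.inl hlt
    by_cases h0 : τ.inner = ∅
    · exact hlt (by rw [cellKind, if_pos h0]; omega)
    by_cases h1 : τ.inner = {B.base τ.top}
    · exact hlt (by rw [cellKind, if_neg h0, if_pos h1]; omega)
    have hτ : cellKind B τ = 2 := by rw [cellKind, if_neg h0, if_neg h1]
    simp only [potential, hσ, hτ, htop, Prod.Lex.toLex_lt_toLex, lt_self_iff_false, true_and,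
      false_or]
    have hsub : τ.inner ⊆ σ.inner := by rw [hinner]; exact Finset.erase_subset _ _
    obtain hlt | heq := (firstIdx_mono (B.order τ.top) hsub).lt_or_eq
    · exact Or.inl hlt
    · refine Or.inr ⟨heq, ?_⟩
      rw [hinner] at heq ⊢
      refine togglePotential_erase_lt hx heq fun htog => hf ?_
      refine B.matching_iff.2 ⟨htop, Or.inl ?_⟩
      refine (bhMatched_iff (hB _) (B.isChain_order _)).2
        ⟨Finset.nonempty_iff_ne_empty.2 h0, x, ?_, ?_, ?_⟩
      · rw [hinner, heq]
        exact htog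
      · rw [hinner]
        exact Finset.notMem_erase _ _
      · rw [hinner, Finset.insert_erase hx]

/-- The Babson–Hersh matching of the cells is acyclic. -/
theorem isAcyclicMatching [Nontrivial k] (hA : IsHPA k S) : IsAcyclicMatching B.matching where
  facet := by
    intro σ τ h
    obtain ⟨a, b, σ, τ, rfl, rfl, htop⟩ := B.exists_of_matching h
    obtain ⟨-, h | ⟨h, h'⟩⟩ := B.matching_iff.1 h
    · obtain ⟨hne, x, hx, hxt, hs⟩ := (bhMatched_iff (hB _) (B.isChain_order _)).1 h
      have hxσ : x ∈ σ.inner := by rw [hs]; exact Finset.mem_insert_self _ _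
      exact ⟨Facet.internal x σ τ hxσ
        (Cell.inner_erase htop (by rw [hs, Finset.erase_insert hxt]) hxσ)⟩
    · have hxσ : B.base τ.top ∈ σ.inner := by rw [h]; exact Finset.mem_singleton_self _
      exact ⟨Facet.internal _ σ τ hxσ
        (Cell.inner_erase htop (by rw [h, h', Finset.erase_singleton]) hxσ)⟩
  down_unique := by
    intro σ τ τ' h h'
    obtain ⟨a, b, σ, τ, rfl, rfl, htop⟩ := B.exists_of_matching h
    obtain ⟨a, b, σ, τ', hσ, rfl, htop'⟩ := B.exists_of_matching h'
    cases hσ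
    have htt : τ.top = τ'.top := htop.symm.trans htop'
    suffices τ.inner = τ'.inner by rw [Cell.ext_inner htt this]
    obtain ⟨-, h⟩ := B.matching_iff.1 h
    obtain ⟨-, h'⟩ := B.matching_iff.1 h'
    rw [← htt] at h'
    -- The base point is unmatched in the order complex, so a cell cannot be the upper member of
    -- pairs of both sorts.
    have key : ∀ {τ τ' : Cell k S a b}, σ.top = τ.top →
        BHMatched (B.order τ.top) σ.inner τ'.inner → ¬ σ.inner = {B.base τ.top} := by
      intro τ τ' htop h h'
      have hx : B.base τ.top ∈ σ.inner := by rw [h']; exact Finset.mem_singleton_self _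
      have hx' := σ.inner_subset hx
      rw [htop] at hx'
      rw [h'] at h
      exact (B.base_unmatched_of_mem hx' _).2 h
    obtain h | ⟨h, h0⟩ := h <;> obtain h' | ⟨h', h0'⟩ := h'
    · obtain ⟨hne, x, hx, hxt, hs⟩ := (bhMatched_iff (hB _) (B.isChain_order _)).1 h
      obtain ⟨hne', x', hx', hxt', hs'⟩ := (bhMatched_iff (hB _) (B.isChain_order _)).1 h'
      have e1 := hx.firstIdx_insert
      have e2 := hx'.firstIdx_insert
      rw [← hs] at e1
      rw [← hs', e1] at e2
      rw [← e2] at hx'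
      obtain rfl := hx.unique hx'
      rw [← Finset.erase_insert hxt, ← Finset.erase_insert hxt', ← hs, ← hs']
    · exact (key htop h h').elim
    · exact (key htop h' h).elim
    · rw [h0, h0']
  up_unique := by
    intro σ σ' τ h h'
    obtain ⟨a, b, σ, τ, rfl, rfl, htop⟩ := B.exists_of_matching h
    obtain ⟨a, b, σ', τ, rfl, hτ, htop'⟩ := B.exists_of_matching h'
    cases hτ
    suffices σ.inner = σ'.inner by rw [Cell.ext_inner (htop.trans htop'.symm) this]
    obtain ⟨-, h⟩ := B.matching_iff.1 h
    obtain ⟨-, h'⟩ := B.matching_iff.1 h'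
    obtain h | ⟨h, h0⟩ := h <;> obtain h' | ⟨h', h0'⟩ := h'
    · obtain ⟨hne, x, hx, hxt, hs⟩ := (bhMatched_iff (hB _) (B.isChain_order _)).1 h
      obtain ⟨hne', x', hx', hxt', hs'⟩ := (bhMatched_iff (hB _) (B.isChain_order _)).1 h'
      rw [hs, hs', hx.unique hx']
    · exact (h.1.ne_empty h0').elim
    · exact (h'.1.ne_empty h0).elim
    · rw [h, h']
  not_both := by
    intro ρ σ τ h h'
    obtain ⟨a, b, ρ, σ, rfl, rfl, htop⟩ := B.exists_of_matching h
    obtain ⟨a, b, σ, τ, hσ, rfl, htop'⟩ := B.exists_of_matching h'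
    cases hσ
    obtain ⟨-, h⟩ := B.matching_iff.1 h
    obtain ⟨-, h'⟩ := B.matching_iff.1 h'
    rw [← htop'] at h'
    have hne : σ.inner.Nonempty := by
      obtain h' | ⟨h', -⟩ := h'
      · obtain ⟨-, x, -, -, hs'⟩ := (bhMatched_iff (hB _) (B.isChain_order _)).1 h'
        rw [hs']
        exact Finset.insert_nonempty _ _
      · rw [h']
        exact Finset.singleton_nonempty _
    obtain h | ⟨h, h0⟩ := h
    swap
    · exact hne.ne_empty h0
    obtain ⟨y, hy⟩ := hne
    obtain ⟨hne, x, hx, hxt, hs⟩ := (bhMatched_iff (hB _) (B.isChain_order _)).1 h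
    obtain h' | ⟨h', -⟩ := h'
    · obtain ⟨hne', x', hx', hxt', hs'⟩ := (bhMatched_iff (hB _) (B.isChain_order _)).1 h'
      -- A chain obtained by adding its toggle keeps the first facet and hence the toggle, so it
      -- cannot be extended by the same element again.
      have e := hx'.firstIdx_insert
      rw [← hs'] at e
      rw [← e] at hx'
      obtain rfl := hx.unique hx'
      exact hxt (by rw [hs']; exact Finset.mem_insert_self _ _)
    · rw [h'] at h
      exact (B.base_unmatched_of_mem (σ.inner_subset hy) _).1 h
  acyclic := by
    have key : ∀ {σ τ}, Relation.TransGen (HasseArrow B.matching) σ τ →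
        potential B τ < potential B σ := by
      intro σ τ h
      have step : ∀ {σ τ}, HasseArrow B.matching σ τ → potential B τ < potential B σ := by
        rintro σ τ (⟨⟨f⟩, hf⟩ | h)
        · exact potential_lt_of_facet hB hA f hf
        · exact potential_lt_of_matching hB h
      induction h with
      | single h => exact step h
      | tail _ h ih => exact (step h).trans ih
    exact fun σ h => lt_irrefl _ (key h)

/-- The critical cells correspond to maximal chains of the open intervals. -/
theorem inner_mem_facets_of_isCritical {a b : V} {σ : Cell k S a b}
    (hσ : IsCritical B.matching ⟨a, b, σ⟩) :
    σ.inner ∈ facets (orderComplex σ.top.openInterval) ∨ σ.top.openInterval = ∅ := by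
  have hpts : ∀ x ∈ σ.top.openInterval, IsChain (· ≤ ·) (({x} : Finset _) : Set (PathsFrom k S a)) :=
    fun x _ => by simp
  obtain he | hne := σ.inner.eq_empty_or_nonempty
  · right
    -- A nonempty interval has a base point, and then `[e < p]` is matched with the cell of that
    -- point.
    by_contra hi
    have hb := B.base_mem σ.top (Set.nonempty_iff_ne_empty.2 hi)
    let τ := Cell.ofInner σ.top {B.base σ.top} (by simpa using hb) (hpts _ hb)
    exact (hσ ⟨a, b, τ⟩).2 (B.matching_iff.2 ⟨rfl, Or.inr ⟨Cell.inner_ofInner _ _ _ _, he⟩⟩)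
  left
  have hun : ∀ s, ¬ BHMatched (B.order σ.top) s σ.inner ∧
      ¬ BHMatched (B.order σ.top) σ.inner s := by
    intro s
    constructor
    · intro h
      obtain ⟨-, x, hx, hxt, hs⟩ := (bhMatched_iff (hB _) (B.isChain_order _)).1 h
      have hF : (B.order σ.top).getD (firstIdx (B.order σ.top) σ.inner) ∅ ∈ B.order σ.top := by
        rw [List.getD_eq_getElem _ _ hx.lt_length]
        exact List.getElem_mem _
      have hF' := ((B.isFacetOrder σ.top).2 _).1 hF
      have hsub : s ⊆ (B.order σ.top).getD (firstIdx (B.order σ.top) σ.inner) ∅ := by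
        rw [hs]
        exact Finset.insert_subset hx.mem (subset_getD_firstIdx hx.lt_length)
      let τ := Cell.ofInner σ.top s (fun y hy => hF'.1.2.1 (hsub hy))
        (hF'.1.2.2.mono (by exact_mod_cast hsub))
      refine (hσ ⟨a, b, τ⟩).2 (B.matching_iff.2 ⟨rfl, Or.inl ?_⟩)
      rw [Cell.inner_ofInner]
      exact h
    · intro h
      obtain ⟨-, x, hx, hxt, hs⟩ := (bhMatched_iff (hB _) (B.isChain_order _)).1 h
      have hsub : s ⊆ σ.inner := by rw [hs]; exact Finset.subset_insert _ _
      have hf := σ.inner_mem_faces hne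
      let τ := Cell.ofInner σ.top s (fun y hy => hf.2.1 (hsub hy))
        (hf.2.2.mono (by exact_mod_cast hsub))
      refine (hσ ⟨a, b, τ⟩).1 (B.matching_iff.2 ⟨rfl, Or.inl ?_⟩)
      rw [Cell.inner_ofInner]
      exact h
  obtain h | ⟨x, hx, htog⟩ := (hB σ.top).eq_facet_or_of_unmatched (B.isChain_order _) hne
    (B.firstIdx_lt σ hne) hun
  · exact ((B.isFacetOrder σ.top).2 _).1 h
  -- The chain left over is the least point `x` of the first facet. As the cell is critical, the
  -- base point differs from `x`. The base point is unmatched as well, so it must form a facet by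
  -- itself. By purity all facets are then points, and `{x}` is one of them.
  have hxi : x ∈ σ.top.openInterval := σ.inner_subset (by rw [hx]; exact Finset.mem_singleton_self x)
  have hb := B.base_mem σ.top ⟨x, hxi⟩
  have hbne : B.base σ.top ≠ x := by
    intro h
    let τ := Cell.ofInner σ.top ∅ (by simp) (by simp)
    exact (hσ ⟨a, b, τ⟩).1 (B.matching_iff.2 ⟨rfl, Or.inr ⟨by rw [hx, ← h]; rfl,
      Cell.inner_ofInner _ _ _ _⟩⟩)
  obtain ⟨F, hF, hle⟩ := exists_facet_of_mem_faces (Set.toFinite _) (singleton_mem_faces hb)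
  obtain h | ⟨y, hy, htog'⟩ := (hB σ.top).eq_facet_or_of_unmatched (B.isChain_order _)
    (Finset.singleton_nonempty (B.base σ.top))
    (firstIdx_lt_length (((B.isFacetOrder σ.top).2 F).2 hF) hle)
    (B.base_unmatched σ.top ⟨x, hxi⟩)
  · obtain ⟨F', hF', hle'⟩ := exists_facet_of_mem_faces (Set.toFinite _) (σ.inner_mem_faces hne)
    have hcard := (hB σ.top).1 _ (((B.isFacetOrder σ.top).2 F').2 hF') _ h
    have : σ.inner = F' := Finset.eq_of_subset_of_card_le hle' (by rw [hcard, hx]; simp)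
    rwa [this]
  · rw [htog.unique htog'] at hbne
    exact (hbne (Finset.singleton_injective hy)).elim

end BHChoice

end CellMatching

/-! ### Path lengths -/

section Length

variable {k : Type w} {V : Type u} [Quiver.{v} V] [CommRing k] [Fintype V] {S : PathRelations V}
  [AcyclicQuiver V]

variable (k S) in
/-- The facets of the order complex of every open interval have the same cardinality. -/
def IsPureAlgebra : Prop :=
  ∀ {a b : V} (p : PathClass k S a b), ∀ F ∈ facets (orderComplex p.openInterval),
    ∀ F' ∈ facets (orderComplex p.openInterval), F.card = F'.card

/-- A cell is saturated if its vertices form a maximal chain below its top. -/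
def Cell.IsSaturated {a b : V} (σ : Cell k S a b) : Prop :=
  ∀ y ≤ σ.top.toPoset, (∀ z ∈ σ.verts, y ≤ z ∨ z ≤ y) → y ∈ σ.verts

theorem Cell.IsSaturated.inner_mem_facets {a b : V} {σ : Cell k S a b} (h : σ.IsSaturated) :
    σ.inner ∈ facets (orderComplex σ.top.openInterval) ∨ σ.top.openInterval = ∅ := by
  have key : ∀ y ∈ σ.top.openInterval, (∀ z ∈ σ.inner, y ≤ z ∨ z ≤ y) → y ∈ σ.inner := by
    intro y hy hz
    refine Facet.mem_inner.2 ⟨hy.2.ne, hy.1.ne', h y hy.2.le fun z hz' => ?_⟩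
    by_cases h1 : z = σ.top.toPoset
    · exact Or.inl (h1 ▸ hy.2.le)
    by_cases h2 : z = ⊥
    · exact Or.inr (h2 ▸ bot_le)
    exact hz z (Facet.mem_inner.2 ⟨h1, h2, hz'⟩)
  obtain he | hne := σ.inner.eq_empty_or_nonempty
  · right
    rw [Set.eq_empty_iff_forall_notMem]
    intro y hy
    have := key y hy (by rw [he]; simp)
    rw [he] at this
    exact Finset.notMem_empty _ this
  · left
    refine ⟨σ.inner_mem_faces hne, fun t ht hle y hy => key y (ht.2.1 hy) fun z hz => ?_⟩
    exact ht.2.2.total hy (hle hz)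

/-- Purity settles nonempty intervals. The separate alternative is needed because the order complex
has no empty face; it covers trivial and irreducible tops. -/
theorem Cell.dim_eq_of_facets (hp : IsPureAlgebra k S) {a b : V} {σ τ : Cell k S a b}
    (htop : σ.top = τ.top)
    (hσ : σ.inner ∈ facets (orderComplex σ.top.openInterval) ∨ σ.top.openInterval = ∅)
    (hτ : τ.inner ∈ facets (orderComplex τ.top.openInterval) ∨ τ.top.openInterval = ∅) :
    σ.dim = τ.dim := by
  by_cases hab : a = b
  · subst hab
    have h0 : ∀ σ : Cell k S a a, σ.verts = {⊥} := by
      intro σ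
      ext x
      rw [Finset.mem_singleton]
      refine ⟨fun hx => ?_, fun hx => hx ▸ σ.bot_mem⟩
      have := σ.le_top hx
      rw [PathClass.eq_id σ.top, PathClass.toPoset_id, le_bot_iff] at this
      exact this
    rw [Cell.dim, Cell.dim, h0, h0]
  rw [σ.dim_eq_card_inner hab, τ.dim_eq_card_inner hab]
  rw [← htop] at hτ
  have h0 : ∀ ρ : Cell k S a b, ρ.top = σ.top → σ.top.openInterval = ∅ → ρ.inner = ∅ := by
    intro ρ h h'
    rw [Finset.eq_empty_iff_forall_notMem]
    intro x hx
    have := ρ.inner_subset hx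
    rw [h, h'] at this
    exact this
  have h1 : ∀ ρ : Cell k S a b, ρ.inner ∈ facets (orderComplex σ.top.openInterval) →
      σ.top.openInterval ≠ ∅ := by
    intro ρ h h'
    obtain ⟨x, hx⟩ := h.1.1
    have := h.1.2.1 hx
    rw [h'] at this
    exact this
  obtain hσ | hσ := hσ <;> obtain hτ | hτ := hτ
  · rw [hp _ _ hσ _ hτ]
  · exact (h1 _ hσ hτ).elim
  · exact (h1 _ hτ hσ).elim
  · rw [h0 σ rfl hσ, h0 τ htop.symm hτ]

/-- By left cancellation, `lcomp p` identifies the interval from `⊥` to `r` with the interval from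
`p` to `p r`. -/
theorem covBy_comp_iff [Nontrivial k] (hA : IsHPA k S) {a b c : V} (p : PathClass k S a b)
    (r : PathClass k S b c) : p.toPoset ⋖ (p.comp r).toPoset ↔ r.IsIrreducible := by
  constructor
  · intro h
    refine ⟨?_, fun q h1 h2 => ?_⟩
    · rw [← PathsFrom.lcomp_lt_lcomp hA p, PathsFrom.lcomp_bot]
      exact h.1
    · refine h.2 (c := PathsFrom.lcomp p q) ?_ ?_
      · rw [← PathsFrom.lcomp_bot p]
        exact (PathsFrom.lcomp_lt_lcomp hA p).2 h1
      · exact (PathsFrom.lcomp_lt_lcomp hA p).2 h2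
  · intro h
    refine ⟨?_, fun q h1 h2 => ?_⟩
    · have := (PathsFrom.lcomp_lt_lcomp hA p).2 h.1
      rwa [PathsFrom.lcomp_bot] at this
    · obtain ⟨q', rfl⟩ := PathsFrom.exists_lcomp h1.le
      rw [← PathsFrom.lcomp_bot p] at h1
      exact h.2 ((PathsFrom.lcomp_lt_lcomp hA p).1 h1) ((PathsFrom.lcomp_lt_lcomp hA p).1 h2)

namespace PathClass

/-- Descending along covers in the finite path poset splits off one irreducible right factor at a
time. -/
theorem exists_hasLength [Nontrivial k] (hA : IsHPA k S) [∀ a b : V, Finite (a ⟶ b)] {a b : V}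
    (p : PathClass k S a b) : ∃ n, p.HasLength n := by
  have key : ∀ q : PathsFrom k S a, ∃ n, q.path.HasLength n := by
    intro q
    induction q using WellFoundedLT.induction with
    | _ q ih =>
      by_cases hq : q = ⊥
      · subst hq
        exact ⟨0, HasLength.id a⟩
      · obtain ⟨q', hcov⟩ := exists_covBy_of_wellFoundedGT (a := q) fun h => hq h.eq_bot
        obtain ⟨n, hn⟩ := ih q' hcov.1
        obtain ⟨c, q⟩ := q
        obtain ⟨b, q'⟩ := q'
        obtain ⟨r, hr⟩ : ∃ r : PathClass k S b c, q = q'.comp r := hcov.1.le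
        subst hr
        exact ⟨n + 1, HasLength.comp hn ((covBy_comp_iff hA q' r).1 hcov)⟩
  exact key p.toPoset

/-- The partial products of a factorization into irreducible paths form a chain of covers, so
nothing can be inserted. -/
theorem HasLength.exists_saturated [Nontrivial k] (hA : IsHPA k S) {a b : V}
    {p : PathClass k S a b} {n : ℕ} (hp : p.HasLength n) :
    ∃ σ : Cell k S a b, σ.top = p ∧ σ.dim = n ∧ σ.IsSaturated := by
  classical
  induction hp with
  | id =>
    refine ⟨Cell.vertex a, rfl, rfl, fun y hy _ => ?_⟩
    have : y = ⊥ := le_bot_iff.1 hy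
    rw [this]
    exact Cell.bot_mem _
  | @comp b c p n r hp hr ih =>
    obtain ⟨σ, rfl, hdim, hsat⟩ := ih
    have hcov := (covBy_comp_iff hA σ.top r).2 hr
    have hnot : (σ.top.comp r).toPoset ∉ σ.verts := fun h =>
      (σ.le_top h).not_gt hcov.1
    let τ : Cell k S a c :=
      { top := σ.top.comp r
        verts := insert (σ.top.comp r).toPoset σ.verts
        chain := by
          rw [Finset.coe_insert]
          exact σ.chain.insert fun x hx _ => Or.inr ((σ.le_top hx).trans hcov.1.le)
        bot_mem := Finset.mem_insert_of_mem σ.bot_mem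
        isGreatest := by
          refine ⟨Finset.mem_insert_self _ _, fun x hx => ?_⟩
          obtain rfl | hx := Finset.mem_insert.1 hx
          · exact le_rfl
          · exact (σ.le_top hx).trans hcov.1.le }
    refine ⟨τ, rfl, ?_, ?_⟩
    · have h1 := τ.card_verts
      have h2 := σ.card_verts
      have h3 : τ.verts.card = σ.verts.card + 1 := Finset.card_insert_of_notMem hnot
      omega
    · intro y hy hz
      have hyz : ∀ z ∈ σ.verts, y ≤ z ∨ z ≤ y := fun z hz' => hz z (Finset.mem_insert_of_mem hz')
      obtain h | h := hyz _ σ.top_mem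
      · exact Finset.mem_insert_of_mem (hsat y h hyz)
      · obtain h' | h' := hcov.eq_or_eq h hy
        · rw [h']
          exact Finset.mem_insert_of_mem σ.top_mem
        · rw [h']
          exact Finset.mem_insert_self _ _

theorem HasLength.unique [Nontrivial k] (hA : IsHPA k S) (hpure : IsPureAlgebra k S) {a b : V}
    {p : PathClass k S a b} {m n : ℕ} (hm : p.HasLength m) (hn : p.HasLength n) : m = n := by
  obtain ⟨σ, hσ, rfl, hσ'⟩ := hm.exists_saturated hA
  obtain ⟨τ, hτ, rfl, hτ'⟩ := hn.exists_saturated hA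
  exact Cell.dim_eq_of_facets hpure (hσ.trans hτ.symm) hσ'.inner_mem_facets hτ'.inner_mem_facets

theorem HasLength.mul {a b c : V} {p : PathClass k S a b} {q : PathClass k S b c} {m n : ℕ}
    (hp : p.HasLength m) (hq : q.HasLength n) : (p.comp q).HasLength (m + n) := by
  induction hq with
  | id => rwa [comp_id]
  | comp hq hr ih =>
    rw [← comp_assoc]
    exact ih.comp hr

theorem HasLength.eq_of_zero {a b : V} {p : PathClass k S a b} {n : ℕ} (hp : p.HasLength n)
    (hn : n = 0) : a = b := by
  cases hp with
  | id => rfl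
  | comp hp hr => omega

end PathClass

/-- Compare the cell with the saturated cell of any factorization of its top; purity equates the two
dimensions. -/
theorem Cell.hasLength_top [Nontrivial k] (hA : IsHPA k S) (hpure : IsPureAlgebra k S)
    [∀ a b : V, Finite (a ⟶ b)] {a b : V} (σ : Cell k S a b)
    (hσ : σ.inner ∈ facets (orderComplex σ.top.openInterval) ∨ σ.top.openInterval = ∅) :
    σ.top.HasLength σ.dim := by
  obtain ⟨n, hn⟩ := σ.top.exists_hasLength hA
  obtain ⟨τ, hτ, rfl, hτ'⟩ := hn.exists_saturated hA
  rw [Cell.dim_eq_of_facets hpure hτ.symm hσ hτ'.inner_mem_facets]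
  exact hn

theorem isPureAlgebra_of_isShellable
    (h : ∀ (a b : V) (p : PathClass k S a b), IsShellable (orderComplex p.openInterval)) :
    IsPureAlgebra k S := by
  intro a b p F hF F' hF'
  obtain ⟨L, hL, hs⟩ := h a b p
  exact hs.1 F ((hL.2 F).2 hF) F' ((hL.2 F').2 hF')

theorem exists_bhChoice [∀ a b : V, Finite (a ⟶ b)]
    (h : ∀ (a b : V) (p : PathClass k S a b), IsShellable (orderComplex p.openInterval)) :
    ∃ B : BHChoice k S, B.IsShelling := by
  classical
  choose L hL hs using h
  have hb : ∀ (a b : V) (p : PathClass k S a b), ∃ x : PathsFrom k S a, p.openInterval.Nonempty →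
      x ∈ p.openInterval ∧ ∀ s, ¬ BHMatched (L a b p) s {x} ∧ ¬ BHMatched (L a b p) {x} s := by
    intro a b p
    by_cases hne : p.openInterval.Nonempty
    · obtain ⟨x, hx, hx'⟩ := exists_unmatched_point (Set.toFinite _) hne (hL a b p) (hs a b p)
      exact ⟨x, fun _ => ⟨hx, hx'⟩⟩
    · exact ⟨⊥, fun h => (hne h).elim⟩
  choose x hx using hb
  exact ⟨{ order := fun {a b} p => L a b p
           isFacetOrder := fun {a b} p => hL a b p
           base := fun {a b} p => x a b p
           base_mem := fun {a b} p h => (hx a b p h).1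
           base_unmatched := fun {a b} p h => (hx a b p h).2 }, fun {a b} p => hs a b p⟩

end Length

/-! ### The length grading -/

/-- A family of subgroups is an internal direct sum if it has a family of projections. -/
theorem isInternal_of_projections {ι P : Type*} [DecidableEq ι] [AddCommGroup P]
    (G : ι → AddSubgroup P) (π : ι → P →+ P) (h1 : ∀ j x, π j x ∈ G j)
    (h2 : ∀ i j, ∀ x ∈ G i, π j x = if j = i then x else 0)
    (h3 : ∀ x, ∃ s : Finset ι, ∑ i ∈ s, π i x = x) : DirectSum.IsInternal G := by
  constructor
  · rw [injective_iff_map_eq_zero]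
    intro f hf
    have key : ∀ (j : ι) (f : DirectSum ι fun i => G i),
        π j (DirectSum.coeAddMonoidHom G f) = f j := by
      intro j f
      induction f using DirectSum.induction_on with
      | zero => simp
      | of i x =>
        rw [DirectSum.coeAddMonoidHom_of, h2 i j x x.2]
        by_cases h : j = i
        · subst h
          rw [if_pos rfl, DirectSum.of_eq_same]
        · rw [if_neg h, DirectSum.of_eq_of_ne _ _ _ h]
          rfl
      | add f g hf hg => rw [map_add, map_add, hf, hg]; rfl
    refine DFinsupp.ext fun j => Subtype.ext ?_
    have := key j f
    change DirectSum.coeAddMonoidHom G f = 0 at hf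
    rw [hf, map_zero] at this
    exact this.symm
  · intro x
    obtain ⟨s, hs⟩ := h3 x
    refine ⟨∑ i ∈ s, DirectSum.of (fun i => G i) i ⟨π i x, h1 i x⟩, ?_⟩
    change DirectSum.coeAddMonoidHom G _ = x
    rw [map_sum]
    simp only [DirectSum.coeAddMonoidHom_of]
    exact hs

section Grading

variable {k : Type w} {V : Type u} [Quiver.{v} V] [CommRing k] [Fintype V] {S : PathRelations V}
  [AcyclicQuiver V]

theorem toAlg_mem_lengthGrading {a b : V} {p : PathClass k S a b} {n : ℕ} (hp : p.HasLength n) :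
    p.toAlg ∈ lengthGrading k S n := Submodule.subset_span ⟨a, b, p, hp, rfl⟩

theorem one_mem_lengthGrading : (1 : QuiverAlgebra k S) ∈ lengthGrading k S 0 := by
  rw [← PathClass.sum_id_toAlg]
  exact Submodule.sum_mem _ fun a _ => toAlg_mem_lengthGrading (PathClass.HasLength.id a)

theorem mul_mem_lengthGrading {m n : ℕ} {x y : QuiverAlgebra k S} (hx : x ∈ lengthGrading k S m)
    (hy : y ∈ lengthGrading k S n) : x * y ∈ lengthGrading k S (m + n) := by
  induction hx using Submodule.span_induction with
  | zero => rw [zero_mul]; exact zero_mem _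
  | add x x' _ _ hx hx' => rw [add_mul]; exact add_mem hx hx'
  | smul r x _ hx => rw [smul_mul_assoc]; exact Submodule.smul_mem _ _ hx
  | mem x hx =>
    obtain ⟨a, b, p, hp, rfl⟩ := hx
    induction hy using Submodule.span_induction with
    | zero => rw [mul_zero]; exact zero_mem _
    | add y y' _ _ hy hy' => rw [mul_add]; exact add_mem hy hy'
    | smul r y _ hy => rw [mul_smul_comm]; exact Submodule.smul_mem _ _ hy
    | mem y hy =>
      obtain ⟨c, d, q, hq, rfl⟩ := hy
      by_cases h : b = c
      · subst h
        rw [PathClass.toAlg_mul]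
        exact toAlg_mem_lengthGrading (hp.mul hq)
      · rw [PathClass.toAlg_mul_of_ne _ _ h]
        exact zero_mem _

variable [Nontrivial k] [∀ a b : V, Finite (a ⟶ b)] (hA : IsHPA k S)

/-- A length of a path. -/
def pathLength {a b : V} (p : PathClass k S a b) : ℕ := (p.exists_hasLength hA).choose

theorem hasLength_pathLength {a b : V} (p : PathClass k S a b) :
    p.HasLength (pathLength hA p) := (p.exists_hasLength hA).choose_spec

/-- The projection onto the component of degree `n`. -/
def lengthProj (n : ℕ) : QuiverAlgebra k S →ₗ[k] QuiverAlgebra k S :=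
  pathBasis.constr k fun p => if n = pathLength hA p.2.2 then p.2.2.toAlg else 0

theorem lengthProj_toAlg (n : ℕ) {a b : V} (p : PathClass k S a b) :
    lengthProj hA n p.toAlg = if n = pathLength hA p then p.toAlg else 0 := by
  rw [← pathBasis_mk, lengthProj, Module.Basis.constr_basis, pathBasis_mk]

theorem lengthProj_mem (n : ℕ) (x : QuiverAlgebra k S) :
    lengthProj hA n x ∈ lengthGrading k S n := by
  induction x using quiverAlgebra_induction with
  | zero => rw [map_zero]; exact zero_mem _
  | add x y hx hy => rw [map_add]; exact add_mem hx hy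
  | smul r p =>
    rw [map_smul, lengthProj_toAlg]
    refine Submodule.smul_mem _ _ ?_
    split_ifs with h
    · rw [h]
      exact toAlg_mem_lengthGrading (hasLength_pathLength hA p)
    · exact zero_mem _

/-- The projection was defined through one chosen length for each path. Purity makes lengths unique,
so the choice agrees with the degree of `x`. -/
theorem lengthProj_of_mem (hp : IsPureAlgebra k S) {m n : ℕ} {x : QuiverAlgebra k S}
    (hx : x ∈ lengthGrading k S m) : lengthProj hA n x = if n = m then x else 0 := by
  induction hx using Submodule.span_induction with
  | zero => rw [map_zero, ite_self]
  | add x y _ _ hx hy => rw [map_add, hx, hy]; split_ifs <;> simp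
  | smul r x _ hx => rw [map_smul, hx]; split_ifs <;> simp
  | mem x hx =>
    obtain ⟨a, b, p, hp', rfl⟩ := hx
    rw [lengthProj_toAlg, (hasLength_pathLength hA p).unique hA hp hp']

theorem lengthProj_mul_id (n : ℕ) (x : QuiverAlgebra k S) (a : V) :
    lengthProj hA n (x * (PathClass.id a).toAlg) = lengthProj hA n x * (PathClass.id a).toAlg := by
  induction x using quiverAlgebra_induction with
  | zero => rw [zero_mul, map_zero, zero_mul]
  | add x y hx hy => rw [add_mul, map_add, hx, hy, map_add, add_mul]
  | @smul r b c p =>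
    rw [smul_mul_assoc, map_smul, map_smul, smul_mul_assoc, lengthProj_toAlg]
    congr 1
    by_cases h : c = a
    · subst h
      rw [PathClass.toAlg_mul_id, lengthProj_toAlg]
      split_ifs
      · rw [PathClass.toAlg_mul_id]
      · rw [zero_mul]
    · rw [PathClass.toAlg_mul_of_ne _ _ h, map_zero]
      split_ifs
      · rw [PathClass.toAlg_mul_of_ne _ _ h]
      · rw [zero_mul]

/-- There are finitely many path classes, so one bound on the lengths serves for all elements. -/
theorem exists_lengthProj_sum :
    ∃ N, ∀ x : QuiverAlgebra k S, ∑ i ∈ Finset.range N, lengthProj hA i x = x := by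
  have : Finite (AnyClass k S) := inferInstance
  obtain ⟨N, hN⟩ := (Set.finite_range fun p : AnyClass k S => pathLength hA p.2.2).bddAbove
  refine ⟨N + 1, fun x => ?_⟩
  induction x using quiverAlgebra_induction with
  | zero => simp
  | add x y hx hy => simp only [map_add, Finset.sum_add_distrib, hx, hy]
  | @smul r a b p =>
    simp only [map_smul, ← Finset.smul_sum, lengthProj_toAlg]
    rw [Finset.sum_ite_eq' (Finset.range (N + 1)), if_pos]
    have : pathLength hA p ≤ N := hN ⟨⟨a, b, p⟩, rfl⟩
    exact Finset.mem_range.2 (by omega)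

include hA in
theorem nonempty_gradedAlgebra (hp : IsPureAlgebra k S) :
    Nonempty (GradedAlgebra (lengthGrading k S)) := by
  have hint : DirectSum.IsInternal fun n => (lengthGrading k S n).toAddSubgroup := by
    refine isInternal_of_projections _ (fun n => (lengthProj hA n).toAddMonoidHom)
      (fun n x => lengthProj_mem hA n x) (fun i j x hx => lengthProj_of_mem hA hp hx) fun x => ?_
    obtain ⟨N, hN⟩ := exists_lengthProj_sum hA
    exact ⟨_, hN x⟩
  have hint' : DirectSum.IsInternal (lengthGrading k S) := hint
  exact ⟨{ one_mem := one_mem_lengthGrading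
           mul_mem := fun _ _ _ _ => mul_mem_lengthGrading
           toDecomposition := hint'.chooseDecomposition }⟩

end Grading

/-! ### Weights of gradient paths -/

section Weights

variable {k : Type w} {V : Type u} [Quiver.{v} V] [CommRing k] [Fintype V] {S : PathRelations V}
  [AcyclicQuiver V] {M : CellMatching k S}

/-- The element `u ⊗ w` of the enveloping algebra, for a factorization of the top path of `σ` into
`u`, the top path of `η`, and `w`. -/
def IsFactorWeight (σ η : AnyCell k S) (z : Env k S) : Prop :=
  ∃ (u : PathClass k S σ.1 η.1) (w : PathClass k S η.2.1 σ.2.1),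
    (u.comp η.2.2.top).comp w = σ.2.2.top ∧ z = u.toAlg ⊗ₜ[k] MulOpposite.op w.toAlg

theorem Facet.isFactorWeight {σ τ : AnyCell k S} (f : Facet σ τ) :
    IsFactorWeight σ τ (idem k S σ.1 σ.2.1 * (f.left ⊗ₜ[k] MulOpposite.op f.right)) := by
  cases f with
  | @initial a b c r hr σ τ h =>
    refine ⟨r, PathClass.id c, ?_, ?_⟩
    · rw [PathClass.comp_id]
      exact (Facet.initial_top (by rw [h]; simp [Cell.cons]; rfl)).symm
    · simp only [left, right, idem, Algebra.TensorProduct.tmul_mul_tmul]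
      rw [PathClass.id_mul_toAlg, MulOpposite.op_one, mul_one]
  | @internal a b x σ τ hx h =>
    refine ⟨PathClass.id a, PathClass.id b, ?_, ?_⟩
    · rw [PathClass.comp_id, PathClass.id_comp]
      exact (Facet.internal_top hx h).symm
    · simp only [left, right, MulOpposite.op_one, idem]
      rw [← Algebra.TensorProduct.one_def, mul_one]
  | @terminal a b c r hr σ τ h htop =>
    refine ⟨PathClass.id a, r, ?_, ?_⟩
    · rw [PathClass.id_comp]
      exact htop.symm
    · simp only [left, right, idem, Algebra.TensorProduct.tmul_mul_tmul]
      rw [← MulOpposite.op_mul, PathClass.toAlg_mul_id, mul_one]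

/-- An upward step keeps the top path and contributes no coefficient. The factorizations given by
the downward steps can therefore be nested, left factors multiplying on the left and right factors
on the right. -/
theorem GradientPath.isFactorWeight (hv : IsVertical M) {σ η : AnyCell k S}
    (γ : GradientPath M σ η) :
    IsFactorWeight σ η (idem k S σ.1 σ.2.1 * (γ.left ⊗ₜ[k] MulOpposite.op γ.right)) := by
  induction γ with
  | last f hf => exact f.isFactorWeight
  | @step σ τ σ' η f hf g hg γ ih =>
    obtain ⟨a, b, σ', τ', htop, rfl, rfl⟩ := hv _ _ hg
    obtain ⟨u, w, huw, hz⟩ := f.isFactorWeight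
    obtain ⟨u', w', huw', hz'⟩ := ih
    refine ⟨u.comp u', w'.comp w, ?_, ?_⟩
    · rw [← huw]
      change _ = (u.comp τ'.top).comp w
      rw [← htop]
      have h1 : (u'.comp η.2.2.top).comp w' = σ'.top := huw'
      rw [← h1]
      simp only [PathClass.comp_assoc]
    · have h1 : idem k S σ.1 σ.2.1 * ((f.left * γ.left) ⊗ₜ[k] MulOpposite.op (γ.right * f.right)) =
          (idem k S σ.1 σ.2.1 * (f.left ⊗ₜ[k] MulOpposite.op f.right)) *
            (γ.left ⊗ₜ[k] MulOpposite.op γ.right) := by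
        rw [mul_assoc, Algebra.TensorProduct.tmul_mul_tmul, MulOpposite.op_mul]
      change idem k S σ.1 σ.2.1 *
        ((f.left * γ.left) ⊗ₜ[k] MulOpposite.op (γ.right * f.right)) = _
      have h2 : (u.toAlg ⊗ₜ[k] MulOpposite.op w.toAlg : Env k S) * idem k S a b =
          u.toAlg ⊗ₜ[k] MulOpposite.op w.toAlg := by
        rw [idem, Algebra.TensorProduct.tmul_mul_tmul, ← MulOpposite.op_mul,
          PathClass.id_mul_toAlg, PathClass.toAlg_mul_id]
      rw [h1, hz, ← h2, mul_assoc]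
      change _ * (idem k S a b * (γ.left ⊗ₜ[k] MulOpposite.op γ.right)) = _
      have hz'' : idem k S a b * (γ.left ⊗ₜ[k] MulOpposite.op γ.right) =
        u'.toAlg ⊗ₜ[k] MulOpposite.op w'.toAlg := hz'
      rw [hz'', Algebra.TensorProduct.tmul_mul_tmul, ← MulOpposite.op_mul, PathClass.toAlg_mul,
        PathClass.toAlg_mul]

variable [∀ a b : V, Finite (a ⟶ b)]

/-- The entries of the Morse differential are combinations of weights. -/
theorem idem_mul_morseCoeff_mem (hM : IsAcyclicMatching M)
    (hv : IsVertical M) (σ η : AnyCell k S) {N : AddSubgroup (Env k S)}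
    (hN : ∀ z, IsFactorWeight σ η z → z ∈ N) :
    idem k S σ.1 σ.2.1 * morseCoeff M σ η ∈ N := by
  have hfin := hM.finite_gradientPath σ η
  rw [morseCoeff, mul_finsum' _ _ (Set.toFinite _)]
  have := Fintype.ofFinite (GradientPath M σ η)
  rw [finsum_eq_sum_of_fintype]
  refine AddSubgroup.sum_mem _ fun γ _ => ?_
  rw [mul_smul_comm]
  exact AddSubgroup.zsmul_mem _ (hN _ (γ.isFactorWeight hv)) _

theorem IsFactorWeight.mul_idem {σ η : AnyCell k S} {z : Env k S} (hz : IsFactorWeight σ η z) :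
    z * idem k S η.1 η.2.1 = z := by
  obtain ⟨u, w, -, rfl⟩ := hz
  rw [idem, Algebra.TensorProduct.tmul_mul_tmul, ← MulOpposite.op_mul,
    PathClass.id_mul_toAlg, PathClass.toAlg_mul_id]

theorem idem_mul_morseMatrix_mem (hM : IsAcyclicMatching M)
    (hv : IsVertical M) (σ η : AnyCell k S) {N : AddSubgroup (Env k S)}
    (hN : IsCritical M σ → IsCritical M η → ∀ z, IsFactorWeight σ η z → z ∈ N) :
    idem k S σ.1 σ.2.1 * morseMatrix M σ η ∈ N := by
  rw [morseMatrix]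
  split_ifs with h
  · rw [← mul_assoc]
    exact idem_mul_morseCoeff_mem hM hv σ η
      (N := N.comap (AddMonoidHom.mulRight (idem k S η.1 η.2.1))) fun z hz => by
        rw [AddSubgroup.mem_comap]
        change z * idem k S η.1 η.2.1 ∈ N
        rw [hz.mul_idem]
        exact hN h.1 h.2 z hz
  · rw [mul_zero]
    exact zero_mem _

theorem morseMatrix_mul_self [Nontrivial k] (hA : IsHPA k S) (hM : IsAcyclicMatching M)
    (hv : IsVertical M) : morseMatrix M * morseMatrix M = 0 := by
  obtain ⟨T, U, -, -, -, -, -, -, -, -, h⟩ := exists_morse_transfer hA hM hv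
  exact h

theorem morseMatrix_eq_zero [Nontrivial k] (hA : IsHPA k S) (hM : IsAcyclicMatching M)
    (hv : IsVertical M) {σ η : AnyCell k S} {n : ℕ} (hσ : σ.2.2.dim = n + 1) (hη : η.2.2.dim ≠ n) :
    morseMatrix M σ η = 0 := by
  obtain ⟨T, U, -, -, -, -, -, -, h, -, -⟩ := exists_morse_transfer hA hM hv
  have h1 := congrFun (congrFun (h n) σ) η
  rwa [dimMatrix_mul_apply, mul_dimMatrix_apply, if_pos hσ, if_neg hη] at h1

/-- If the tops of two critical cells have lengths equal to their dimensions, which are consecutive,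
the weights between them have one factor of length one and one trivial factor. -/
theorem IsFactorWeight.exists_length [Nontrivial k] (hA : IsHPA k S) (hp : IsPureAlgebra k S)
    {n : ℕ} {σ η : AnyCell k S} (hσ : σ.2.2.top.HasLength (n + 1)) (hη : η.2.2.top.HasLength n)
    {z : Env k S} (hz : IsFactorWeight σ η z) :
    ∃ (u : PathClass k S σ.1 η.1) (w : PathClass k S η.2.1 σ.2.1),
      z = u.toAlg ⊗ₜ[k] MulOpposite.op w.toAlg ∧
      ((u.HasLength 1 ∧ η.2.1 = σ.2.1) ∨ (w.HasLength 1 ∧ σ.1 = η.1)) := by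
  obtain ⟨u, w, huw, hz⟩ := hz
  refine ⟨u, w, hz, ?_⟩
  obtain ⟨i, hi⟩ := u.exists_hasLength hA
  obtain ⟨j, hj⟩ := w.exists_hasLength hA
  have h := (hi.mul hη).mul hj
  rw [huw] at h
  have h1 := h.unique hA hp hσ
  -- Lengths add up along the factorization: `i + n + j = n + 1`.
  obtain ⟨rfl, hj0⟩ | ⟨hi0, rfl⟩ : (i = 1 ∧ j = 0) ∨ (i = 0 ∧ j = 1) := by omega
  · exact Or.inl ⟨hi, hj.eq_of_zero hj0⟩
  · exact Or.inr ⟨hj, hi.eq_of_zero hi0⟩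

theorem PathClass.HasLength.ne [Nontrivial k] (hA : IsHPA k S) (hp : IsPureAlgebra k S)
    {a b : V} {p : PathClass k S a b} (h : p.HasLength 1) : a ≠ b := by
  rintro rfl
  rw [p.eq_id] at h
  exact absurd (h.unique hA hp (PathClass.HasLength.id a)) one_ne_zero

end Weights

/-! ### The Morse resolution of bimodules -/

section Bimodule

open scoped Classical

variable {k : Type w} {V : Type u} [Quiver.{v} V] [CommRing k] [Fintype V] {S : PathRelations V}
  [AcyclicQuiver V]

theorem mem_projBimod {a b : V} {x : Env k S} :
    x ∈ projBimod k S a b ↔ x * idem k S a b = x := by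
  rw [projBimod, Ideal.mem_span_singleton']
  constructor
  · rintro ⟨y, rfl⟩
    rw [mul_assoc, idem_mul_idem]
  · intro h
    exact ⟨x, h⟩

theorem projective_projBimod (a b : V) : Module.Projective (Env k S) (projBimod k S a b) := by
  refine Module.Projective.of_split (projBimod k S a b).subtype
    ((LinearMap.toSpanSingleton (Env k S) (Env k S) (idem k S a b)).codRestrict _ fun x => ?_) ?_
  · exact Ideal.mem_span_singleton'.2 ⟨x, rfl⟩
  · ext x
    exact mem_projBimod.1 x.2

variable [∀ a b : V, Finite (a ⟶ b)] (M : CellMatching k S)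

theorem changeRight_id (z : Env k S) :
    changeRight (AlgHom.id k (QuiverAlgebra k S)ᵐᵒᵖ) z = z := by
  have : changeRight (AlgHom.id k (QuiverAlgebra k S)ᵐᵒᵖ) = AlgHom.id k (Env k S) :=
    Algebra.TensorProduct.map_id
  rw [this]
  rfl

theorem refl_changeRight_id (z : Env k S) : (AlgEquiv.refl (R := k) (A₁ := Env k S))
    (changeRight (AlgHom.id k (QuiverAlgebra k S)ᵐᵒᵖ) z) = z := changeRight_id z

instance fintype_crit (n : ℕ) : Fintype (Crit M n) := Fintype.ofFinite _

variable {M}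

/-- The row vector of the components of an element of the Morse complex. -/
def morseVec {n : ℕ} (x : MorseModule M n) (σ : AnyCell k S) : Env k S :=
  if h : IsCritical M σ ∧ σ.2.2.dim = n then (x ⟨σ, h⟩).1 else 0

theorem morseVec_coe {n : ℕ} (x : MorseModule M n) (σ : Crit M n) :
    morseVec x σ.1 = (x σ).1 := dif_pos σ.2

theorem morseVec_mul_idem {n : ℕ} (x : MorseModule M n) (σ : AnyCell k S) :
    morseVec x σ * idem k S σ.1 σ.2.1 = morseVec x σ := by
  rw [morseVec]
  split_ifs with h
  · exact mem_projBimod.1 (x ⟨σ, h⟩).2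
  · rw [zero_mul]

theorem morseVec_eq_zero {n : ℕ} (x : MorseModule M n) {σ : AnyCell k S}
    (h : ¬ (IsCritical M σ ∧ σ.2.2.dim = n)) : morseVec x σ = 0 := dif_neg h

theorem morseVec_injective {n : ℕ} {x y : MorseModule M n} (h : morseVec x = morseVec y) :
    x = y := by
  refine DFinsupp.ext fun σ => Subtype.ext ?_
  have := congrFun h σ.1
  rwa [morseVec_coe, morseVec_coe] at this

theorem exists_morseVec {n : ℕ} {w : AnyCell k S → Env k S}
    (h1 : ∀ σ, w σ * idem k S σ.1 σ.2.1 = w σ)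
    (h2 : ∀ σ, ¬ (IsCritical M σ ∧ σ.2.2.dim = n) → w σ = 0) :
    ∃ x : MorseModule M n, morseVec x = w := by
  refine ⟨DirectSum.mk (fun η : Crit M n => projBimod k S η.1.1 η.1.2.1) Finset.univ
    fun η => ⟨w η.1.1, mem_projBimod.2 (h1 _)⟩, ?_⟩
  ext σ
  by_cases h : IsCritical M σ ∧ σ.2.2.dim = n
  · have := morseVec_coe (DirectSum.mk (fun η : Crit M n => projBimod k S η.1.1 η.1.2.1) Finset.univ
      fun η => ⟨w η.1.1, mem_projBimod.2 (h1 _)⟩) ⟨σ, h⟩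
    rw [this, DirectSum.mk_apply_of_mem (Finset.mem_univ _)]
  · rw [morseVec_eq_zero _ h, h2 σ h]

theorem morseVec_lof {n : ℕ} (σ : Crit M n) (y : projBimod k S σ.1.1 σ.1.2.1) (τ : AnyCell k S) :
    morseVec (DirectSum.lof (Env k S) (Crit M n) (fun η => projBimod k S η.1.1 η.1.2.1) σ y) τ =
      if σ.1 = τ then y.1 else 0 := by
  by_cases h : IsCritical M τ ∧ τ.2.2.dim = n
  · rw [morseVec, dif_pos h]
    by_cases hστ : σ.1 = τ
    · subst hστ
      rw [if_pos rfl, DirectSum.lof_apply]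
    · rw [if_neg hστ, DirectSum.lof_eq_of, DirectSum.of_eq_of_ne]
      · rfl
      · intro h'
        exact hστ (congrArg Subtype.val h').symm
  · rw [morseVec_eq_zero _ h, if_neg]
    rintro rfl
    exact h σ.2

theorem morseVec_add {n : ℕ} (x y : MorseModule M n) :
    morseVec (x + y) = morseVec x + morseVec y := by
  ext σ
  rw [Pi.add_apply, morseVec, morseVec, morseVec]
  split_ifs
  · rfl
  · rw [add_zero]

theorem morseVec_zero {n : ℕ} : morseVec (0 : MorseModule M n) = 0 := by
  ext σ
  rw [morseVec]
  split_ifs <;> rfl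

theorem morseVec_sum {n : ℕ} {ι : Type*} (s : Finset ι) (f : ι → MorseModule M n) :
    morseVec (∑ i ∈ s, f i) = ∑ i ∈ s, morseVec (f i) :=
  map_sum (⟨⟨morseVec, morseVec_zero⟩, morseVec_add⟩ : MorseModule M n →+ AnyCell k S → Env k S) f s

variable [Nontrivial k] (hA : IsHPA k S) (hM : IsAcyclicMatching M) (hv : IsVertical M)

theorem morseDiff_lof {n : ℕ} (σ : Crit M (n + 1)) (y : projBimod k S σ.1.1 σ.1.2.1) :
    morseDiff M n (DirectSum.lof (Env k S) (Crit M (n + 1))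
      (fun η => projBimod k S η.1.1 η.1.2.1) σ y) =
    ∑ η : Crit M n, DirectSum.lof (Env k S) (Crit M n) (fun η => projBimod k S η.1.1 η.1.2.1) η
      (projBimodMap k S σ.1.1 σ.1.2.1 η.1.1 η.1.2.1 (morseCoeff M σ.1 η.1) y) := by
  rw [morseDiff]
  refine (DirectSum.toModule_lof _ _ _).trans ?_
  rw [finsum_eq_sum_of_fintype, LinearMap.sum_apply]
  rfl

include hA hM hv

/-- This translates the bimodule complex into row vectors, where the transfer matrices apply.
Entries of `morseMatrix` towards cells outside dimension `n` vanish on these vectors. -/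
theorem morseVec_morseDiff {n : ℕ} (x : MorseModule M (n + 1)) :
    morseVec (morseDiff M n x) = Matrix.vecMul (morseVec x) (morseMatrix M) := by
  induction x using DirectSum.induction_on with
  | zero => rw [map_zero, morseVec_zero, morseVec_zero, Matrix.zero_vecMul]
  | add x y hx hy => rw [map_add, morseVec_add, hx, hy, morseVec_add, Matrix.add_vecMul]
  | of σ y =>
    have h1 := morseDiff_lof (M := M) σ y
    rw [DirectSum.lof_eq_of] at h1
    rw [h1, morseVec_sum]
    ext τ
    rw [Finset.sum_apply]
    simp only [morseVec_lof]
    have h2 : Matrix.vecMul (morseVec (DirectSum.of (fun η : Crit M (n + 1) =>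
        projBimod k S η.1.1 η.1.2.1) σ y)) (morseMatrix M) τ = y.1 * morseMatrix M σ.1 τ := by
      rw [Matrix.vecMul, dotProduct, Finset.sum_eq_single σ.1]
      · rw [← DirectSum.lof_eq_of (Env k S), morseVec_lof, if_pos rfl]
      · intro ρ _ hρ
        rw [← DirectSum.lof_eq_of (Env k S), morseVec_lof, if_neg hρ.symm, zero_mul]
      · simp
    rw [h2]
    by_cases h : IsCritical M τ ∧ τ.2.2.dim = n
    · rw [Finset.sum_eq_single ⟨τ, h⟩]
      · rw [if_pos rfl, morseMatrix, if_pos ⟨σ.2.1, h.1⟩]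
        rfl
      · intro η _ hη
        exact if_neg fun h' => hη (Subtype.ext h')
      · simp
    · rw [Finset.sum_eq_zero]
      · by_cases hτ : IsCritical M τ
        · rw [morseMatrix_eq_zero hA hM hv σ.2.2 fun h' => h ⟨hτ, h'⟩, mul_zero]
        · rw [morseMatrix, if_neg fun h' => hτ h'.2, mul_zero]
      · intro η _
        refine if_neg fun h' => h ?_
        rw [← h']
        exact η.2

theorem morseDiff_exact (n : ℕ) : Function.Exact (morseDiff M (n + 1)) (morseDiff M n) := by
  intro x
  constructor
  · intro hx
    have h3 : Matrix.vecMul (morseVec x) (morseMatrix M) = 0 := by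
      rw [← morseVec_morseDiff hA hM hv, hx, morseVec_zero]
    obtain ⟨w, hw1, hw2, hw3⟩ := morse_exact_succ hA hM hv (AlgHom.id k (QuiverAlgebra k S)ᵐᵒᵖ)
      (AlgEquiv.refl (R := k) (A₁ := Env k S)) (n := n) (x := morseVec x)
      (fun σ => by
        rw [refl_changeRight_id]
        exact morseVec_mul_idem x σ)
      (fun σ hσ => morseVec_eq_zero x hσ)
      (by simp only [refl_changeRight_id]; exact h3)
    simp only [refl_changeRight_id] at hw1 hw3
    obtain ⟨y, hy⟩ := exists_morseVec hw1 hw2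
    refine ⟨y, morseVec_injective ?_⟩
    rw [morseVec_morseDiff hA hM hv, hy]
    exact hw3
  · rintro ⟨y, rfl⟩
    apply morseVec_injective
    rw [morseVec_morseDiff hA hM hv, morseVec_morseDiff hA hM hv, Matrix.vecMul_vecMul,
      morseMatrix_mul_self hA hM hv, Matrix.vecMul_zero, morseVec_zero]

attribute [local instance] TensorProduct.Algebra.module

omit [∀ a b : V, Finite (a ⟶ b)] [Nontrivial k] hA hM hv in
theorem tmul_smul (x y z : QuiverAlgebra k S) :
    ((x ⊗ₜ[k] MulOpposite.op y : Env k S) • z) = x * z * y := by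
  rw [TensorProduct.Algebra.smul_def]
  simp [mul_assoc]

omit [Nontrivial k] hA hM hv in
theorem smul_one_eq (z : Env k S) : z • (1 : QuiverAlgebra k S) =
    (augTerm (AlgHom.id k (QuiverAlgebra k S)ᵐᵒᵖ) z).unop := by
  induction z using TensorProduct.induction_on with
  | zero => rw [zero_smul, map_zero, MulOpposite.unop_zero]
  | add x y hx hy => rw [add_smul, map_add, MulOpposite.unop_add, hx, hy]
  | tmul x y =>
    rw [augTerm_tmul]
    have := tmul_smul (k := k) (S := S) x y.unop 1
    rw [MulOpposite.op_unop] at this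
    rw [this, mul_one]
    rfl

omit [Nontrivial k] hA hM hv in
theorem morseAug_apply (x : MorseModule M 0) :
    morseAug M x = ∑ σ : AnyCell k S, morseVec x σ • (1 : QuiverAlgebra k S) := by
  induction x using DirectSum.induction_on with
  | zero => simp [morseVec_zero]
  | add x y hx hy =>
    rw [map_add, hx, hy, morseVec_add]
    simp only [Pi.add_apply, add_smul, Finset.sum_add_distrib]
  | of σ y =>
    have h1 : morseAug M (DirectSum.of (fun η : Crit M 0 => projBimod k S η.1.1 η.1.2.1) σ y) =
        y.1 • (1 : QuiverAlgebra k S) := DirectSum.toModule_lof _ _ _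
    rw [h1, Finset.sum_eq_single σ.1]
    · rw [← DirectSum.lof_eq_of (Env k S), morseVec_lof, if_pos rfl]
    · intro ρ _ hρ
      rw [← DirectSum.lof_eq_of (Env k S), morseVec_lof, if_neg hρ.symm, zero_smul]
    · simp

omit [Nontrivial k] hA hM hv in
theorem morseAug_eq (x : MorseModule M 0) :
    morseAug M x = ∑ a : V, morseVec x ⟨a, a, Cell.vertex a⟩ • (1 : QuiverAlgebra k S) := by
  rw [morseAug_apply]
  symm
  refine Fintype.sum_of_injective (fun a : V => (⟨a, a, Cell.vertex a⟩ : AnyCell k S))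
    (fun a b h => congrArg Sigma.fst h) _ _ (fun σ hσ => ?_) fun a => rfl
  rw [morseVec_eq_zero, zero_smul]
  rintro ⟨-, h⟩
  exact hσ ⟨σ.1, (σ.2.2.eq_vertex_of_dim_eq_zero h).symm⟩

theorem morseDiff_exact_zero : Function.Exact (morseDiff M 0) (morseAug M) := by
  have hsum : ∀ x : MorseModule M 0, morseAug M x =
      (∑ a : V, augTerm (AlgHom.id k (QuiverAlgebra k S)ᵐᵒᵖ)
        ((AlgEquiv.refl (R := k) (A₁ := Env k S)).symm
          (morseVec x ⟨a, a, Cell.vertex a⟩))).unop := by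
    intro x
    rw [morseAug_eq, Finset.unop_sum]
    exact Finset.sum_congr rfl fun a _ => smul_one_eq _
  intro x
  constructor
  · intro hx
    rw [hsum, MulOpposite.unop_eq_zero_iff] at hx
    obtain ⟨w, hw1, hw2, hw3⟩ := morse_exact_zero hA hM hv (AlgHom.id k (QuiverAlgebra k S)ᵐᵒᵖ)
      (AlgEquiv.refl (R := k) (A₁ := Env k S)) (x := morseVec x)
      (fun σ => by
        rw [refl_changeRight_id]
        exact morseVec_mul_idem x σ)
      (fun σ hσ => morseVec_eq_zero x hσ) hx
    simp only [refl_changeRight_id] at hw1 hw3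
    obtain ⟨y, hy⟩ := exists_morseVec hw1 hw2
    refine ⟨y, morseVec_injective ?_⟩
    rw [morseVec_morseDiff hA hM hv, hy]
    exact hw3
  · rintro ⟨y, rfl⟩
    rw [hsum, MulOpposite.unop_eq_zero_iff, morseVec_morseDiff hA hM hv]
    have := morse_aug_eq_zero hA hM hv (AlgHom.id k (QuiverAlgebra k S)ᵐᵒᵖ)
      (AlgEquiv.refl (R := k) (A₁ := Env k S)) (x := morseVec y)
      (fun σ => by
        rw [refl_changeRight_id]
        exact morseVec_mul_idem y σ)
      (fun σ hσ => morseVec_eq_zero y hσ)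
    simp only [refl_changeRight_id] at this
    exact this

-- A preimage of `y` is the sum of the elements `y e_a ⊗ e_a` over the vertices, because the trivial
-- paths add up to `1` and all 0-cells are critical.
omit [Nontrivial k] hA hM hv in
theorem morseAug_surjective (hc : ∀ a : V, IsCritical M ⟨a, a, Cell.vertex a⟩) :
    Function.Surjective (morseAug M) := by
  intro y
  obtain ⟨x, hx⟩ := exists_morseVec (M := M) (n := 0)
    (w := fun σ => if IsCritical M σ ∧ σ.2.2.dim = 0 then
      (y ⊗ₜ[k] 1 : Env k S) * idem k S σ.1 σ.2.1 else 0)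
    (fun σ => by
      split_ifs
      · rw [mul_assoc, idem_mul_idem]
      · rw [zero_mul])
    (fun σ hσ => if_neg hσ)
  refine ⟨x, ?_⟩
  rw [morseAug_eq, hx]
  have : ∀ a : V, (if IsCritical M ⟨a, a, Cell.vertex a⟩ ∧ (Cell.vertex a : Cell k S a a).dim = 0 then
      (y ⊗ₜ[k] 1 : Env k S) * idem k S a a else 0) • (1 : QuiverAlgebra k S) =
      y * (PathClass.id a).toAlg := by
    intro a
    rw [if_pos ⟨hc a, rfl⟩, idem, Algebra.TensorProduct.tmul_mul_tmul, one_mul, tmul_smul, mul_one,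
      mul_assoc, PathClass.toAlg_mul_id]
  refine (Finset.sum_congr rfl fun a _ => this a).trans ?_
  rw [← Finset.mul_sum, PathClass.sum_id_toAlg, mul_one]

theorem isProjectiveResolution (hc : ∀ a : V, IsCritical M ⟨a, a, Cell.vertex a⟩) :
    IsProjectiveResolution M where
  projective n := by
    have := fun η : Crit M n => projective_projBimod (k := k) (S := S) η.1.1 η.1.2.1
    infer_instance
  surjective := morseAug_surjective hc
  exact_zero := morseDiff_exact_zero hA hM hv
  exact_succ n := morseDiff_exact hA hM hv n

-- A path between different vertices has a last arrow, which can be factored out.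
omit hM hv [Nontrivial k] [∀ a b : V, Finite (a ⟶ b)] hA in
theorem toAlg_tmul_mem_arrowIdeal {a b : V} (p : PathClass k S a b) (h : a ≠ b) :
    (p.toAlg ⊗ₜ[k] 1 : Env k S) ∈ arrowIdeal k S ∧
      (1 ⊗ₜ[k] MulOpposite.op p.toAlg : Env k S) ∈ arrowIdeal k S := by
  obtain ⟨p, rfl⟩ := p.mk_surjective
  rw [PathClass.toAlg_mk]
  cases p with
  | nil => exact (h rfl).elim
  | cons p f =>
    have h1 : ofPath k (p.cons f) = ofPath k p * ofPath k f.toPath := by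
      rw [ofPath_mul_ofPath]
      rfl
    rw [h1, map_mul]
    constructor
    · rw [← mul_one (1 : (QuiverAlgebra k S)ᵐᵒᵖ), ← Algebra.TensorProduct.tmul_mul_tmul]
      exact (arrowIdeal k S).mul_mem_left _ _ (TwoSidedIdeal.subset_span ⟨_, _, f, Or.inl rfl⟩)
    · rw [MulOpposite.op_mul, ← mul_one (1 : QuiverAlgebra k S),
        ← Algebra.TensorProduct.tmul_mul_tmul]
      exact (arrowIdeal k S).mul_mem_right _ _ (TwoSidedIdeal.subset_span ⟨_, _, f, Or.inr rfl⟩)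

omit hM hv in
theorem IsFactorWeight.mem_arrowIdeal (hp : IsPureAlgebra k S) {n : ℕ} {σ η : AnyCell k S}
    (hσ : σ.2.2.top.HasLength (n + 1)) (hη : η.2.2.top.HasLength n) {z : Env k S}
    (hz : IsFactorWeight σ η z) : z ∈ arrowIdeal k S := by
  obtain ⟨u, w, rfl, ⟨h, -⟩ | ⟨h, -⟩⟩ := hz.exists_length hA hp hσ hη
  · rw [← mul_one u.toAlg, ← one_mul (MulOpposite.op w.toAlg),
      ← Algebra.TensorProduct.tmul_mul_tmul]
    exact (arrowIdeal k S).mul_mem_right _ _ (toAlg_tmul_mem_arrowIdeal u (h.ne hA hp)).1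
  · rw [← mul_one u.toAlg, ← one_mul (MulOpposite.op w.toAlg),
      ← Algebra.TensorProduct.tmul_mul_tmul]
    exact (arrowIdeal k S).mul_mem_left _ _ (toAlg_tmul_mem_arrowIdeal w (h.ne hA hp)).2

/-- The Morse complex is minimal if the tops of the critical cells have lengths equal to the
dimensions of the cells. -/
theorem isMinimal (hp : IsPureAlgebra k S)
    (hlen : ∀ σ : AnyCell k S, IsCritical M σ → σ.2.2.top.HasLength σ.2.2.dim) : IsMinimal M := by
  rintro n _ ⟨x, rfl⟩
  induction x using DirectSum.induction_on with
  | zero => rw [map_zero]; exact zero_mem _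
  | add x y hx hy => rw [map_add]; exact add_mem hx hy
  | of σ y =>
    have h1 := morseDiff_lof (M := M) σ y
    rw [DirectSum.lof_eq_of] at h1
    rw [h1]
    refine Submodule.sum_mem _ fun η _ => Submodule.subset_span ?_
    have hcoeff : idem k S σ.1.1 σ.1.2.1 * morseCoeff M σ.1 η.1 ∈ arrowIdeal k S := by
      have hσ := hlen σ.1 σ.2.1
      have hη := hlen η.1 η.2.1
      rw [σ.2.2] at hσ
      rw [η.2.2] at hη
      refine TwoSidedIdeal.mem_asIdeal.1 (idem_mul_morseCoeff_mem hM hv σ.1 η.1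
        (N := (arrowIdeal k S).asIdeal.toAddSubgroup) fun z hz => ?_)
      exact TwoSidedIdeal.mem_asIdeal.2 (hz.mem_arrowIdeal hA hp hσ hη)
    -- The idempotent of `σ` may be inserted since it fixes `y`. With it the coefficient is a
    -- combination of factor weights, all of which lie in the arrow ideal.
    refine ⟨y.1 * (idem k S σ.1.1 σ.1.2.1 * morseCoeff M σ.1 η.1),
      (arrowIdeal k S).mul_mem_left _ _ hcoeff,
      DirectSum.lof (Env k S) (Crit M n) (fun η => projBimod k S η.1.1 η.1.2.1) η
        ⟨idem k S η.1.1 η.1.2.1, mem_projBimod.2 (idem_mul_idem _ _)⟩, ?_⟩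
    rw [← map_smul]
    congr 1
    apply Subtype.ext
    change y.1 * (morseCoeff M σ.1 η.1 * idem k S η.1.1 η.1.2.1) =
      y.1 * (idem k S σ.1.1 σ.1.2.1 * morseCoeff M σ.1 η.1) * idem k S η.1.1 η.1.2.1
    conv_lhs => rw [← mem_projBimod.1 y.2]
    simp only [mul_assoc]

end Bimodule

/-! ### The Koszul resolution -/

section Koszul

open scoped Classical

variable {k : Type w} {V : Type u} [Quiver.{v} V] [CommRing k] [Fintype V] {S : PathRelations V}
  [AcyclicQuiver V]

/-- The linear map sending trivial paths to the idempotents of `V → k` and all other paths to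
zero. -/
def vertexLin : QuiverAlgebra k S →ₗ[k] V → k :=
  pathBasis.constr k fun p => if p.1 = p.2.1 then Pi.single p.1 1 else 0

theorem vertexLin_toAlg {a b : V} (p : PathClass k S a b) :
    vertexLin p.toAlg = if a = b then Pi.single a 1 else 0 := by
  rw [← pathBasis_mk, vertexLin, Module.Basis.constr_basis]

/-- Without oriented cycles, a product of two paths is trivial only if both factors are. -/
theorem vertexLin_mul (x y : QuiverAlgebra k S) :
    vertexLin (x * y) = vertexLin x * vertexLin y := by
  induction x using quiverAlgebra_induction with
  | zero => rw [zero_mul, map_zero, zero_mul]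
  | add x x' hx hx' => rw [add_mul, map_add, hx, hx', map_add, add_mul]
  | @smul r a b p =>
    rw [smul_mul_assoc, map_smul, map_smul, smul_mul_assoc]
    congr 1
    induction y using quiverAlgebra_induction with
    | zero => rw [mul_zero, map_zero, mul_zero]
    | add y y' hy hy' => rw [mul_add, map_add, hy, hy', map_add, mul_add]
    | @smul s c d q =>
      rw [mul_smul_comm, map_smul, map_smul, mul_smul_comm]
      congr 1
      by_cases h : b = c
      · subst h
        rw [PathClass.toAlg_mul, vertexLin_toAlg, vertexLin_toAlg, vertexLin_toAlg]
        by_cases had : a = d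
        · subst had
          obtain rfl := PathClass.isEmpty_or p q
          rw [if_pos rfl, ← Pi.single_mul, one_mul]
        · rw [if_neg had]
          by_cases hab : a = b
          · rw [if_neg (fun h : b = d => had (hab.trans h)), mul_zero]
          · rw [if_neg hab, zero_mul]
      · rw [PathClass.toAlg_mul_of_ne _ _ h, map_zero, vertexLin_toAlg, vertexLin_toAlg]
        split_ifs with h1 h2
        · subst h1 h2
          ext v
          by_cases hv : v = a
          · subst hv
            simp [h]
          · simp [hv]
        all_goals simp

/-- The projection of the algebra onto its component of degree zero. -/
def vertexHom : QuiverAlgebra k S →ₐ[k] V → k :=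
  AlgHom.ofLinearMap vertexLin
    (by
      rw [← PathClass.sum_id_toAlg, map_sum]
      simp only [vertexLin_toAlg, if_true]
      exact Finset.univ_sum_single (1 : V → k))
    vertexLin_mul

theorem vertexHom_toAlg {a b : V} (p : PathClass k S a b) :
    vertexHom p.toAlg = if a = b then Pi.single a 1 else 0 := vertexLin_toAlg p

/-- The projection onto the component of degree zero, on the opposite algebra. -/
def vertexOpHom : (QuiverAlgebra k S)ᵐᵒᵖ →ₐ[k] V → k :=
  AlgHom.fromOpposite vertexHom fun _ _ => Commute.all _ _

theorem vertexOpHom_op (x : QuiverAlgebra k S) : vertexOpHom (MulOpposite.op x) = vertexHom x := rfl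

variable (k S) in
/-- The tensor product of the algebra with its component of degree zero, as a product. -/
def scalarEquiv : QuiverAlgebra k S ⊗[k] (V → k) ≃ₐ[k] V → QuiverAlgebra k S :=
  Algebra.TensorProduct.piScalarRight k k (QuiverAlgebra k S) V

theorem scalarEquiv_tmul (x : QuiverAlgebra k S) (y : V → k) (v : V) :
    scalarEquiv k S (x ⊗ₜ y) v = y v • x := by
  rw [scalarEquiv, Algebra.TensorProduct.piScalarRight_tmul]

variable [∀ a b : V, Finite (a ⟶ b)]

theorem augTerm_vertexOpHom (z : QuiverAlgebra k S ⊗[k] (V → k)) :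
    augTerm vertexOpHom z = fun v => vertexHom (scalarEquiv k S z v) v := by
  ext v
  induction z using TensorProduct.induction_on with
  | zero => simp
  | add x y hx hy => rw [map_add, map_add, Pi.add_apply, Pi.add_apply, map_add, Pi.add_apply, hx, hy]
  | tmul x y =>
    rw [augTerm_tmul, vertexOpHom_op, scalarEquiv_tmul, map_smul, Pi.mul_apply, Pi.smul_apply,
      smul_eq_mul]

variable (k S) in
/-- Change of coefficients from the enveloping algebra to the left modules `A ⊗ A₀`. -/
def leftHom : Env k S →+* (V → QuiverAlgebra k S) :=
  ((scalarEquiv k S).toAlgHom.comp (changeRight vertexOpHom)).toRingHom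

theorem leftHom_apply (z : Env k S) :
    scalarEquiv k S (changeRight vertexOpHom z) = leftHom k S z := rfl

theorem leftHom_tmul (x y : QuiverAlgebra k S) (v : V) :
    leftHom k S (x ⊗ₜ MulOpposite.op y) v = vertexHom y v • x := by
  rw [← leftHom_apply, changeRight_tmul, scalarEquiv_tmul, vertexOpHom_op]

theorem leftHom_idem (a b v : V) :
    leftHom k S (idem k S a b) v = if v = b then (PathClass.id a).toAlg else 0 := by
  rw [idem, leftHom_tmul, vertexHom_toAlg, if_pos rfl, Pi.single_apply]
  split_ifs
  · rw [one_smul]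
  · rw [zero_smul]

theorem morseMatrix_mul_idem {M : CellMatching k S} (σ η : AnyCell k S) :
    morseMatrix M σ η * idem k S η.1 η.2.1 = morseMatrix M σ η := by
  rw [morseMatrix]
  split_ifs
  · rw [mul_assoc, idem_mul_idem]
  · rw [zero_mul]

/-! #### The shifted gradings -/

section Shift

variable (k S) in
/-- The component of degree `j` of the algebra, generated in degree `n`. -/
def shiftGrading (n j : ℕ) : Submodule k (QuiverAlgebra k S) :=
  -- Truncated subtraction would send all degrees below `n` to the component of degree zero, hence
  -- the case distinction.
  if n ≤ j then lengthGrading k S (j - n) else ⊥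

theorem mul_mem_shiftGrading {m n j : ℕ} {x y : QuiverAlgebra k S} (hx : x ∈ lengthGrading k S m)
    (hy : y ∈ shiftGrading k S n j) : x * y ∈ shiftGrading k S n (m + j) := by
  rw [shiftGrading] at hy
  split_ifs at hy with h
  · rw [shiftGrading, if_pos (by omega), Nat.add_sub_assoc h]
    exact mul_mem_lengthGrading hx hy
  · rw [(Submodule.mem_bot k).1 hy, mul_zero]
    exact zero_mem _

/-- A factor of length one compensates the change of the generating degree from `n + 1` to `n`. So a
differential with entries of length one preserves degrees. -/
theorem mul_mem_shiftGrading_of_succ {n j : ℕ} {x y : QuiverAlgebra k S}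
    (hx : x ∈ shiftGrading k S (n + 1) j) (hy : y ∈ lengthGrading k S 1) :
    x * y ∈ shiftGrading k S n j := by
  rw [shiftGrading] at hx
  split_ifs at hx with h
  · rw [shiftGrading, if_pos (by omega), show j - n = j - (n + 1) + 1 by omega]
    exact mul_mem_lengthGrading hx hy
  · rw [(Submodule.mem_bot k).1 hx, zero_mul]
    exact zero_mem _

variable [Nontrivial k] (hA : IsHPA k S)

/-- The projection onto a component of a shifted grading. -/
def shiftProj (n j : ℕ) : QuiverAlgebra k S →ₗ[k] QuiverAlgebra k S :=
  if n ≤ j then lengthProj hA (j - n) else 0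

theorem shiftProj_mem (n j : ℕ) (x : QuiverAlgebra k S) :
    shiftProj hA n j x ∈ shiftGrading k S n j := by
  rw [shiftProj, shiftGrading]
  split_ifs
  · exact lengthProj_mem hA _ x
  · exact zero_mem _

theorem shiftProj_of_mem (hp : IsPureAlgebra k S) {n i j : ℕ} {x : QuiverAlgebra k S}
    (hx : x ∈ shiftGrading k S n i) : shiftProj hA n j x = if j = i then x else 0 := by
  rw [shiftGrading] at hx
  split_ifs at hx with h
  · rw [shiftProj]
    by_cases hj : n ≤ j
    · rw [if_pos hj, lengthProj_of_mem hA hp hx]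
      by_cases hij : j = i
      · rw [if_pos (by rw [hij]), if_pos hij]
      · rw [if_neg (by omega), if_neg hij]
    · rw [if_neg hj, if_neg (by omega), LinearMap.zero_apply]
  · rw [(Submodule.mem_bot k).1 hx, map_zero, ite_self]

theorem shiftProj_mul_id (n j : ℕ) (x : QuiverAlgebra k S) (a : V) :
    shiftProj hA n j (x * (PathClass.id a).toAlg) =
      shiftProj hA n j x * (PathClass.id a).toAlg := by
  rw [shiftProj]
  split_ifs
  · exact lengthProj_mul_id hA _ x a
  · rw [LinearMap.zero_apply, LinearMap.zero_apply, zero_mul]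

theorem exists_shiftProj_sum (n : ℕ) :
    ∃ N, ∀ x : QuiverAlgebra k S, ∑ j ∈ Finset.range N, shiftProj hA n j x = x := by
  obtain ⟨N, hN⟩ := exists_lengthProj_sum hA
  refine ⟨n + N, fun x => ?_⟩
  rw [Finset.sum_range_add, Finset.sum_eq_zero, zero_add]
  · conv_rhs => rw [← hN x]
    refine Finset.sum_congr rfl fun j _ => ?_
    rw [shiftProj, if_pos (by omega), Nat.add_sub_cancel_left]
  · intro j hj
    rw [shiftProj, if_neg (by have := Finset.mem_range.1 hj; omega), LinearMap.zero_apply]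

end Shift

/-! #### The modules of the resolution -/

variable (M : CellMatching k S)

/-- The module in degree `n` of the Morse complex tensored with the component of degree zero. -/
def leftModule (n : ℕ) : Submodule (QuiverAlgebra k S) (AnyCell k S → V → QuiverAlgebra k S) where
  carrier := {x | (∀ σ, x σ * leftHom k S (idem k S σ.1 σ.2.1) = x σ) ∧
    ∀ σ, ¬ (IsCritical M σ ∧ σ.2.2.dim = n) → x σ = 0}
  zero_mem' := ⟨fun σ => zero_mul _, fun σ _ => rfl⟩
  add_mem' := by
    rintro x y ⟨hx, hx'⟩ ⟨hy, hy'⟩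
    refine ⟨fun σ => ?_, fun σ h => ?_⟩
    · rw [Pi.add_apply, add_mul, hx, hy]
    · rw [Pi.add_apply, hx' σ h, hy' σ h, add_zero]
  smul_mem' := by
    rintro r x ⟨hx, hx'⟩
    refine ⟨fun σ => ?_, fun σ h => ?_⟩
    · rw [Pi.smul_apply, smul_mul_assoc, hx]
    · rw [Pi.smul_apply, hx' σ h, smul_zero]

variable {M}

theorem mem_leftModule {n : ℕ} {x : AnyCell k S → V → QuiverAlgebra k S} :
    x ∈ leftModule M n ↔ (∀ σ, x σ * leftHom k S (idem k S σ.1 σ.2.1) = x σ) ∧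
      ∀ σ, ¬ (IsCritical M σ ∧ σ.2.2.dim = n) → x σ = 0 := Iff.rfl

theorem mem_leftModule_iff {n : ℕ} {x : AnyCell k S → V → QuiverAlgebra k S} :
    x ∈ leftModule M n ↔ (∀ σ, x σ σ.2.1 * (PathClass.id σ.1).toAlg = x σ σ.2.1) ∧
      (∀ σ, ∀ v ≠ σ.2.1, x σ v = 0) ∧
      ∀ σ, ¬ (IsCritical M σ ∧ σ.2.2.dim = n) → x σ = 0 := by
  rw [mem_leftModule, ← and_assoc]
  refine and_congr_left fun _ => ?_
  constructor
  · intro h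
    refine ⟨fun σ => ?_, fun σ v hv => ?_⟩
    · have := congrFun (h σ) σ.2.1
      rwa [Pi.mul_apply, leftHom_idem, if_pos rfl] at this
    · have := congrFun (h σ) v
      rw [Pi.mul_apply, leftHom_idem, if_neg hv, mul_zero] at this
      exact this.symm
  · rintro ⟨h1, h2⟩ σ
    ext v
    rw [Pi.mul_apply, leftHom_idem]
    split_ifs with hv
    · rw [hv, h1]
    · rw [mul_zero, h2 σ v hv]

theorem projective_leftModule (n : ℕ) : Module.Projective (QuiverAlgebra k S) (leftModule M n) := by
  refine Module.Projective.of_split (leftModule M n).subtype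
    (LinearMap.codRestrict (leftModule M n)
      { toFun := fun x σ => if IsCritical M σ ∧ σ.2.2.dim = n then
          x σ * leftHom k S (idem k S σ.1 σ.2.1) else 0
        map_add' := fun x y => ?_
        map_smul' := fun r x => ?_ } fun x => ?_) ?_
  · ext σ : 1
    rw [Pi.add_apply, Pi.add_apply]
    split_ifs
    · rw [add_mul]
    · rw [add_zero]
  · ext σ : 1
    rw [RingHom.id_apply, Pi.smul_apply, Pi.smul_apply]
    split_ifs
    · rw [smul_mul_assoc]
    · rw [smul_zero]
  · refine mem_leftModule.2 ⟨fun σ => ?_, fun σ hσ => if_neg hσ⟩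
    change (if IsCritical M σ ∧ σ.2.2.dim = n then
          x σ * leftHom k S (idem k S σ.1 σ.2.1) else 0) * leftHom k S (idem k S σ.1 σ.2.1) =
      if IsCritical M σ ∧ σ.2.2.dim = n then x σ * leftHom k S (idem k S σ.1 σ.2.1) else 0
    split_ifs
    · rw [mul_assoc, ← map_mul, idem_mul_idem]
    · rw [zero_mul]
  · refine LinearMap.ext fun x => Subtype.ext (funext fun σ => ?_)
    obtain ⟨h1, h2⟩ := mem_leftModule.1 x.2
    change (if IsCritical M σ ∧ σ.2.2.dim = n then
          x.1 σ * leftHom k S (idem k S σ.1 σ.2.1) else 0) = x.1 σ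
    split_ifs with h
    · exact h1 σ
    · rw [h2 σ h]

variable (M) in
/-- The grading of the modules of the resolution. -/
def leftGrading (n j : ℕ) : AddSubgroup (leftModule M n) where
  carrier := {x | ∀ σ v, x.1 σ v ∈ shiftGrading k S n j}
  zero_mem' := fun _ _ => zero_mem _
  add_mem' := fun hx hy σ v => add_mem (hx σ v) (hy σ v)
  neg_mem' := fun hx σ v => neg_mem (hx σ v)

/-- The summand of a critical cell is generated by the trivial path at its tail, which has degree
`n` in the shifted grading. -/
theorem span_leftGrading (n : ℕ) :
    Submodule.span (QuiverAlgebra k S) (leftGrading M n n : Set (leftModule M n)) = ⊤ := by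
  rw [eq_top_iff]
  rintro x -
  obtain ⟨h1, h2, h3⟩ := mem_leftModule_iff.1 x.2
  let g : AnyCell k S → leftModule M n := fun σ =>
    ⟨Pi.single σ (if IsCritical M σ ∧ σ.2.2.dim = n then
      Pi.single σ.2.1 (PathClass.id σ.1).toAlg else 0), by
      refine mem_leftModule_iff.2 ⟨fun τ => ?_, fun τ v hv => ?_, fun τ hτ => ?_⟩
      · by_cases h : τ = σ
        · subst h
          rw [Pi.single_eq_same]
          split_ifs
          · rw [Pi.single_eq_same, PathClass.toAlg_mul_id]
          · exact zero_mul _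
        · rw [Pi.single_eq_of_ne h]
          exact zero_mul _
      · by_cases h : τ = σ
        · subst h
          rw [Pi.single_eq_same]
          split_ifs
          · rw [Pi.single_eq_of_ne hv]
          · rfl
        · rw [Pi.single_eq_of_ne h]
          rfl
      · by_cases h : τ = σ
        · subst h
          rw [Pi.single_eq_same, if_neg hτ]
        · rw [Pi.single_eq_of_ne h]⟩
  have hg : ∀ σ, g σ ∈ leftGrading M n n := by
    intro σ τ v
    have h0 : (0 : QuiverAlgebra k S) ∈ shiftGrading k S n n := zero_mem _
    change (Pi.single σ (if IsCritical M σ ∧ σ.2.2.dim = n then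
      Pi.single σ.2.1 (PathClass.id σ.1).toAlg else 0) :
        AnyCell k S → V → QuiverAlgebra k S) τ v ∈ _
    by_cases h : τ = σ
    · subst h
      rw [Pi.single_eq_same]
      split_ifs
      · by_cases hv : v = τ.2.1
        · subst hv
          rw [Pi.single_eq_same, shiftGrading, if_pos le_rfl, Nat.sub_self]
          exact toAlg_mem_lengthGrading (PathClass.HasLength.id _)
        · rw [Pi.single_eq_of_ne hv]
          exact h0
      · exact h0
    · rw [Pi.single_eq_of_ne h]
      exact h0
  have hx : x = ∑ σ, x.1 σ σ.2.1 • g σ := by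
    apply Subtype.ext
    ext σ v
    rw [AddSubmonoidClass.coe_finsetSum, Finset.sum_apply, Finset.sum_apply,
      Finset.sum_eq_single σ]
    · change _ = x.1 σ σ.2.1 * (Pi.single σ (if IsCritical M σ ∧ σ.2.2.dim = n then
        Pi.single σ.2.1 (PathClass.id σ.1).toAlg else 0) :
          AnyCell k S → V → QuiverAlgebra k S) σ v
      rw [Pi.single_eq_same]
      by_cases h : IsCritical M σ ∧ σ.2.2.dim = n
      · rw [if_pos h]
        by_cases hv : v = σ.2.1
        · subst hv
          rw [Pi.single_eq_same, h1]
        · rw [Pi.single_eq_of_ne hv, mul_zero, h2 σ v hv]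
      · rw [h3 σ h]
        exact (zero_mul _).symm
    · intro τ _ hτ
      change x.1 τ τ.2.1 * (Pi.single τ _ : AnyCell k S → V → QuiverAlgebra k S) σ v = 0
      rw [Pi.single_eq_of_ne hτ.symm]
      exact mul_zero _
    · simp
  rw [hx]
  exact Submodule.sum_mem _ fun σ _ => Submodule.smul_mem _ _ (Submodule.subset_span (hg σ))

variable [Nontrivial k] (hA : IsHPA k S) (hp : IsPureAlgebra k S)

include hA hp in
theorem isInternal_leftGrading (n : ℕ) : DirectSum.IsInternal (leftGrading M n) := by
  let π : ℕ → leftModule M n →+ leftModule M n := fun j =>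
    { toFun := fun x => ⟨fun σ v => shiftProj hA n j (x.1 σ v), by
        obtain ⟨h1, h2, h3⟩ := mem_leftModule_iff.1 x.2
        refine mem_leftModule_iff.2 ⟨fun σ => ?_, fun σ v hv => ?_, fun σ hσ => ?_⟩
        · rw [← shiftProj_mul_id, h1]
        · rw [h2 σ v hv, map_zero]
        · ext v
          rw [h3 σ hσ]
          exact map_zero _⟩
      map_zero' := Subtype.ext (funext fun σ => funext fun v => map_zero _)
      map_add' := fun x y => Subtype.ext (funext fun σ => funext fun v => map_add _ _ _) }
  refine isInternal_of_projections _ π (fun j x σ v => shiftProj_mem hA n j _)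
    (fun i j x hx => ?_) fun x => ?_
  · apply Subtype.ext
    ext σ v
    refine (shiftProj_of_mem hA hp (hx σ v)).trans ?_
    split_ifs <;> rfl
  · obtain ⟨N, hN⟩ := exists_shiftProj_sum (k := k) (S := S) hA n
    refine ⟨Finset.range N, ?_⟩
    apply Subtype.ext
    ext σ v
    rw [AddSubmonoidClass.coe_finsetSum, Finset.sum_apply, Finset.sum_apply]
    exact hN _

end Koszul

/-! ### The resolution of `A₀` and its linearity -/

section KoszulResolution

open scoped Classical

variable {k : Type w} {V : Type u} [Quiver.{v} V] [CommRing k] [Fintype V] {S : PathRelations V}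
  [AcyclicQuiver V] [∀ a b : V, Finite (a ⟶ b)] {M : CellMatching k S}
  [Nontrivial k] (hA : IsHPA k S) (hM : IsAcyclicMatching M) (hv : IsVertical M)
  (hp : IsPureAlgebra k S)
  (hlen : ∀ σ : AnyCell k S, IsCritical M σ → σ.2.2.top.HasLength σ.2.2.dim)

include hA hM hv in
theorem vecMul_mem_leftModule {n : ℕ} {x : AnyCell k S → V → QuiverAlgebra k S}
    (hx : x ∈ leftModule M (n + 1)) :
    Matrix.vecMul x ((morseMatrix M).map (leftHom k S)) ∈ leftModule M n := by
  refine mem_leftModule.2 ⟨fun η => ?_, fun η hη => ?_⟩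
  · rw [Matrix.vecMul, dotProduct, Finset.sum_mul]
    refine Finset.sum_congr rfl fun σ _ => ?_
    rw [Matrix.map_apply, mul_assoc, ← map_mul, morseMatrix_mul_idem]
  · refine Finset.sum_eq_zero fun σ _ => ?_
    change x σ * leftHom k S (morseMatrix M σ η) = 0
    by_cases hσ : IsCritical M σ ∧ σ.2.2.dim = n + 1
    · by_cases h : IsCritical M η
      · rw [morseMatrix_eq_zero hA hM hv hσ.2 fun h' => hη ⟨h, h'⟩, map_zero, mul_zero]
      · rw [morseMatrix, if_neg fun h' => h h'.2, map_zero, mul_zero]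
    · rw [hx.2 σ hσ, zero_mul]

/-- The differential of the Morse complex tensored with the component of degree zero. -/
def leftDiff (n : ℕ) : leftModule M (n + 1) →ₗ[QuiverAlgebra k S] leftModule M n where
  toFun x := ⟨_, vecMul_mem_leftModule hA hM hv x.2⟩
  map_add' _ _ := Subtype.ext (Matrix.add_vecMul _ _ _)
  map_smul' _ _ := Subtype.ext (Matrix.smul_vecMul _ _ _)

theorem leftDiff_exact (n : ℕ) :
    Function.Exact (leftDiff hA hM hv (n + 1)) (leftDiff hA hM hv n) := by
  intro x
  obtain ⟨h1, h2⟩ := mem_leftModule.1 x.2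
  constructor
  · intro hx
    obtain ⟨w, hw1, hw2, hw3⟩ := morse_exact_succ hA hM hv vertexOpHom (scalarEquiv k S) h1 h2
      (congrArg Subtype.val hx)
    exact ⟨⟨w, hw1, hw2⟩, Subtype.ext hw3⟩
  · rintro ⟨y, rfl⟩
    apply Subtype.ext
    change Matrix.vecMul (Matrix.vecMul y.1 ((morseMatrix M).map (leftHom k S)))
      ((morseMatrix M).map (leftHom k S)) = 0
    rw [Matrix.vecMul_vecMul, ← Matrix.map_mul, morseMatrix_mul_self hA hM hv,
      Matrix.map_zero _ (map_zero _), Matrix.vecMul_zero]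

variable (k S) in
/-- The ideal of all elements of positive degree. -/
abbrev positiveIdeal : Ideal (QuiverAlgebra k S) :=
  Ideal.span (⋃ n : ℕ, (lengthGrading k S (n + 1) : Set (QuiverAlgebra k S)))

variable (M) in
/-- The augmentation of the Koszul resolution. -/
def leftAug : leftModule M 0 →ₗ[QuiverAlgebra k S] QuiverAlgebra k S ⧸ positiveIdeal k S :=
  (positiveIdeal k S).mkQ ∘ₗ (∑ a : V, LinearMap.proj (R := QuiverAlgebra k S) a ∘ₗ
    LinearMap.proj (φ := fun _ : AnyCell k S => V → QuiverAlgebra k S)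
      (⟨a, a, Cell.vertex a⟩ : AnyCell k S)) ∘ₗ (leftModule M 0).subtype

theorem leftAug_apply (x : leftModule M 0) :
    leftAug M x = (positiveIdeal k S).mkQ (∑ a : V, x.1 ⟨a, a, Cell.vertex a⟩ a) := by
  simp [leftAug]

theorem leftAug_surjective (hc : ∀ a : V, IsCritical M ⟨a, a, Cell.vertex a⟩) :
    Function.Surjective (leftAug M) := by
  intro y
  obtain ⟨y, rfl⟩ := Submodule.mkQ_surjective _ y
  refine ⟨⟨fun σ => if IsCritical M σ ∧ σ.2.2.dim = 0 then
    Pi.single σ.2.1 (y * (PathClass.id σ.1).toAlg) else 0, mem_leftModule_iff.2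
      ⟨fun σ => ?_, fun σ v hv => ?_, fun σ hσ => if_neg hσ⟩⟩, ?_⟩
  · split_ifs
    · rw [Pi.single_eq_same, mul_assoc, PathClass.toAlg_mul_id]
    · exact zero_mul _
  · split_ifs
    · rw [Pi.single_eq_of_ne hv]
    · rfl
  · rw [leftAug_apply]
    congr 1
    have : ∀ a : V, (if IsCritical M ⟨a, a, Cell.vertex a⟩ ∧
        (Cell.vertex a : Cell k S a a).dim = 0 then
        (Pi.single a (y * (PathClass.id a).toAlg) : V → QuiverAlgebra k S) else 0) a =
        y * (PathClass.id a).toAlg := by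
      intro a
      rw [if_pos ⟨hc a, rfl⟩, Pi.single_eq_same]
    refine (Finset.sum_congr rfl fun a _ => this a).trans ?_
    rw [← Finset.mul_sum, PathClass.sum_id_toAlg, mul_one]

include hA hp in
theorem vertexHom_eq_zero_of_mem {x : QuiverAlgebra k S} (hx : x ∈ positiveIdeal k S) :
    vertexHom x = 0 := by
  have : positiveIdeal k S ≤ RingHom.ker (vertexHom (k := k) (S := S)) := by
    rw [positiveIdeal, Ideal.span_le, Set.iUnion_subset_iff]
    intro n x hx
    rw [SetLike.mem_coe, RingHom.mem_ker]
    induction hx using Submodule.span_induction with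
    | zero => rw [map_zero]
    | add x y _ _ hx hy => rw [map_add, hx, hy, add_zero]
    | smul r x _ hx => rw [map_smul, hx, smul_zero]
    | mem x hx =>
      obtain ⟨a, b, p, hp', rfl⟩ := hx
      rw [vertexHom_toAlg, if_neg]
      rintro rfl
      rw [p.eq_id] at hp'
      exact absurd (hp'.unique hA hp (PathClass.HasLength.id a)) (Nat.succ_ne_zero n)
  exact this hx

-- Of the possible weights `u ⊗ w`, those with nontrivial `w` are killed by `vertexHom`, and in the
-- others `u` has length one.
include hA hM hv hp hlen in
theorem leftHom_mem {n : ℕ} {σ η : AnyCell k S} (hσ : σ.2.2.dim = n + 1)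
    (hη : η.2.2.dim = n) (v : V) :
    leftHom k S (idem k S σ.1 σ.2.1 * morseMatrix M σ η) v ∈ lengthGrading k S 1 := by
  refine idem_mul_morseMatrix_mem hM hv σ η (N := (lengthGrading k S 1).toAddSubgroup.comap
    ((Pi.evalAddMonoidHom (fun _ : V => QuiverAlgebra k S) v).comp
      (leftHom k S).toAddMonoidHom)) fun hσc hηc z hz => ?_
  have hσ' := hlen σ hσc
  have hη' := hlen η hηc
  rw [hσ] at hσ'
  rw [hη] at hη'
  change leftHom k S z v ∈ lengthGrading k S 1
  obtain ⟨u, w, rfl, ⟨h, -⟩ | ⟨h, -⟩⟩ := hz.exists_length hA hp hσ' hη'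
  · rw [leftHom_tmul]
    exact Submodule.smul_mem _ _ (toAlg_mem_lengthGrading h)
  · rw [leftHom_tmul, vertexHom_toAlg, if_neg (h.ne hA hp), Pi.zero_apply, zero_smul]
    exact zero_mem _

include hp hlen in
theorem leftDiff_mem {n j : ℕ} (x : leftModule M (n + 1)) (hx : x ∈ leftGrading M (n + 1) j) :
    leftDiff hA hM hv n x ∈ leftGrading M n j := by
  intro η v
  change (Matrix.vecMul x.1 ((morseMatrix M).map (leftHom k S)) η) v ∈ _
  by_cases hη : η.2.2.dim = n
  · rw [Matrix.vecMul, dotProduct, Finset.sum_apply]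
    refine Submodule.sum_mem _ fun σ _ => ?_
    by_cases hσ : IsCritical M σ ∧ σ.2.2.dim = n + 1
    · rw [← x.2.1 σ, Matrix.map_apply, mul_assoc, ← map_mul, Pi.mul_apply]
      exact mul_mem_shiftGrading_of_succ (hx σ v) (leftHom_mem hA hM hv hp hlen hσ.2 hη v)
    · rw [x.2.2 σ hσ, zero_mul]
      exact zero_mem _
  · have := (vecMul_mem_leftModule hA hM hv x.2).2 η fun h => hη h.2
    rw [this]
    exact zero_mem _

-- Elements of positive degree are killed by `vertexHom`. An element in the kernel of `leftAug` is
-- therefore in the kernel of the augmentation with coefficients in `V → k`, where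
-- `morse_exact_zero` applies. Conversely, the entries of a boundary in degree zero lie in the ideal
-- generated by paths of length one.
include hp hlen in
theorem leftDiff_exact_zero : Function.Exact (leftDiff hA hM hv 0) (leftAug M) := by
  intro x
  obtain ⟨h1, h2⟩ := mem_leftModule.1 x.2
  constructor
  · intro hx
    rw [leftAug_apply, Submodule.mkQ_apply, Submodule.Quotient.mk_eq_zero] at hx
    obtain ⟨h3, h4, -⟩ := mem_leftModule_iff.1 x.2
    -- The summand at a vertex `a` consists of paths ending at `a`, so only `a = v` contributes to
    -- the coordinate `v`.
    have h5 : ∀ v : V, vertexHom (x.1 ⟨v, v, Cell.vertex v⟩ v) v = 0 := by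
      intro v
      have h := congrFun (vertexHom_eq_zero_of_mem hA hp hx) v
      rw [map_sum, Finset.sum_apply, Finset.sum_eq_single v] at h
      · exact h
      · intro a _ hav
        have h6 := h3 ⟨a, a, Cell.vertex a⟩
        change x.1 ⟨a, a, Cell.vertex a⟩ a * (PathClass.id a).toAlg =
          x.1 ⟨a, a, Cell.vertex a⟩ a at h6
        rw [← h6, map_mul, vertexHom_toAlg, if_pos rfl, Pi.mul_apply, Pi.single_eq_of_ne hav.symm,
          mul_zero]
      · simp
    obtain ⟨w, hw1, hw2, hw3⟩ := morse_exact_zero hA hM hv vertexOpHom (scalarEquiv k S) h1 h2 (by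
      ext v
      simp only [augTerm_vertexOpHom, AlgEquiv.apply_symm_apply]
      rw [Finset.sum_apply, Finset.sum_eq_single v]
      · exact h5 v
      · intro a _ hav
        rw [h4 ⟨a, a, Cell.vertex a⟩ v hav.symm, map_zero]
        rfl
      · simp)
    exact ⟨⟨w, hw1, hw2⟩, Subtype.ext hw3⟩
  · rintro ⟨y, rfl⟩
    rw [leftAug_apply, Submodule.mkQ_apply, Submodule.Quotient.mk_eq_zero]
    refine Submodule.sum_mem _ fun a _ => ?_
    change (Matrix.vecMul y.1 ((morseMatrix M).map (leftHom k S)) ⟨a, a, Cell.vertex a⟩) a ∈ _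
    rw [Matrix.vecMul, dotProduct, Finset.sum_apply]
    refine Submodule.sum_mem _ fun σ _ => ?_
    by_cases hσ : IsCritical M σ ∧ σ.2.2.dim = 1
    · rw [← y.2.1 σ, Matrix.map_apply, mul_assoc, ← map_mul, Pi.mul_apply]
      refine Ideal.mul_mem_left _ _ (Ideal.subset_span (Set.mem_iUnion.2 ⟨0, ?_⟩))
      exact leftHom_mem hA hM hv hp hlen hσ.2 rfl a
    · rw [y.2.2 σ hσ, zero_mul]
      exact zero_mem _

include hA hM hv hp hlen in
theorem isKoszul (hc : ∀ a : V, IsCritical M ⟨a, a, Cell.vertex a⟩) :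
    IsKoszul (lengthGrading k S) :=
  ⟨nonempty_gradedAlgebra hA hp, fun n => leftModule M n, inferInstance, inferInstance,
    fun n => leftGrading M n, leftDiff hA hM hv, leftAug M, fun n => projective_leftModule n,
    fun n => isInternal_leftGrading hA hp n,
    fun _ _ _ _ ha _ hx σ v => mul_mem_shiftGrading ha (hx σ v),
    fun _ _ x hx => leftDiff_mem hA hM hv hp hlen x hx, fun n => span_leftGrading n,
    leftAug_surjective hc, leftDiff_exact_zero hA hM hv hp hlen, leftDiff_exact hA hM hv⟩

end KoszulResolution

/-! ### The Babson–Hersh matching as input for the Morse resolution -/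

section BabsonHershResolution

variable {k : Type w} {V : Type u} [Quiver.{v} V] [CommRing k] [Fintype V] {S : PathRelations V}
  [AcyclicQuiver V] [∀ a b : V, Finite (a ⟶ b)]

/-- A path from `a` to itself is trivial, so no cell with both ends at `a` has inner vertices,
whereas the upper member of any pair has at least one. -/
theorem BHChoice.isCritical_vertex (B : BHChoice k S) (a : V) :
    IsCritical B.matching ⟨a, a, Cell.vertex a⟩ := by
  have hempty : ∀ σ : Cell k S a a, σ.inner = ∅ := by
    intro σ
    rw [Finset.eq_empty_iff_forall_notMem]
    intro x hx
    have := σ.inner_subset hx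
    rw [σ.top.eq_id] at this
    exact absurd this.2 not_lt_bot
  have key : ∀ σ τ : Cell k S a a, ¬ B.matching ⟨a, a, σ⟩ ⟨a, a, τ⟩ := by
    intro σ τ h
    obtain ⟨-, h | ⟨h, -⟩⟩ := B.matching_iff.1 h
    · exact h.1.ne_empty (hempty τ)
    · rw [hempty σ] at h
      exact (Finset.singleton_ne_empty _ h.symm).elim
  intro τ
  constructor
  · intro h
    obtain ⟨b, c, σ', τ', hσ, rfl, -⟩ := B.exists_of_matching h
    cases hσ
    exact key _ _ h
  · intro h
    obtain ⟨b, c, σ', τ', rfl, hτ, -⟩ := B.exists_of_matching h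
    cases hτ
    exact key _ _ h

theorem BHChoice.hasLength_top [Nontrivial k] (hA : IsHPA k S) (hp : IsPureAlgebra k S)
    {B : BHChoice k S} (hB : B.IsShelling) (σ : AnyCell k S) (hσ : IsCritical B.matching σ) :
    σ.2.2.top.HasLength σ.2.2.dim :=
  σ.2.2.hasLength_top hA hp (BHChoice.inner_mem_facets_of_isCritical hB hσ)

end BabsonHershResolution

end HPA

end

theorem mainTheorem6 {k : Type*} [CommRing k] [IsNoetherianRing k] [Nontrivial k]
    {V : Type*} [Fintype V] [Quiver V] [∀ a b : V, Finite (a ⟶ b)] [HPA.AcyclicQuiver V]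
    (S : HPA.PathRelations V) (hA : HPA.IsHPA k S)
    (h : ∀ (a b : V) (p : HPA.PathClass k S a b),
      HPA.IsShellable (HPA.orderComplex p.openInterval) ∨
      HPA.IsFinitePointSet (HPA.orderComplex p.openInterval)) :
    HPA.IsKoszul (HPA.lengthGrading k S) ∧
    (∃ B : HPA.BHChoice k S, B.IsShelling) ∧
    ∀ B : HPA.BHChoice k S, B.IsShelling →
      HPA.IsAcyclicMatching B.matching ∧
      HPA.IsProjectiveResolution B.matching ∧
      HPA.IsMinimal B.matching := by
  have hs : ∀ (a b : V) (p : HPA.PathClass k S a b),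
      HPA.IsShellable (HPA.orderComplex p.openInterval) :=
    fun a b p => (h a b p).elim id HPA.IsFinitePointSet.isShellable
  have hp : HPA.IsPureAlgebra k S := HPA.isPureAlgebra_of_isShellable hs
  have hex := HPA.exists_bhChoice hs
  refine ⟨?_, hex, fun B hB => ?_⟩
  -- Koszulness does not refer to a matching, so any one choice of shellings and base points will
  -- do.
  · obtain ⟨B, hB⟩ := hex
    exact HPA.isKoszul hA (HPA.BHChoice.isAcyclicMatching hB hA) B.isVertical hp
      (HPA.BHChoice.hasLength_top hA hp hB) B.isCritical_vertex
  · have hM := HPA.BHChoice.isAcyclicMatching hB hA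
    exact ⟨hM, HPA.isProjectiveResolution hA hM B.isVertical B.isCritical_vertex,
      HPA.isMinimal hA hM B.isVertical hp (HPA.BHChoice.hasLength_top hA hp hB)⟩
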